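/- **Setting.** Consider a discounted constrained Markov decision process with measurable state and action spaces $\mathcal S,\mathcal A$, transition kernel $P$, initial distribution $\rho$, discount $\gamma\in(0,1)$, measurable reward $r_0:\mathcal S\times\mathcal A\to[0,1]$ and utilities $r_1,\dots,r_m:\mathcal S\times\mathcal A\to[-1,1]$, $m\ge 1$. For a stationary stochastic policy $\pi$ let $V_i^\pi(\rho)=\mathbb E\sum_{t\ge0}\gamma^t r_i(s_t,a_t)$, let $d_\rho^\pi=(1-\gamma)\sum_{t\ge 0}\gamma^t\,\mathbb P((s_t,a_t)\in\cdot)$, and let $A_i^\pi=Q_i^\pi-V_i^\pi$ be the advantage functions. Let $\pi^*$ maximize $V_0^\pi(\rho)$ subject to $V_i^\pi(\rho)\ge0$, $i\in[m]$, over all stationary stochastic policies. Let $\pi_\theta$, $\theta\in\mathbb R^d$, be policies with positive densities $\pi_\theta(a|s)$ with respect to a $\sigma$-finite reference measure on $\mathcal A$, with $\theta\mapsto\log\pi_\theta(a|s)$ twice continuously differentiable. Write $V_i^\theta=V_i^{\pi_\theta}(\rho)$, $\Theta=\{\theta: V_i^\theta\ge 0,\ i\in[m]\}$, and $F^\theta=\mathbb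 E_{d_\rho^{\pi_\theta}}[\nabla\log\pi_\theta(\nabla\log\pi_\theta)^{T}]$. **Assumptions.** 1. $\|\nabla_\theta\log\pi_\theta(a|s)\|\le M_g$ and $\|\nabla^2_\theta\log\pi_\theta(a|s)\|\le M_h$ for all $\theta\in\Theta$ and all $(s,a)$. 2. (Slater) $V_i^{\theta_0}\ge\nu_s>0$ for all $i\in[m]$, at the starting point $\theta_0$. 3. (Extended MFCQ) There are $0<\nu_{\rm emf}\le\nu_s$ and $\ell>0$ such that every $\theta\in\Theta$ admits a unit vector $s_\theta$ with $\langle s_\theta,\nabla V_i^\theta\rangle>\ell$ for all $i\in[m]$ with $0<V_i^\theta\le\nu_{\rm emf}$. Without loss of generality $\ell\le\frac12$. 4. (Relaxed Fisher non-degeneracy) For all $\theta\in\Theta$, every non-zero eigenvalue of $F^\theta$ is at least $\mu_F>0$. 5. (Bounded transfer error) For all $\theta\in\Theta$ and $i\in\{0,\dots,m\}$, $\mathbb E_{d_\rho^{\pi^*}}\big[(A_i^{\pi_\theta}-(1-\gamma)\langle\mu_i^*,\nabla_\theta\log\pi_\theta\rangle)^2\big]\le\varepsilon_{bias}$, where $\mu_i^*=(F^\theta)^\dagger\nabla_\theta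 V_i^\theta$ and $\dagger$ is the Moore–Penrose pseudo-inverse. **Algorithm LB-SGD.** The input is $\theta_0,M_g,M_h,\eta,\delta,n,H,T$. Put $$M=\tfrac{M_g^2+M_h}{(1-\gamma)^2},\quad b^0=\tfrac{\gamma^H}{1-\gamma},\quad b^1=\tfrac{M_g\gamma^H}{1-\gamma}\sqrt{\tfrac1{1-\gamma}+H},\quad \sigma^0=\tfrac{\sqrt2}{\sqrt n(1-\gamma)},\quad \sigma^1=\tfrac{2\sqrt2M_g}{\sqrt n(1-\gamma)^{3/2}}.$$ At iteration $t=0,\dots,T-1$ draw $n$ independent trajectories $(s^j_h,a^j_h)_{h<H}$ of $\pi_{\theta_t}$ from $\rho$ and form $$\hat V_i=\tfrac1n\sum_j\sum_{h<H}\gamma^hr_i(s_h^j,a_h^j),\qquad \hat\nabla V_i=\tfrac1n\sum_j\sum_{h<H}\sum_{h'\le h}\gamma^hr_i(s_h^j,a_h^j)\nabla_\theta\log\pi_{\theta_t}(a_{h'}^j|s_{h'}^j),\qquad \hat g=\hat\nabla V_0+\eta\sum_{i=1}^m\hat\nabla V_i/\hat V_i .$$ If $\|\hat g\|\le\eta/2$,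 stop and return $\theta_t$. Otherwise set $\theta_{t+1}=\theta_t+\gamma_t\hat g$, where $$\gamma_t=\min\Big\{\tfrac1{\hat M_t},\ \tfrac{1}{\|\hat g\|}\min_{i\in[m]}\tfrac{\underline\alpha_i}{\sqrt{M\underline\alpha_i}+2|\overline\beta_i|}\Big\},\qquad \hat M_t=M+\sum_{i=1}^m\tfrac{10M\eta}{\underline\alpha_i}+8\eta\sum_{i=1}^m\tfrac{\overline\beta_i^2}{\underline\alpha_i^2},$$ $$\underline\alpha_i=\hat V_i-b^0-\sigma^0\sqrt{\ln\tfrac2\delta},\qquad \overline\beta_i=\big|\langle\hat\nabla V_i,\hat g/\|\hat g\|\rangle\big|+\sigma^1\sqrt{\ln\tfrac{e^{1/4}}\delta}+b^1 .$$ If the algorithm never stops early, return $\theta_T$. Let $\theta_{\rm out}$ be the returned parameter. After an early stop at $\theta_t$, put $\theta_{t'}=\theta_t$ for all $t'\ge t$. The number of samples (state-action pairs) used is at most $nHT$. **Claim.** There is a constant $K>0$, depending only on $m,M_g,M_h$, such that for all $\gamma,\ell,\mu_F,\nu_{\rm emf},\nu_s$ as above and every $\beta\in(0,1)$ there is $\varepsilon_0>0$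 with the following property. For every $\varepsilon\in(0,\varepsilon_0]$ there are $n,H,T\in\mathbb N$ and $\delta\in(0,1)$, depending only on $m,M_g,M_h,\gamma,\ell,\mu_F,\nu_{\rm emf},\nu_s,\beta,\varepsilon$, with $$nHT\ \le\ K\,\mu_F^{-1}\varepsilon^{-6}\ell^{-6m}(1-\gamma)^{-10-12m}\,\ln\tfrac1\ell\,\ln^3\tfrac1\varepsilon ,$$ such that for every process, parameterization, $\theta_0$, $\pi^*$ and $\varepsilon_{bias}\ge0$ satisfying Assumptions 1–5 with these constants, LB-SGD with $\eta=\varepsilon$ satisfies, with probability at least $1-\beta$, both $V_i^{\theta_t}\ge0$ for all $i\in[m]$ and all $t\in\{0,\dots,T\}$ (safe exploration) and $$V_0^{\pi^*}(\rho)-V_0^{\theta_{\rm out}}\ \le\ K\Big(\varepsilon\ln\tfrac1\varepsilon+\tfrac{\varepsilon}{\mu_F}\Big)+K\,\sqrt{\varepsilon_{bias}}\;\ell^{-m}(1-\gamma)^{-2m-1}.$$ -/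

import Mathlib

open MeasureTheory ProbabilityTheory

noncomputable section

namespace SafeRL

/-! ## Constrained Markov decision processes -/

/-- A discounted infinite-horizon CMDP with `m` constraints. The state and action spaces are
arbitrary measurable spaces; `reward 0` is the objective reward and `reward i.succ`, `i : Fin m`,
are the utilities of the constraints. -/
structure CMDP (S A : Type*) [MeasurableSpace S] [MeasurableSpace A] (m : ℕ) where
  P : Kernel (S × A) S
  markov_P : IsMarkovKernel P
  ρ : Measure S
  prob_ρ : IsProbabilityMeasure ρ
  reward : Fin (m + 1) → S × A → ℝ
  measurable_reward : ∀ i, Measurable (reward i)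
  reward_zero_mem : ∀ z, reward 0 z ∈ Set.Icc (0 : ℝ) 1
  reward_succ_mem : ∀ (i : Fin m) (z), reward i.succ z ∈ Set.Icc (-1 : ℝ) 1
  γ : ℝ
  γ_pos : 0 < γ
  γ_lt_one : γ < 1

attribute [instance] CMDP.markov_P CMDP.prob_ρ

section Values

variable {S A : Type*} [MeasurableSpace S] [MeasurableSpace A] {m : ℕ}

/-- One step of the state-action chain: `s' ∼ P(· | s, a)`, then `a' ∼ π(· | s')`. -/
def saStep (C : CMDP S A m) (π : Kernel S A) [IsMarkovKernel π] : Kernel (S × A) (S × A) :=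
  (Kernel.id ×ₖ π) ∘ₖ C.P

instance (C : CMDP S A m) (π : Kernel S A) [IsMarkovKernel π] : IsMarkovKernel (saStep C π) := by
  unfold saStep; infer_instance

/-- The law of the infinite trajectory `(s₀, a₀, s₁, a₁, …)` under the stationary policy `π` when
`(s₀, a₀) ∼ μ₀` (Ionescu-Tulcea). -/
def trajLaw (C : CMDP S A m) (π : Kernel S A) [IsMarkovKernel π] (μ₀ : Measure (S × A)) :
    Measure (ℕ → S × A) :=
  Kernel.trajMeasure (X := fun _ => S × A) μ₀ fun n =>
    (saStep C π).comap (fun h : (Π _ : Finset.Iic n, S × A) => h ⟨n, Finset.mem_Iic.2 le_rfl⟩)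
      (measurable_pi_apply _)

/-- The trajectory law with `s₀ ∼ μ`, `a₀ ∼ π(· | s₀)`. -/
def trajFrom (C : CMDP S A m) (π : Kernel S A) [IsMarkovKernel π] (μ : Measure S) :
    Measure (ℕ → S × A) :=
  trajLaw C π (μ ⊗ₘ π)

/-- The infinite-horizon discounted return `∑ₜ γᵗ rᵢ(sₜ, aₜ)` of a trajectory. -/
def discountedReturn (C : CMDP S A m) (i : Fin (m + 1)) (τ : ℕ → S × A) : ℝ :=
  ∑' t : ℕ, C.γ ^ t * C.reward i (τ t)

/-- `V_i^π(ρ)`. -/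
def value (C : CMDP S A m) (π : Kernel S A) [IsMarkovKernel π] (i : Fin (m + 1)) : ℝ :=
  ∫ τ, discountedReturn C i τ ∂(trajFrom C π C.ρ)

/-- The state value function `V_i^π(s)`. -/
def stateValue (C : CMDP S A m) (π : Kernel S A) [IsMarkovKernel π] (i : Fin (m + 1))
    (s : S) : ℝ :=
  ∫ τ, discountedReturn C i τ ∂(trajFrom C π (Measure.dirac s))

/-- The state-action value function `Q_i^π(s, a)`. -/
def qValue (C : CMDP S A m) (π : Kernel S A) [IsMarkovKernel π] (i : Fin (m + 1))
    (z : S × A) : ℝ :=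
  ∫ τ, discountedReturn C i τ ∂(trajLaw C π (Measure.dirac z))

/-- The advantage function `A_i^π(s, a) = Q_i^π(s, a) - V_i^π(s)`. -/
def advantage (C : CMDP S A m) (π : Kernel S A) [IsMarkovKernel π] (i : Fin (m + 1))
    (z : S × A) : ℝ :=
  qValue C π i z - stateValue C π i z.1

/-- The discounted state-action visitation distribution
`d_ρ^π = (1 - γ) ∑ₜ γᵗ ℙ((sₜ, aₜ) ∈ ·)`. -/
def visitation (C : CMDP S A m) (π : Kernel S A) [IsMarkovKernel π] : Measure (S × A) :=
  ENNReal.ofReal (1 - C.γ) •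
    Measure.sum fun t : ℕ => ENNReal.ofReal (C.γ ^ t) • (trajFrom C π C.ρ).map fun τ => τ t

/-- `π` is an optimal stationary stochastic policy: it is feasible, and its objective value is
at least that of every feasible stationary stochastic policy. -/
def IsOptimalPolicy (C : CMDP S A m) (π : Kernel S A) [IsMarkovKernel π] : Prop :=
  (∀ i : Fin m, 0 ≤ value C π i.succ) ∧
    ∀ (π' : Kernel S A) [IsMarkovKernel π'], (∀ i : Fin m, 0 ≤ value C π' i.succ) →
      value C π' 0 ≤ value C π 0

end Values

/-! ## Parameterized policies -/

/-- The parameter space `ℝᵈ` with its Euclidean norm. -/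
abbrev Param (d : ℕ) := EuclideanSpace ℝ (Fin d)

/-- A policy parameterization `θ ↦ π_θ`, `θ ∈ ℝᵈ`: `π_θ(· | s)` has the positive density
`density θ s` with respect to a σ-finite reference measure on the action space (the counting
measure for discrete actions, Lebesgue measure for continuous ones), and `log π_θ(a | s)` is
twice continuously differentiable in `θ`. -/
structure PolicyClass (S A : Type*) [MeasurableSpace S] [MeasurableSpace A] (d : ℕ) where
  base : Measure A
  sigmaFinite_base : SigmaFinite base
  density : Param d → S → A → ℝ
  density_pos : ∀ θ s a, 0 < density θ s a
  measurable_density : ∀ θ, Measurable (Function.uncurry (density θ))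
  lintegral_density : ∀ θ s, ∫⁻ a, ENNReal.ofReal (density θ s a) ∂base = 1
  contDiff_log : ∀ s a, ContDiff ℝ 2 fun θ => Real.log (density θ s a)

attribute [instance] PolicyClass.sigmaFinite_base

section Param

variable {S A : Type*} [MeasurableSpace S] [MeasurableSpace A] {m d : ℕ}

/-- The stationary policy `π_θ` as a Markov kernel. -/
def PolicyClass.policy (pol : PolicyClass S A d) (θ : Param d) : Kernel S A :=
  (Kernel.const S pol.base).withDensity fun s a => ENNReal.ofReal (pol.density θ s a)

instance (pol : PolicyClass S A d) (θ : Param d) : IsMarkovKernel (pol.policy θ) := by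
  refine ⟨fun s => ⟨?_⟩⟩
  have h : Measurable (Function.uncurry fun s a => ENNReal.ofReal (pol.density θ s a)) :=
    (pol.measurable_density θ).ennreal_ofReal
  rw [PolicyClass.policy, Kernel.withDensity_apply' _ h, Kernel.const_apply,
    setLIntegral_univ, pol.lintegral_density θ s]

/-- The score `∇_θ log π_θ(a | s)`. -/
def PolicyClass.score (pol : PolicyClass S A d) (θ : Param d) (z : S × A) : Param d :=
  gradient (fun θ' => Real.log (pol.density θ' z.1 z.2)) θ

/-- `V_i^θ(ρ)`. -/
def val (C : CMDP S A m) (pol : PolicyClass S A d) (i : Fin (m + 1)) (θ : Param d) : ℝ :=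
  value C (pol.policy θ) i

/-- `∇_θ V_i^θ(ρ)`. -/
def gradVal (C : CMDP S A m) (pol : PolicyClass S A d) (i : Fin (m + 1)) (θ : Param d) :
    Param d :=
  gradient (val C pol i) θ

/-- The feasible set `Θ = {θ | V_i^θ(ρ) ≥ 0, i ∈ [m]}`. -/
def feasible (C : CMDP S A m) (pol : PolicyClass S A d) : Set (Param d) :=
  {θ | ∀ i : Fin m, 0 ≤ val C pol i.succ θ}

/-- The Fisher information matrix `F^θ(ρ) = E_{(s,a) ∼ d_ρ^θ}[∇log π_θ (∇log π_θ)ᵀ]`. -/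
def fisher (C : CMDP S A m) (pol : PolicyClass S A d) (θ : Param d) :
    Matrix (Fin d) (Fin d) ℝ :=
  Matrix.of fun j k => ∫ z, pol.score θ z j * pol.score θ z k ∂(visitation C (pol.policy θ))

lemma fisher_isHermitian (C : CMDP S A m) (pol : PolicyClass S A d) (θ : Param d) :
    (fisher C pol θ).IsHermitian := by
  ext j k
  simp [fisher, mul_comm]

/-- `B† v` for the Moore-Penrose pseudo-inverse `B†` of a symmetric matrix `B` with orthonormal
eigenvectors `u_j` and eigenvalues `λ_j`: the vector `∑_{j : λ_j ≠ 0} λ_j⁻¹ ⟨u_j, v⟩ u_j`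
(recall `0⁻¹ = 0`). -/
def pinvApply {B : Matrix (Fin d) (Fin d) ℝ} (hB : B.IsHermitian) (v : Param d) : Param d :=
  ∑ j, ((hB.eigenvalues j)⁻¹ * inner ℝ (hB.eigenvectorBasis j) v) • hB.eigenvectorBasis j

/-- `μ_i^* = (F^θ(ρ))† ∇_θ V_i^θ(ρ)`. -/
def muStar (C : CMDP S A m) (pol : PolicyClass S A d) (i : Fin (m + 1)) (θ : Param d) :
    Param d :=
  pinvApply (fisher_isHermitian C pol θ) (gradVal C pol i θ)

/-- The transfer error `L(μ_i^*, θ, d_ρ^{π*})`. -/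
def transferError (C : CMDP S A m) (pol : PolicyClass S A d) (πstar : Kernel S A)
    [IsMarkovKernel πstar] (i : Fin (m + 1)) (θ : Param d) : ℝ :=
  ∫ z, (advantage C (pol.policy θ) i z
    - (1 - C.γ) * inner ℝ (muStar C pol i θ) (pol.score θ z)) ^ 2 ∂(visitation C πstar)

/-! ## Assumptions -/

/-- Gradient and Hessian of `log π_θ(a | s)` are bounded by `Mg` and `Mh` on the feasible set. -/
def BoundedScore (C : CMDP S A m) (pol : PolicyClass S A d) (Mg Mh : ℝ) : Prop :=
  ∀ θ ∈ feasible C pol, ∀ z : S × A,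
    ‖pol.score θ z‖ ≤ Mg ∧ ‖fderiv ℝ (fun θ' => pol.score θ' z) θ‖ ≤ Mh

/-- Slater's condition at the starting point. -/
def Slater (C : CMDP S A m) (pol : PolicyClass S A d) (θ₀ : Param d) (νs : ℝ) : Prop :=
  ∀ i : Fin m, νs ≤ val C pol i.succ θ₀

/-- Extended Mangasarian-Fromovitz constraint qualification. -/
def ExtendedMFCQ (C : CMDP S A m) (pol : PolicyClass S A d) (νemf ℓ : ℝ) : Prop :=
  ∀ θ ∈ feasible C pol, ∃ s : Param d, ‖s‖ = 1 ∧
    ∀ i : Fin m, 0 < val C pol i.succ θ → val C pol i.succ θ ≤ νemf →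
      ℓ < inner ℝ s (gradVal C pol i.succ θ)

/-- Relaxed Fisher non-degeneracy: on the feasible set, every non-zero eigenvalue of the Fisher
information matrix is at least `μF`. -/
def RelaxedFisher (C : CMDP S A m) (pol : PolicyClass S A d) (μF : ℝ) : Prop :=
  ∀ θ ∈ feasible C pol, ∀ j, (fisher_isHermitian C pol θ).eigenvalues j ≠ 0 →
    μF ≤ (fisher_isHermitian C pol θ).eigenvalues j

/-- Bounded transfer error. -/
def BoundedTransferError (C : CMDP S A m) (pol : PolicyClass S A d) (πstar : Kernel S A)
    [IsMarkovKernel πstar] (εbias : ℝ) : Prop :=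
  ∀ θ ∈ feasible C pol, ∀ i : Fin (m + 1), transferError C pol πstar i θ ≤ εbias

end Param

/-! ## The LB-SGD algorithm -/

/-- The input of LB-SGD, except the number of iterations and the starting point: constants `Mg`,
`Mh` (which give the smoothness parameter), barrier parameter `η`, confidence bound `δ`, batch
size `n` and truncated horizon `H`. -/
structure LBInput where
  Mg : ℝ
  Mh : ℝ
  η : ℝ
  δ : ℝ
  n : ℕ
  H : ℕ

/-- A batch of `n` trajectories truncated at horizon `H`. -/
abbrev Batch (S A : Type*) (p : LBInput) := Fin p.n → Fin p.H → S × A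

section Algorithm

variable {S A : Type*} [MeasurableSpace S] [MeasurableSpace A] {m d : ℕ}
  (C : CMDP S A m) (pol : PolicyClass S A d) (p : LBInput)

/-- The law of a batch of `n` independent truncated trajectories of `π_θ` started from `ρ`. -/
def batchLaw (θ : Param d) : Measure (Batch S A p) :=
  Measure.pi fun _ => (trajFrom C (pol.policy θ) C.ρ).map fun τ (h : Fin p.H) => τ h

/-- The Monte Carlo estimator of `V_i^θ(ρ)`. -/
def valHat (i : Fin (m + 1)) (b : Batch S A p) : ℝ :=
  (1 / (p.n : ℝ)) * ∑ j, ∑ t : Fin p.H, C.γ ^ (t : ℕ) * C.reward i (b j t)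

/-- The GPOMDP estimator of `∇_θ V_i^θ(ρ)`. -/
def gradHat (i : Fin (m + 1)) (θ : Param d) (b : Batch S A p) : Param d :=
  (1 / (p.n : ℝ)) • ∑ j, ∑ t : Fin p.H, ∑ t' ∈ Finset.Iic t,
    (C.γ ^ (t : ℕ) * C.reward i (b j t)) • pol.score θ (b j t')

/-- The estimator of the gradient of the log barrier function
`V_0^θ(ρ) + η ∑ᵢ log V_i^θ(ρ)`. -/
def barrierGradHat (θ : Param d) (b : Batch S A p) : Param d :=
  gradHat C pol p 0 θ b +
    p.η • ∑ i : Fin m, (valHat C p i.succ b)⁻¹ • gradHat C pol p i.succ θ b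

/-- The smoothness parameter `M = (Mg² + Mh) / (1 - γ)²`. -/
def smoothM : ℝ := (p.Mg ^ 2 + p.Mh) / (1 - C.γ) ^ 2

/-- Bias bound `b⁰(H)`. -/
def bias0 : ℝ := C.γ ^ p.H / (1 - C.γ)

/-- Bias bound `b¹(H)`. -/
def bias1 : ℝ := p.Mg * C.γ ^ p.H / (1 - C.γ) * √(1 / (1 - C.γ) + p.H)

/-- Deviation parameter `σ⁰(n)`. -/
def sigma0 : ℝ := √2 / (√(p.n : ℝ) * (1 - C.γ))

/-- Deviation parameter `σ¹(n)`. -/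
def sigma1 : ℝ := 2 * √2 * p.Mg / (√(p.n : ℝ) * (1 - C.γ) ^ (3 / 2 : ℝ))

/-- Lower confidence bound of the `i`-th constraint value. -/
def alphaLow (i : Fin m) (b : Batch S A p) : ℝ :=
  valHat C p i.succ b - bias0 C p - sigma0 C p * √(Real.log (2 / p.δ))

/-- Upper confidence bound of the absolute slope of the `i`-th constraint in the direction of the
step. -/
def betaUp (i : Fin m) (θ : Param d) (b : Batch S A p) : ℝ :=
  |inner ℝ (gradHat C pol p i.succ θ b)
      (‖barrierGradHat C pol p θ b‖⁻¹ • barrierGradHat C pol p θ b)|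
    + sigma1 C p * √(Real.log (Real.exp (1 / 4) / p.δ)) + bias1 C p

/-- The estimated local smoothness constant of the log barrier function. -/
def smoothHat (θ : Param d) (b : Batch S A p) : ℝ :=
  smoothM C p + ∑ i : Fin m, 10 * smoothM C p * p.η / alphaLow C p i b
    + 8 * p.η * ∑ i : Fin m, betaUp C pol p i θ b ^ 2 / alphaLow C p i b ^ 2

/-- The stepsize `γ_t`. -/
def stepsize (θ : Param d) (b : Batch S A p) : ℝ :=
  min (1 / smoothHat C pol p θ b)
    ((⨅ i : Fin m, alphaLow C p i b /
        (√(smoothM C p * alphaLow C p i b) + 2 * |betaUp C pol p i θ b|))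
      * (1 / ‖barrierGradHat C pol p θ b‖))

/-- One iteration of LB-SGD. The state of the algorithm is the current parameter together with a
flag that records whether the algorithm has stopped (line "break"); a stopped algorithm keeps its
parameter. -/
def lbStep (x : Param d × Bool) (b : Batch S A p) : Param d × Bool :=
  open Classical in
  if x.2 = true then x
  else if ‖barrierGradHat C pol p x.1 b‖ ≤ p.η / 2 then (x.1, true)
  else (x.1 + stepsize C pol p x.1 b • barrierGradHat C pol p x.1 b, false)

/-- The state of LB-SGD after `t` iterations, started at `θ₀`, when the batches are
`ω 0, …, ω (T - 1)`; it is constant for `t ≥ T`. -/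
def lbState (θ₀ : Param d) {T : ℕ} (ω : Fin T → Batch S A p) : ℕ → Param d × Bool
  | 0 => (θ₀, false)
  | t + 1 =>
    if h : t < T then lbStep C pol p (lbState θ₀ ω t) (ω ⟨t, h⟩) else lbState θ₀ ω t

/-- The iterate `θ_t`; if the algorithm breaks then `θ_t` is `θ_break` from there on, so that
`lbIterate θ₀ ω T` is the output `θ_out` of `T` iterations. -/
def lbIterate (θ₀ : Param d) {T : ℕ} (ω : Fin T → Batch S A p) (t : ℕ) : Param d :=
  (lbState C pol p θ₀ ω t).1

/-- The joint law of the batches drawn in the first `T` iterations of LB-SGD started at `θ₀`: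
given the first `t` batches, the next one is a batch of trajectories of `π_{θ_t}`. (Once the
algorithm has stopped, further batches have no effect on the iterates.) -/
def lbLaw (θ₀ : Param d) : (T : ℕ) → Measure (Fin T → Batch S A p)
  | 0 => Measure.dirac Fin.elim0
  | t + 1 => (lbLaw θ₀ t).bind fun ω =>
      (batchLaw C pol p (lbIterate C pol p θ₀ ω t)).map fun b =>
        (Fin.snoc (α := fun _ => Batch S A p) ω b : Fin (t + 1) → Batch S A p)

end Algorithm

end SafeRL

end

open SafeRL

namespace SafeRL

/-! The proof separates a deterministic analysis of log barrier ascent for an abstract smooth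
problem (`SmoothProblem`) from two facts about CMDPs: the values form such a problem, and the Monte
Carlo estimates are accurate with high probability.

Smoothness. The law of the first steps of a trajectory under π_θ has a density with respect to the
law under π_0, in which the transition kernels cancel (`lintegral_pathLaw`). One can therefore
differentiate twice under a fixed measure. Scores of different steps are orthogonal, so the second
derivative of the expected reward at time n grows only like n + 1, and discounting yields the
constant M (`abs_val_taylor_policyGrad_le`). All this happens on the open set of strictly feasible
parameters.

Safety of one step. The stepsize rule makes each constraint lose at most half of its value
(`step_length_bounds`, `half_le_of_segment`). Halving could accumulate, so a uniform lower bound κ^m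
η on the constraints is needed. It comes from an invariant on products over all subsets I of the
constraints (`ProductBound`). If the product over I is far above its bound, one halving is harmless.
Otherwise the bounds for I minus a point and I plus a point show that the constraints in I are small
while all the others are much larger. The barrier gradient is then dominated by the terms of I,
which cannot cancel because of the MFCQ direction, and the step does not decrease the product over I
(`prod_le_prod_of_small`, `ProductBound.step`).

Convergence. The performance difference lemma, applied to the objective and to the constraints with
weights η / V_i, bounds the suboptimality by mη + (Mg/μF)‖∇B‖ plus a bias term, where B is the
barrier function (`gradient_domination`). The lower bound on the constraints gives stepsizes of
order η at least, so above the level 4mη log(1/η) the gap X of B satisfies X' ≤ X - aX² with a of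
order η. Hence X ≤ 1/(at), and order η⁻² iterations suffice (`Invariant.step`, `Convergent.run`). An
early stop means that ‖∇B‖ ≤ η, which is as good.

Randomness. A dimension-free Hoeffding inequality, proved with the potential cosh‖·‖
(`cosh_norm_add_le`), and a union bound over the iterations (`measure_not_accurateRun_le`) make all
the estimates accurate; on that event the deterministic analysis applies.

Constants. With l = log(1/ε), the inputs are n of order l/ε⁴, H of order l and T of order ε⁻², so
the cost is of order l²/ε⁶ with a factor that depends on the problem constants. The third logarithm
in the claimed bound absorbs this factor once ε is small (`Schedule.cost_le`). -/

lemma integral_kernel_bind {X Y E : Type*} [MeasurableSpace X] [MeasurableSpace Y]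
    [NormedAddCommGroup E] [NormedSpace ℝ E] {μ : Measure X} [SFinite μ] {κ : Kernel X Y}
    [IsSFiniteKernel κ] {f : Y → E} (hf : Integrable f (κ ∘ₘ μ)) :
    ∫ y, f y ∂(κ ∘ₘ μ) = ∫ x, ∫ y, f y ∂κ x ∂μ := by
  have h : κ ∘ₘ μ = (κ ∘ₖ Kernel.const Unit μ) () := by
    rw [Kernel.comp_apply, Kernel.const_apply]
  rw [h] at hf ⊢
  rw [Kernel.integral_comp hf, Kernel.const_apply]

/-! ## Trajectories and values -/

section Trajectories

variable {S A : Type*} [MeasurableSpace S] [MeasurableSpace A] {m : ℕ}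
  (C : CMDP S A m) (π : Kernel S A) [IsMarkovKernel π]

instance (μ₀ : Measure (S × A)) [IsProbabilityMeasure μ₀] :
    IsProbabilityMeasure (trajLaw C π μ₀) := by
  unfold trajLaw; infer_instance

instance (μ : Measure S) [IsProbabilityMeasure μ] : IsProbabilityMeasure (trajFrom C π μ) := by
  unfold trajFrom; infer_instance

lemma saStep_apply (z : S × A) : saStep C π z = (C.P z) ⊗ₘ π := by
  rw [saStep, Kernel.comp_apply, Measure.compProd_eq_comp_prod]

/-- The Markov property in integrated form: given the history, the next pair is drawn from `saStep`
at the last pair. It drives the induction on the number of steps in the change of measure. -/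
lemma lintegral_trajLaw_succ (μ₀ : Measure (S × A)) [IsProbabilityMeasure μ₀] (n : ℕ)
    {F : (Π _ : Finset.Iic n, S × A) × (S × A) → ENNReal} (hF : Measurable F) :
    ∫⁻ τ, F (Preorder.frestrictLe n τ, τ (n + 1)) ∂trajLaw C π μ₀ =
      ∫⁻ τ, ∫⁻ z, F (Preorder.frestrictLe n τ, z) ∂saStep C π (τ n) ∂trajLaw C π μ₀ := by
  have h := Kernel.map_frestrictLe_trajMeasure_compProd_eq_map_trajMeasure
    (X := fun _ => S × A) (μ₀ := μ₀)
    (κ := fun n => (saStep C π).comap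
      (fun h : (Π _ : Finset.Iic n, S × A) => h ⟨n, Finset.mem_Iic.2 le_rfl⟩)
      (measurable_pi_apply _)) (a := n)
  have h2 := congrArg (fun μ => ∫⁻ x, F x ∂μ) h
  beta_reduce at h2
  rw [lintegral_map hF (by fun_prop), Measure.lintegral_compProd hF,
    lintegral_map (hF.lintegral_kernel_prod_right' ) (by fun_prop)] at h2
  exact h2.symm

lemma trajLaw_map_zero (μ₀ : Measure (S × A)) [IsProbabilityMeasure μ₀] :
    (trajLaw C π μ₀).map (fun τ => τ 0) = μ₀ := by
  have h1 : (fun τ : ℕ → S × A => τ 0) =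
      (MeasurableEquiv.piUnique (fun _ : Finset.Iic 0 => S × A)) ∘
        (Preorder.frestrictLe (π := fun _ => S × A) 0) := by
    ext τ <;> rfl
  rw [h1, ← Measure.map_map (by fun_prop) (by fun_prop), trajLaw, Kernel.trajMeasure,
    Measure.map_comp _ _ (by fun_prop), Kernel.traj_map_frestrictLe, Kernel.partialTraj_self,
    Measure.id_comp]
  exact MeasurableEquiv.map_map_symm _

/-- The `n`-step transition kernel of the state-action chain. -/
noncomputable def saIter : ℕ → Kernel (S × A) (S × A)
  | 0 => Kernel.id
  | n + 1 => saIter n ∘ₖ saStep C π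

instance (n : ℕ) : IsMarkovKernel (saIter C π n) := by
  induction n with
  | zero => unfold saIter; infer_instance
  | succ n ih => unfold saIter; infer_instance

lemma saIter_succ' (n : ℕ) : saIter C π (n + 1) = saStep C π ∘ₖ saIter C π n := by
  induction n with
  | zero => simp [saIter]
  | succ n ih => rw [saIter, ih, Kernel.comp_assoc, ← saIter, ih]

lemma trajLaw_map_succ (μ₀ : Measure (S × A)) [IsProbabilityMeasure μ₀] (n : ℕ) :
    (trajLaw C π μ₀).map (fun τ => τ (n + 1)) =
      saStep C π ∘ₘ (trajLaw C π μ₀).map (fun τ => τ n) := by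
  ext s hs
  have h := lintegral_trajLaw_succ C π μ₀ n (F := fun x => s.indicator 1 x.2)
    ((measurable_one.indicator hs).comp measurable_snd)
  rw [Measure.bind_apply hs (Kernel.aemeasurable _), lintegral_map (Kernel.measurable_coe _ hs)
    (by fun_prop), ← lintegral_indicator_one (μ := Measure.map _ _) hs,
    lintegral_map (measurable_one.indicator hs) (by fun_prop)]
  rw [h]
  simp [lintegral_indicator_one hs]

lemma trajLaw_map_eq (μ₀ : Measure (S × A)) [IsProbabilityMeasure μ₀] (n : ℕ) :
    (trajLaw C π μ₀).map (fun τ => τ n) = saIter C π n ∘ₘ μ₀ := by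
  induction n with
  | zero => rw [trajLaw_map_zero, saIter, Measure.id_comp]
  | succ n ih => rw [trajLaw_map_succ, ih, saIter_succ', Measure.comp_assoc]

lemma abs_reward_le (i : Fin (m + 1)) (z : S × A) : |C.reward i z| ≤ 1 := by
  refine Fin.cases ?_ (fun i => ?_) i
  · have := C.reward_zero_mem z
    rw [abs_le]; constructor <;> linarith [this.1, this.2]
  · exact abs_le.2 (C.reward_succ_mem i z)

lemma integrable_of_bounded {X E : Type*} [MeasurableSpace X] [NormedAddCommGroup E]
    {μ : Measure X} [IsFiniteMeasure μ] {f : X → E} (hf : AEStronglyMeasurable f μ) {B : ℝ}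
    (hB : ∀ x, ‖f x‖ ≤ B) : Integrable f μ :=
  Integrable.of_bound hf B (Filter.Eventually.of_forall hB)

lemma abs_integral_le_of_abs_le {X : Type*} [MeasurableSpace X] {μ : Measure X}
    [IsProbabilityMeasure μ] {f : X → ℝ} {B : ℝ} (hB : ∀ x, |f x| ≤ B) : |∫ x, f x ∂μ| ≤ B := by
  have := norm_integral_le_of_norm_le_const (μ := μ) (f := f) (C := B)
    (Filter.Eventually.of_forall hB)
  simpa using this

lemma integrable_reward (i : Fin (m + 1)) (μ : Measure (S × A)) [IsFiniteMeasure μ] :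
    Integrable (C.reward i) μ :=
  integrable_of_bounded (C.measurable_reward i).aestronglyMeasurable (abs_reward_le C i)

/-- Expected reward at time `n` when `(s₀, a₀) = z`. -/
noncomputable def rewardAt (i : Fin (m + 1)) (n : ℕ) (z : S × A) : ℝ :=
  ∫ x, C.reward i x ∂(saIter C π n z)

lemma measurable_rewardAt (i : Fin (m + 1)) (n : ℕ) : Measurable (rewardAt C π i n) :=
  ((C.measurable_reward i).stronglyMeasurable.integral_kernel).measurable

lemma abs_rewardAt_le (i : Fin (m + 1)) (n : ℕ) (z : S × A) : |rewardAt C π i n z| ≤ 1 :=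
  abs_integral_le_of_abs_le (abs_reward_le C i)

lemma summable_discount {f : ℕ → ℝ} {B : ℝ} (hf : ∀ n, |f n| ≤ B) :
    Summable fun n => C.γ ^ n * f n := by
  refine Summable.of_norm_bounded
    ((summable_geometric_of_lt_one C.γ_pos.le C.γ_lt_one).mul_right B) fun n => ?_
  rw [norm_mul, Real.norm_of_nonneg (pow_nonneg C.γ_pos.le n)]
  exact mul_le_mul_of_nonneg_left (hf n) (pow_nonneg C.γ_pos.le n)

lemma abs_tsum_discount_le {f : ℕ → ℝ} {B : ℝ} (hf : ∀ n, |f n| ≤ B) :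
    |∑' n, C.γ ^ n * f n| ≤ B / (1 - C.γ) := by
  have h : HasSum (fun n => C.γ ^ n * B) ((1 - C.γ)⁻¹ * B) :=
    (hasSum_geometric_of_lt_one C.γ_pos.le C.γ_lt_one).mul_right B
  have := tsum_of_norm_bounded (f := fun n => C.γ ^ n * f n) h fun n => by
    rw [norm_mul, Real.norm_of_nonneg (pow_nonneg C.γ_pos.le n)]
    exact mul_le_mul_of_nonneg_left (hf n) (pow_nonneg C.γ_pos.le n)
  rw [Real.norm_eq_abs] at this
  rwa [div_eq_inv_mul]

lemma integral_tsum_discount {X : Type*} [MeasurableSpace X] (μ : Measure X)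
    [IsProbabilityMeasure μ] {f : ℕ → X → ℝ} {B : ℝ} (hm : ∀ n, Measurable (f n))
    (hf : ∀ n x, |f n x| ≤ B) :
    ∫ x, ∑' n, C.γ ^ n * f n x ∂μ = ∑' n, C.γ ^ n * ∫ x, f n x ∂μ := by
  have hI : ∀ n, Integrable (f n) μ := fun n =>
    integrable_of_bounded (hm n).aestronglyMeasurable (hf n)
  rw [← integral_tsum_of_summable_integral_norm (F := fun n x => C.γ ^ n * f n x)]
  · simp_rw [integral_const_mul]
  · exact fun n => (hI n).const_mul _
  · simp_rw [norm_mul, integral_const_mul]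
    refine Summable.of_norm_bounded
      ((summable_geometric_of_lt_one C.γ_pos.le C.γ_lt_one).mul_right B) fun n => ?_
    rw [norm_mul, norm_norm, Real.norm_of_nonneg (pow_nonneg C.γ_pos.le n)]
    refine mul_le_mul_of_nonneg_left ?_ (pow_nonneg C.γ_pos.le n)
    exact abs_integral_le_of_abs_le fun x => by rw [abs_norm]; exact hf n x

lemma integral_discountedReturn (i : Fin (m + 1)) (μ₀ : Measure (S × A))
    [IsProbabilityMeasure μ₀] :
    ∫ τ, discountedReturn C i τ ∂trajLaw C π μ₀ =
      ∑' n, C.γ ^ n * ∫ τ, C.reward i (τ n) ∂trajLaw C π μ₀ := by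
  have := C.measurable_reward i
  exact integral_tsum_discount C _ (fun n => by fun_prop) fun n τ => abs_reward_le C i (τ n)

lemma integral_reward_trajLaw (i : Fin (m + 1)) (μ₀ : Measure (S × A))
    [IsProbabilityMeasure μ₀] (n : ℕ) :
    ∫ τ, C.reward i (τ n) ∂trajLaw C π μ₀ = ∫ z, rewardAt C π i n z ∂μ₀ := by
  have h := trajLaw_map_eq C π μ₀ n
  rw [← integral_map (φ := fun τ : ℕ → S × A => τ n)
    (measurable_pi_apply n).aemeasurable
    (C.measurable_reward i).aestronglyMeasurable, h, integral_kernel_bind]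
  · rfl
  · exact integrable_reward C i _

lemma qValue_eq (i : Fin (m + 1)) (z : S × A) :
    qValue C π i z = ∑' n, C.γ ^ n * rewardAt C π i n z := by
  rw [qValue, integral_discountedReturn]
  congr! 3 with n
  rw [integral_reward_trajLaw, integral_dirac' _ _ (measurable_rewardAt C π i n).stronglyMeasurable]

lemma measurable_qValue (i : Fin (m + 1)) : Measurable (qValue C π i) := by
  have : qValue C π i = fun z => ∑' n, C.γ ^ n * rewardAt C π i n z := funext (qValue_eq C π i)
  rw [this]
  exact Measurable.tsum fun n => (measurable_rewardAt C π i n).const_mul _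

lemma abs_qValue_le (i : Fin (m + 1)) (z : S × A) : |qValue C π i z| ≤ 1 / (1 - C.γ) := by
  rw [qValue_eq]
  exact abs_tsum_discount_le C fun n => abs_rewardAt_le C π i n z

lemma integral_discountedReturn_eq_qValue (i : Fin (m + 1)) (μ₀ : Measure (S × A))
    [IsProbabilityMeasure μ₀] :
    ∫ τ, discountedReturn C i τ ∂trajLaw C π μ₀ = ∫ z, qValue C π i z ∂μ₀ := by
  simp_rw [integral_discountedReturn, integral_reward_trajLaw, qValue_eq]
  exact (integral_tsum_discount C _ (measurable_rewardAt C π i)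
    (fun n z => abs_rewardAt_le C π i n z)).symm

lemma qValue_bellman (i : Fin (m + 1)) (z : S × A) :
    qValue C π i z = C.reward i z + C.γ * ∫ x, qValue C π i x ∂saStep C π z := by
  have h1 : ∫ x, qValue C π i x ∂saStep C π z = ∑' n, C.γ ^ n * rewardAt C π i (n + 1) z := by
    simp_rw [qValue_eq]
    rw [integral_tsum_discount C _ (measurable_rewardAt C π i)
      (fun n z => abs_rewardAt_le C π i n z)]
    congr! 3 with n
    rw [rewardAt, saIter, Kernel.comp_apply, integral_kernel_bind (integrable_reward C i _)]
    rfl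
  rw [h1, qValue_eq, (summable_discount C fun n => abs_rewardAt_le C π i n z).tsum_eq_zero_add,
    ← tsum_mul_left]
  congr 1
  · simp [rewardAt, saIter, Kernel.id_apply,
      integral_dirac' _ _ (C.measurable_reward i).stronglyMeasurable]
  · congr! 2 with n
    ring

lemma stateValue_eq (i : Fin (m + 1)) (s : S) :
    stateValue C π i s = ∫ a, qValue C π i (s, a) ∂π s := by
  rw [stateValue, trajFrom, integral_discountedReturn_eq_qValue, Measure.integral_compProd,
    integral_dirac']
  · exact (measurable_qValue C π i).stronglyMeasurable.integral_kernel_prod_right'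
  · exact integrable_of_bounded (measurable_qValue C π i).aestronglyMeasurable (abs_qValue_le C π i)

lemma measurable_stateValue (i : Fin (m + 1)) : Measurable (stateValue C π i) := by
  have : stateValue C π i = fun s => ∫ a, qValue C π i (s, a) ∂π s := funext (stateValue_eq C π i)
  rw [this]
  exact (measurable_qValue C π i).stronglyMeasurable.integral_kernel_prod_right'.measurable

lemma abs_stateValue_le (i : Fin (m + 1)) (s : S) : |stateValue C π i s| ≤ 1 / (1 - C.γ) := by
  rw [stateValue_eq]
  exact abs_integral_le_of_abs_le fun a => abs_qValue_le C π i _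

lemma integral_qValue_compProd (i : Fin (m + 1)) (μ : Measure S) [IsProbabilityMeasure μ] :
    ∫ z, qValue C π i z ∂(μ ⊗ₘ π) = ∫ s, stateValue C π i s ∂μ := by
  rw [Measure.integral_compProd (integrable_of_bounded
    (measurable_qValue C π i).aestronglyMeasurable (abs_qValue_le C π i))]
  simp_rw [stateValue_eq]

lemma value_eq_integral_stateValue (i : Fin (m + 1)) :
    value C π i = ∫ s, stateValue C π i s ∂C.ρ := by
  rw [value, trajFrom, integral_discountedReturn_eq_qValue, integral_qValue_compProd]

lemma value_eq_tsum (i : Fin (m + 1)) :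
    value C π i = ∑' n, C.γ ^ n * ∫ τ, C.reward i (τ n) ∂trajFrom C π C.ρ := by
  rw [value, trajFrom, integral_discountedReturn]

lemma abs_value_le (i : Fin (m + 1)) : |value C π i| ≤ 1 / (1 - C.γ) := by
  rw [value_eq_integral_stateValue]
  exact abs_integral_le_of_abs_le (abs_stateValue_le C π i)

lemma advantage_eq (i : Fin (m + 1)) (z : S × A) :
    advantage C π i z =
      C.reward i z + C.γ * (∫ s, stateValue C π i s ∂C.P z) - stateValue C π i z.1 := by
  rw [advantage, qValue_bellman, saStep_apply, integral_qValue_compProd]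

lemma measurable_advantage (i : Fin (m + 1)) : Measurable (advantage C π i) :=
  (measurable_qValue C π i).sub ((measurable_stateValue C π i).comp measurable_fst)

lemma abs_advantage_le (i : Fin (m + 1)) (z : S × A) :
    |advantage C π i z| ≤ 2 / (1 - C.γ) := by
  have h1 := abs_qValue_le C π i z
  have h2 := abs_stateValue_le C π i z.1
  calc _ ≤ |qValue C π i z| + |stateValue C π i z.1| := abs_sub _ _
    _ ≤ 1 / (1 - C.γ) + 1 / (1 - C.γ) := add_le_add h1 h2
    _ = _ := by ring

/-! ### Visitation distribution and performance difference -/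

lemma hasSum_visitation_weights :
    HasSum (fun t => (1 - C.γ) * C.γ ^ t) 1 := by
  have h := (hasSum_geometric_of_lt_one C.γ_pos.le C.γ_lt_one).mul_left (1 - C.γ)
  rwa [mul_inv_cancel₀ (by linarith [C.γ_lt_one])] at h

instance : IsProbabilityMeasure (visitation C π) := by
  constructor
  have h1 : ∀ t : ℕ, ((trajFrom C π C.ρ).map fun τ => τ t) Set.univ = 1 := fun t => by
    rw [Measure.map_apply (by fun_prop) .univ, Set.preimage_univ, measure_univ]
  simp only [visitation, Measure.smul_apply, smul_eq_mul, Measure.sum_apply _ MeasurableSet.univ,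
    h1, mul_one]
  rw [← ENNReal.ofReal_tsum_of_nonneg (fun n => pow_nonneg C.γ_pos.le n)
    (summable_geometric_of_lt_one C.γ_pos.le C.γ_lt_one),
    ← ENNReal.ofReal_mul (by linarith [C.γ_lt_one]), ← tsum_mul_left,
    (hasSum_visitation_weights C).tsum_eq, ENNReal.ofReal_one]

lemma integral_visitation {f : S × A → ℝ} (hf : Measurable f) {B : ℝ} (hB : ∀ z, |f z| ≤ B) :
    ∫ z, f z ∂visitation C π = (1 - C.γ) * ∑' t, C.γ ^ t * ∫ τ, f (τ t) ∂trajFrom C π C.ρ := by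
  have hI : Integrable f (visitation C π) := integrable_of_bounded hf.aestronglyMeasurable hB
  have hγ : 0 < 1 - C.γ := by linarith [C.γ_lt_one]
  have hI2 : Integrable f (Measure.sum fun t : ℕ =>
      ENNReal.ofReal (C.γ ^ t) • (trajFrom C π C.ρ).map fun τ => τ t) := by
    rw [visitation, integrable_smul_measure] at hI
    · exact hI
    · simpa using hγ
    · simp
  rw [visitation, integral_smul_measure, integral_sum_measure hI2, ENNReal.toReal_ofReal hγ.le,
    smul_eq_mul]
  congr! 3 with t
  rw [integral_smul_measure, ENNReal.toReal_ofReal (pow_nonneg C.γ_pos.le t), smul_eq_mul,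
    integral_map (measurable_pi_apply t).aemeasurable hf.aestronglyMeasurable]

lemma trajFrom_map_zero_fst (μ : Measure S) [IsProbabilityMeasure μ] :
    (trajFrom C π μ).map (fun τ => (τ 0).1) = μ := by
  have h : (fun τ : ℕ → S × A => (τ 0).1) = Prod.fst ∘ fun τ => τ 0 := rfl
  rw [h, ← Measure.map_map (by fun_prop) (by fun_prop), trajFrom, trajLaw_map_zero]
  exact Measure.fst_compProd μ π

lemma integral_next_state (μ₀ : Measure (S × A)) [IsProbabilityMeasure μ₀] {f : S → ℝ}
    (hf : Measurable f) {B : ℝ} (hB : ∀ s, |f s| ≤ B) (t : ℕ) :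
    ∫ τ, f (τ (t + 1)).1 ∂trajLaw C π μ₀ =
      ∫ τ, ∫ s, f s ∂C.P (τ t) ∂trajLaw C π μ₀ := by
  have hm : Measurable fun z : S × A => f z.1 := hf.comp measurable_fst
  have e1 := integral_map (μ := trajLaw C π μ₀) (φ := fun τ : ℕ → S × A => τ (t + 1))
    (measurable_pi_apply _).aemeasurable hm.aestronglyMeasurable
  rw [← e1, trajLaw_map_succ, integral_kernel_bind
    (integrable_of_bounded hm.aestronglyMeasurable fun z => hB _), integral_map
    (measurable_pi_apply t).aemeasurable
    hm.stronglyMeasurable.integral_kernel.aestronglyMeasurable]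
  congr with τ
  rw [saStep_apply, Measure.integral_compProd
    (integrable_of_bounded hm.aestronglyMeasurable fun z => hB _)]
  simp

lemma integral_advantage_trajFrom (π' : Kernel S A) [IsMarkovKernel π'] (i : Fin (m + 1))
    (t : ℕ) :
    ∫ τ, advantage C π i (τ t) ∂trajFrom C π' C.ρ =
      (∫ τ, C.reward i (τ t) ∂trajFrom C π' C.ρ) +
        (C.γ * (∫ τ, stateValue C π i (τ (t + 1)).1 ∂trajFrom C π' C.ρ) -
          ∫ τ, stateValue C π i (τ t).1 ∂trajFrom C π' C.ρ) := by
  have hr := C.measurable_reward i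
  have hV := measurable_stateValue C π i
  have hPm : Measurable fun z => ∫ s, stateValue C π i s ∂C.P z :=
    hV.stronglyMeasurable.integral_kernel.measurable
  have e : ∫ τ, stateValue C π i (τ (t + 1)).1 ∂trajFrom C π' C.ρ = _ :=
    integral_next_state C π' (C.ρ ⊗ₘ π') hV (abs_stateValue_le C π i) t
  have i1 : Integrable (fun τ : ℕ → S × A => C.reward i (τ t)) (trajFrom C π' C.ρ) :=
    integrable_of_bounded (hr.comp (measurable_pi_apply t)).aestronglyMeasurable
      fun τ => abs_reward_le C i _
  have i2 : Integrable (fun τ : ℕ → S × A => ∫ s, stateValue C π i s ∂C.P (τ t))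
      (trajFrom C π' C.ρ) :=
    integrable_of_bounded (hPm.comp (measurable_pi_apply t)).aestronglyMeasurable
      fun τ => abs_integral_le_of_abs_le (abs_stateValue_le C π i)
  have i3 : Integrable (fun τ : ℕ → S × A => stateValue C π i (τ t).1) (trajFrom C π' C.ρ) :=
    integrable_of_bounded
      (hV.comp (measurable_fst.comp (measurable_pi_apply t))).aestronglyMeasurable
      fun τ => abs_stateValue_le C π i _
  have i12 := i1.add (i2.const_mul C.γ)
  have h := integral_sub i12 i3
  have h' := integral_add i1 (i2.const_mul C.γ)
  rw [integral_const_mul] at h'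
  simp_rw [advantage_eq]
  rw [e]
  refine h.trans ?_
  refine (congrArg (· - _) h').trans ?_
  exact add_sub_assoc _ _ _

/-- The performance difference lemma. -/
lemma performance_difference (π' : Kernel S A) [IsMarkovKernel π'] (i : Fin (m + 1)) :
    ∫ z, advantage C π i z ∂visitation C π' = (1 - C.γ) * (value C π' i - value C π i) := by
  rw [integral_visitation C π' (measurable_advantage C π i) (abs_advantage_le C π i)]
  congr 1
  have hV := measurable_stateValue C π i
  set v : ℕ → ℝ := fun t => ∫ τ, stateValue C π i (τ t).1 ∂trajFrom C π' C.ρ with hv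
  have hvb : ∀ t, |v t| ≤ 1 / (1 - C.γ) := fun t =>
    abs_integral_le_of_abs_le fun τ => abs_stateValue_le C π i _
  have h1 : ∀ t, ∫ τ, advantage C π i (τ t) ∂trajFrom C π' C.ρ =
      (∫ τ, C.reward i (τ t) ∂trajFrom C π' C.ρ) + (C.γ * v (t + 1) - v t) :=
    integral_advantage_trajFrom C π π' i
  simp_rw [h1, mul_add]
  have s1 := summable_discount C (f := fun t => ∫ τ, C.reward i (τ t) ∂trajFrom C π' C.ρ)
    (B := 1) fun t => abs_integral_le_of_abs_le fun τ => abs_reward_le C i _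
  have s2 := summable_discount C hvb
  have s3 := (summable_nat_add_iff 1).2 s2
  -- By the one-step form of the advantage, the state values telescope in the discounted sum and
  -- only the value of the initial state survives.
  have e2 : ∀ t, C.γ ^ t * (C.γ * v (t + 1) - v t) =
      C.γ ^ (t + 1) * v (t + 1) - C.γ ^ t * v t := fun t => by ring
  simp_rw [e2]
  rw [s1.tsum_add (s3.sub s2), s3.tsum_sub s2, ← value_eq_tsum, s2.tsum_eq_zero_add]
  have : v 0 = value C π i := by
    rw [value_eq_integral_stateValue]
    have e := integral_map (μ := trajFrom C π' C.ρ) (φ := fun τ : ℕ → S × A => (τ 0).1)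
      (measurable_fst.comp (measurable_pi_apply 0)).aemeasurable hV.aestronglyMeasurable
    rw [trajFrom_map_zero_fst] at e
    exact e.symm
  rw [this]
  ring

end Trajectories

/-! ## Scores and likelihoods -/

/-- A derivative is a sequential limit of difference quotients. This yields measurability of the
score from that of the densities alone. -/
lemma measurable_of_hasDerivAt {X : Type*} [MeasurableSpace X] {F : ℝ → X → ℝ} {F' : X → ℝ}
    {x₀ : ℝ} (hF : ∀ x, Measurable (F x)) (h : ∀ a, HasDerivAt (fun x => F x a) (F' a) x₀) :
    Measurable F' := by
  have hseq : Filter.Tendsto (fun n : ℕ => x₀ + 1 / ((n : ℝ) + 1)) Filter.atTop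
      (nhdsWithin x₀ {x₀}ᶜ) := by
    refine tendsto_nhdsWithin_iff.2 ⟨?_, Filter.Eventually.of_forall fun n => ?_⟩
    · simpa using tendsto_one_div_add_atTop_nhds_zero_nat.const_add x₀
    · have : (0 : ℝ) < 1 / ((n : ℝ) + 1) := by positivity
      simp only [Set.mem_compl_iff, Set.mem_singleton_iff]
      linarith
  refine measurable_of_tendsto_metrizable
    (f := fun (n : ℕ) a => slope (fun x => F x a) x₀ (x₀ + 1 / ((n : ℝ) + 1))) (fun n => ?_) ?_
  · simp only [slope, vsub_eq_sub, smul_eq_mul]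
    exact ((hF _).sub (hF _)).const_mul _
  · rw [tendsto_pi_nhds]
    exact fun a => ((hasDerivAt_iff_tendsto_slope.1 (h a)).comp hseq)

lemma measurable_of_inner {X : Type*} [MeasurableSpace X] {d : ℕ} {f : X → Param d}
    (h : ∀ v : Param d, Measurable fun x => inner ℝ (f x) v) : Measurable f := by
  have e : f = fun x => ∑ j, (inner ℝ (f x) (EuclideanSpace.basisFun (Fin d) ℝ j)) •
      EuclideanSpace.basisFun (Fin d) ℝ j := by
    funext x
    conv_lhs => rw [← (EuclideanSpace.basisFun (Fin d) ℝ).sum_repr' (f x)]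
    simp_rw [real_inner_comm]
  rw [e]
  exact Finset.measurable_fun_sum _ fun j _ => (h _).smul_const _

section Policies

variable {S A : Type*} [MeasurableSpace S] [MeasurableSpace A] {d : ℕ}
  (pol : PolicyClass S A d)

lemma measurable_density_uncurry (θ : Param d) :
    Measurable fun z : S × A => pol.density θ z.1 z.2 := pol.measurable_density θ

/-- The log-likelihood `log π_θ(a | s)`. -/
noncomputable def PolicyClass.logDensity (θ : Param d) (z : S × A) : ℝ :=
  Real.log (pol.density θ z.1 z.2)

lemma measurable_logDensity (θ : Param d) : Measurable (pol.logDensity θ) :=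
  (measurable_density_uncurry pol θ).log

lemma contDiff_logDensity (z : S × A) : ContDiff ℝ 2 fun θ => pol.logDensity θ z :=
  pol.contDiff_log z.1 z.2

lemma hasGradientAt_logDensity (θ : Param d) (z : S × A) :
    HasGradientAt (fun θ' => pol.logDensity θ' z) (pol.score θ z) θ :=
  ((contDiff_logDensity pol z).differentiable (by norm_num) θ).hasGradientAt

lemma contDiff_score (z : S × A) : ContDiff ℝ 1 fun θ => pol.score θ z := by
  have h : ContDiff ℝ 1 (fderiv ℝ fun θ => pol.logDensity θ z) :=
    (contDiff_logDensity pol z).fderiv_right (by norm_num)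
  exact (InnerProductSpace.toDual ℝ (Param d)).symm.toContinuousLinearEquiv.contDiff.comp h

lemma hasDerivAt_logDensity_line (θ v : Param d) (z : S × A) (x : ℝ) :
    HasDerivAt (fun x : ℝ => pol.logDensity (θ + x • v) z)
      (inner ℝ (pol.score (θ + x • v) z) v) x := by
  have h1 := (hasGradientAt_logDensity pol (θ + x • v) z).hasFDerivAt
  have h2 : HasDerivAt (fun x : ℝ => θ + x • v) v x := by
    simpa using ((hasDerivAt_id x).smul_const v).const_add θ
  have h3 := h1.comp_hasDerivAt x h2
  simp only [InnerProductSpace.toDual_apply_apply] at h3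
  exact h3

lemma measurable_score (θ : Param d) : Measurable (pol.score θ) := by
  refine measurable_of_inner fun v => ?_
  refine measurable_of_hasDerivAt (F := fun x z => pol.logDensity (θ + x • v) z) (x₀ := 0)
    (fun x => measurable_logDensity pol _) fun z => ?_
  simpa using hasDerivAt_logDensity_line pol θ v z 0

lemma measurable_score_uncurry : Measurable fun x : Param d × (S × A) => pol.score x.1 x.2 :=
  measurable_uncurry_of_continuous_of_measurable (u := fun θ z => pol.score θ z)
    (fun z => (contDiff_score pol z).continuous) (measurable_score pol)

lemma measurable_logDensity_uncurry :
    Measurable fun x : Param d × (S × A) => pol.logDensity x.1 x.2 :=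
  measurable_uncurry_of_continuous_of_measurable (u := fun θ z => pol.logDensity θ z)
    (fun z => (contDiff_logDensity pol z).continuous) (measurable_logDensity pol)

/-- The log-likelihood ratio of `π_θ` with respect to `π_0`. -/
noncomputable def PolicyClass.logRatio (θ : Param d) (z : S × A) : ℝ :=
  pol.logDensity θ z - pol.logDensity 0 z

lemma lintegral_policy_eq (θ : Param d) (s : S) {f : A → ENNReal} (hf : Measurable f) :
    ∫⁻ a, f a ∂pol.policy θ s = ∫⁻ a, ENNReal.ofReal (pol.density θ s a) * f a ∂pol.base := by
  have h : Measurable (Function.uncurry fun s a => ENNReal.ofReal (pol.density θ s a)) :=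
    (pol.measurable_density θ).ennreal_ofReal
  rw [PolicyClass.policy, Kernel.lintegral_withDensity _ h s hf, Kernel.const_apply]

/-- Densities are positive, so all policies are mutually absolutely continuous. The parameter 0 is
an arbitrary reference that makes every law a density against one fixed measure. -/
lemma lintegral_policy_ratio (θ : Param d) (s : S) {f : A → ENNReal} (hf : Measurable f) :
    ∫⁻ a, f a ∂pol.policy θ s =
      ∫⁻ a, f a * ENNReal.ofReal (Real.exp (pol.logRatio θ (s, a))) ∂pol.policy 0 s := by
  have hm : Measurable fun a => Real.exp (pol.logRatio θ (s, a)) :=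
    (((measurable_logDensity pol θ).sub (measurable_logDensity pol 0)).exp).comp
      measurable_prodMk_left
  rw [lintegral_policy_eq pol θ s hf, lintegral_policy_eq pol 0 s
    (f := fun a => f a * ENNReal.ofReal (Real.exp (pol.logRatio θ (s, a))))
    (hf.mul hm.ennreal_ofReal)]
  congr with a
  have h0 := pol.density_pos 0 s a
  have h1 : Real.exp (pol.logRatio θ (s, a)) = pol.density θ s a / pol.density 0 s a := by
    rw [PolicyClass.logRatio, Real.exp_sub, PolicyClass.logDensity, PolicyClass.logDensity,
      Real.exp_log (pol.density_pos θ s a), Real.exp_log h0]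
  rw [h1, mul_comm (f a), ← mul_assoc, ← ENNReal.ofReal_mul h0.le, mul_div_cancel₀ _ h0.ne']

end Policies

/-! ## Gradient domination -/

section Domination

variable {d : ℕ}

lemma pinvApply_add {B : Matrix (Fin d) (Fin d) ℝ} (hB : B.IsHermitian) (v w : Param d) :
    pinvApply hB (v + w) = pinvApply hB v + pinvApply hB w := by
  simp [pinvApply, inner_add_right, mul_add, add_smul, Finset.sum_add_distrib]

lemma pinvApply_smul {B : Matrix (Fin d) (Fin d) ℝ} (hB : B.IsHermitian) (c : ℝ) (v : Param d) :
    pinvApply hB (c • v) = c • pinvApply hB v := by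
  simp only [pinvApply, Finset.smul_sum, smul_smul, real_inner_smul_right]
  exact Finset.sum_congr rfl fun j _ => by ring_nf

lemma pinvApply_sum {ι : Type*} {B : Matrix (Fin d) (Fin d) ℝ} (hB : B.IsHermitian)
    (s : Finset ι) (v : ι → Param d) :
    pinvApply hB (∑ i ∈ s, v i) = ∑ i ∈ s, pinvApply hB (v i) := by
  classical
  induction s using Finset.induction_on with
  | empty => simp [pinvApply]
  | insert a s ha ih => rw [Finset.sum_insert ha, Finset.sum_insert ha, pinvApply_add, ih]

/-- In the eigenbasis, directions with eigenvalue zero are annihilated and the others are scaled by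
at most 1/μ. This is where the relaxed form of Fisher non-degeneracy suffices. -/
lemma norm_pinvApply_le {B : Matrix (Fin d) (Fin d) ℝ} (hB : B.IsHermitian) {μ : ℝ} (hμ : 0 < μ)
    (h : ∀ j, hB.eigenvalues j ≠ 0 → μ ≤ hB.eigenvalues j) (v : Param d) :
    ‖pinvApply hB v‖ ≤ ‖v‖ / μ := by
  have h1 : ‖pinvApply hB v‖ ^ 2 ≤ (‖v‖ / μ) ^ 2 := by
    have e1 : ‖pinvApply hB v‖ ^ 2 =
        ∑ j, ((hB.eigenvalues j)⁻¹ * inner ℝ (hB.eigenvectorBasis j) v) ^ 2 := by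
      rw [← hB.eigenvectorBasis.sum_sq_norm_inner_right]
      refine Finset.sum_congr rfl fun j _ => ?_
      rw [pinvApply, hB.eigenvectorBasis.orthonormal.inner_right_fintype, Real.norm_eq_abs, sq_abs]
    rw [e1, div_pow, ← hB.eigenvectorBasis.sum_sq_norm_inner_right v, Finset.sum_div]
    refine Finset.sum_le_sum fun j _ => ?_
    rw [mul_pow, Real.norm_eq_abs, sq_abs, div_eq_inv_mul]
    refine mul_le_mul_of_nonneg_right ?_ (sq_nonneg _)
    by_cases h0 : hB.eigenvalues j = 0
    · rw [h0]; simp; positivity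
    · have := h j h0
      rw [← inv_pow]
      exact pow_le_pow_left₀ (inv_nonneg.2 (hμ.le.trans this)) (inv_anti₀ hμ this) 2
  exact (pow_le_pow_iff_left₀ (norm_nonneg _) (by positivity) two_ne_zero).1 h1

lemma integral_le_sqrt_of_sq_le {X : Type*} [MeasurableSpace X] {μ : Measure X}
    [IsProbabilityMeasure μ] {f : X → ℝ} (hf : Measurable f) {B : ℝ} (hB : ∀ x, |f x| ≤ B)
    {e : ℝ} (he : ∫ x, f x ^ 2 ∂μ ≤ e) : ∫ x, f x ∂μ ≤ √e := by
  have h0 : 0 ≤ Var[f; μ] := variance_nonneg _ _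
  have hL : MemLp f 2 μ := MemLp.of_bound hf.aestronglyMeasurable B
    (Filter.Eventually.of_forall hB)
  rw [variance_eq_sub hL] at h0
  refine Real.le_sqrt_of_sq_le ?_
  simp only [Pi.pow_apply] at h0
  linarith

variable {S A : Type*} [MeasurableSpace S] [MeasurableSpace A] {m : ℕ}
  (C : CMDP S A m) (pol : PolicyClass S A d)

/-- The gap is the mean advantage under the visitation measure of the comparison policy, divided by
1 - γ. Replacing the advantage by its linear fit in the score costs at most √e, because the variance
of the residual is nonnegative. The mean of the fit is an inner product with the mean score. -/
lemma value_sub_val_le (πstar : Kernel S A) [IsMarkovKernel πstar] {θ : Param d} {Mg e : ℝ}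
    (hs : ∀ z, ‖pol.score θ z‖ ≤ Mg) (i : Fin (m + 1))
    (he : transferError C pol πstar i θ ≤ e) :
    value C πstar i - val C pol i θ ≤
      inner ℝ (muStar C pol i θ) (∫ z, pol.score θ z ∂visitation C πstar) + √e / (1 - C.γ) := by
  have hγ : 0 < 1 - C.γ := by linarith [C.γ_lt_one]
  have hA := measurable_advantage C (pol.policy θ) i
  have hsm := measurable_score pol θ
  have hIs : Integrable (pol.score θ) (visitation C πstar) :=
    integrable_of_bounded hsm.aestronglyMeasurable hs
  have hIA : Integrable (advantage C (pol.policy θ) i) (visitation C πstar) :=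
    integrable_of_bounded hA.aestronglyMeasurable (abs_advantage_le C _ i)
  have hinn : ∀ z, |inner ℝ (muStar C pol i θ) (pol.score θ z)| ≤ ‖muStar C pol i θ‖ * Mg :=
    fun z => (abs_real_inner_le_norm _ _).trans
      (mul_le_mul_of_nonneg_left (hs z) (norm_nonneg _))
  have h1 := integral_le_sqrt_of_sq_le (μ := visitation C πstar)
    (f := fun z => advantage C (pol.policy θ) i z
      - (1 - C.γ) * inner ℝ (muStar C pol i θ) (pol.score θ z))
    (hA.sub ((hsm.const_inner (c := muStar C pol i θ)).const_mul _))
    (B := 2 / (1 - C.γ) + (1 - C.γ) * (‖muStar C pol i θ‖ * Mg)) (fun z => by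
      refine (abs_sub _ _).trans (add_le_add (abs_advantage_le C _ i z) ?_)
      rw [abs_mul, abs_of_pos hγ]
      exact mul_le_mul_of_nonneg_left (hinn z) hγ.le) he
  rw [integral_sub hIA ((hIs.const_inner _).const_mul _), integral_const_mul,
    integral_inner hIs, performance_difference] at h1
  rw [val, ← sub_le_iff_le_add', le_div_iff₀ hγ]
  linarith

/-- Gradient domination for the log barrier function. -/
lemma gradient_domination (πstar : Kernel S A) [IsMarkovKernel πstar] {θ : Param d}
    {Mg μF e η : ℝ} (hμF : 0 < μF) (hη : 0 ≤ η)
    (hπ : ∀ i : Fin m, 0 ≤ value C πstar i.succ)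
    (hs : ∀ z, ‖pol.score θ z‖ ≤ Mg) (he : ∀ i, transferError C pol πstar i θ ≤ e)
    (hF : ∀ j, (fisher_isHermitian C pol θ).eigenvalues j ≠ 0 →
      μF ≤ (fisher_isHermitian C pol θ).eigenvalues j)
    (hV : ∀ i : Fin m, 0 < val C pol i.succ θ) :
    value C πstar 0 - val C pol 0 θ ≤ m * η
      + Mg / μF * ‖gradVal C pol 0 θ
          + η • ∑ i : Fin m, (val C pol i.succ θ)⁻¹ • gradVal C pol i.succ θ‖
      + √e / (1 - C.γ) * (1 + ∑ i : Fin m, η / val C pol i.succ θ) := by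
  set w := ∫ z, pol.score θ z ∂visitation C πstar with hw
  have hwn : ‖w‖ ≤ Mg := by
    have := norm_integral_le_of_norm_le_const (μ := visitation C πstar)
      (Filter.Eventually.of_forall hs)
    simpa using this
  set G := gradVal C pol 0 θ
    + η • ∑ i : Fin m, (val C pol i.succ θ)⁻¹ • gradVal C pol i.succ θ with hG
  -- The pseudo-inverse is linear, so the same weights η / V_i that build the barrier gradient
  -- combine the vectors μ_i^*.
  have hμ : pinvApply (fisher_isHermitian C pol θ) G = muStar C pol 0 θ
      + ∑ i : Fin m, (η / val C pol i.succ θ) • muStar C pol i.succ θ := by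
    rw [hG, pinvApply_add, pinvApply_smul, pinvApply_sum, Finset.smul_sum]
    simp_rw [pinvApply_smul, smul_smul, ← div_eq_mul_inv]
    rfl
  have h0 := value_sub_val_le C pol πstar hs 0 (he 0)
  -- Feasibility of the comparison policy makes its gap in constraint i at least -V_i; the weight η
  -- / V_i turns this into -η, and summation produces the mη.
  have h1 : ∀ i : Fin m, -η ≤ (η / val C pol i.succ θ) * inner ℝ (muStar C pol i.succ θ) w
      + √e / (1 - C.γ) * (η / val C pol i.succ θ) := fun i => by
    have := value_sub_val_le C pol πstar hs i.succ (he i.succ)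
    have hp := hV i
    have h2 : - val C pol i.succ θ ≤ inner ℝ (muStar C pol i.succ θ) w + √e / (1 - C.γ) := by
      linarith [hπ i]
    have h3 := mul_le_mul_of_nonneg_left h2 (div_nonneg hη hp.le)
    rw [mul_neg, div_mul_cancel₀ _ hp.ne'] at h3
    linarith
  have h2 := Finset.sum_le_sum fun i (_ : i ∈ Finset.univ) => h1 i
  rw [Finset.sum_add_distrib, ← Finset.mul_sum] at h2
  simp only [Finset.sum_const, Finset.card_univ, Fintype.card_fin, nsmul_eq_mul] at h2
  have h3 : inner ℝ (pinvApply (fisher_isHermitian C pol θ) G) w ≤ Mg / μF * ‖G‖ := by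
    calc _ ≤ ‖pinvApply (fisher_isHermitian C pol θ) G‖ * ‖w‖ := real_inner_le_norm _ _
      _ ≤ (‖G‖ / μF) * Mg := mul_le_mul (norm_pinvApply_le _ hμF hF G) hwn (norm_nonneg _)
          (by positivity)
      _ = _ := by ring
  rw [hμ, inner_add_left, sum_inner] at h3
  simp_rw [real_inner_smul_left] at h3
  linarith

end Domination

/-! ## Likelihood ratios of trajectories -/

/-- Appends a step to a history. -/
def histSnoc {Z : Type*} (n : ℕ) (x : (Π _ : Finset.Iic n, Z) × (Z)) :
    Π _ : Finset.Iic (n + 1), Z :=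
  fun k => if h : k.1 ≤ n then x.1 ⟨k.1, Finset.mem_Iic.2 h⟩ else x.2

lemma measurable_histSnoc {Z : Type*} [MeasurableSpace Z] (n : ℕ) :
    Measurable (histSnoc (Z := Z) n) := by
  refine measurable_pi_iff.2 fun k => ?_
  by_cases h : k.1 ≤ n
  · simp only [histSnoc, h, dite_true]
    exact (measurable_pi_apply _).comp measurable_fst
  · simp only [histSnoc, h, dite_false]
    exact measurable_snd

lemma histSnoc_frestrictLe {Z : Type*} (n : ℕ) (τ : ℕ → Z) :
    histSnoc n (Preorder.frestrictLe n τ, τ (n + 1)) = Preorder.frestrictLe (n + 1) τ := by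
  funext k
  by_cases h : k.1 ≤ n
  · simp [histSnoc, h]
  · have h2 : k.1 = n + 1 := le_antisymm (Finset.mem_Iic.1 k.2) (by omega)
    simp [histSnoc, h2]

section Likelihood

variable {S A : Type*} [MeasurableSpace S] [MeasurableSpace A] {m d : ℕ}
  (C : CMDP S A m) (pol : PolicyClass S A d)

/-- The law of the trajectory of `π_θ` started from `ρ`. -/
noncomputable abbrev pathLaw (θ : Param d) : Measure (ℕ → S × A) :=
  trajFrom C (pol.policy θ) C.ρ

/-- The log-likelihood ratio of the first `n + 1` steps of a trajectory, as a function of these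
steps. -/
noncomputable def logRatioHist (n : ℕ) (θ : Param d) (h : Π _ : Finset.Iic n, S × A) : ℝ :=
  ∑ k : Finset.Iic n, pol.logRatio θ (h k)

/-- The likelihood ratio of the first `n + 1` steps of a trajectory. -/
noncomputable def pathRatio (n : ℕ) (θ : Param d) (τ : ℕ → S × A) : ℝ :=
  Real.exp (∑ k ∈ Finset.range (n + 1), pol.logRatio θ (τ k))

lemma pathRatio_pos (n : ℕ) (θ : Param d) (τ : ℕ → S × A) : 0 < pathRatio pol n θ τ :=
  Real.exp_pos _

lemma measurable_logRatio (θ : Param d) : Measurable (pol.logRatio θ) :=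
  (measurable_logDensity pol θ).sub (measurable_logDensity pol 0)

lemma measurable_logRatio_uncurry :
    Measurable fun x : Param d × (S × A) => pol.logRatio x.1 x.2 :=
  (measurable_logDensity_uncurry pol).sub ((measurable_logDensity pol 0).comp measurable_snd)

lemma measurable_logRatioHist (n : ℕ) (θ : Param d) :
    Measurable (logRatioHist pol n θ) :=
  Finset.measurable_fun_sum _ fun k _ =>
    (measurable_logRatio pol θ).comp (measurable_pi_apply k)

lemma measurable_pathRatio (n : ℕ) (θ : Param d) : Measurable (pathRatio pol n θ) :=
  (Finset.measurable_fun_sum _ fun k _ =>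
    (measurable_logRatio pol θ).comp (measurable_pi_apply k)).exp

lemma measurable_pathRatio_uncurry (n : ℕ) :
    Measurable fun x : Param d × (ℕ → S × A) => pathRatio pol n x.1 x.2 :=
  (Finset.measurable_fun_sum _ fun k _ => (measurable_logRatio_uncurry pol).comp
    (measurable_fst.prodMk ((measurable_pi_apply k).comp measurable_snd))).exp

lemma continuous_pathRatio (n : ℕ) (τ : ℕ → S × A) :
    Continuous fun θ => pathRatio pol n θ τ :=
  Real.continuous_exp.comp (continuous_finsetSum _ fun k _ =>
    ((contDiff_logDensity pol (τ k)).continuous).sub continuous_const)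

lemma exp_logRatioHist (n : ℕ) (θ : Param d) (τ : ℕ → S × A) :
    Real.exp (logRatioHist pol n θ (Preorder.frestrictLe n τ)) = pathRatio pol n θ τ := by
  rw [pathRatio, logRatioHist, Nat.range_succ_eq_Iic, ← Finset.sum_coe_sort (Finset.Iic n)]
  rfl

lemma pathRatio_succ (n : ℕ) (θ : Param d) (τ : ℕ → S × A) :
    pathRatio pol (n + 1) θ τ = pathRatio pol n θ τ * Real.exp (pol.logRatio θ (τ (n + 1))) := by
  rw [pathRatio, Finset.sum_range_succ, Real.exp_add, ← pathRatio]

lemma lintegral_compProd_policy (θ : Param d) (μ : Measure S) [IsProbabilityMeasure μ]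
    {f : S × A → ENNReal} (hf : Measurable f) :
    ∫⁻ z, f z ∂(μ ⊗ₘ pol.policy θ) =
      ∫⁻ z, f z * ENNReal.ofReal (Real.exp (pol.logRatio θ z)) ∂(μ ⊗ₘ pol.policy 0) := by
  rw [Measure.lintegral_compProd hf,
    Measure.lintegral_compProd
      (f := fun z => f z * ENNReal.ofReal (Real.exp (pol.logRatio θ z)))
      (hf.mul (measurable_logRatio pol θ).exp.ennreal_ofReal)]
  congr with s
  exact lintegral_policy_ratio pol θ s (hf.comp measurable_prodMk_left)

/-- Change of measure for the first `n + 1` steps of a trajectory. -/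
lemma lintegral_pathLaw (n : ℕ) (θ : Param d) {F : (Π _ : Finset.Iic n, S × A) → ENNReal}
    (hF : Measurable F) :
    ∫⁻ τ, F (Preorder.frestrictLe n τ) ∂pathLaw C pol θ =
      ∫⁻ τ, F (Preorder.frestrictLe n τ) * ENNReal.ofReal (pathRatio pol n θ τ)
        ∂pathLaw C pol 0 := by
  induction n with
  | zero =>
    have hm : Measurable fun z : S × A => F fun _ => z :=
      hF.comp (measurable_pi_iff.2 fun _ => measurable_id)
    have h1 : ∀ τ : ℕ → S × A, F (Preorder.frestrictLe 0 τ) = F fun _ => τ 0 := fun τ => by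
      congr 1
      funext k
      have : k.1 = 0 := Nat.le_zero.1 (Finset.mem_Iic.1 k.2)
      simp [this]
    have h2 : ∀ τ : ℕ → S × A,
        pathRatio pol 0 θ τ = Real.exp (pol.logRatio θ (τ 0)) := fun τ => by
      simp [pathRatio]
    have hm2 : Measurable fun z : S × A =>
        (F fun _ => z) * ENNReal.ofReal (Real.exp (pol.logRatio θ z)) :=
      hm.mul (measurable_logRatio pol θ).exp.ennreal_ofReal
    simp_rw [h1, h2]
    have e1 := lintegral_map (μ := pathLaw C pol θ) hm (measurable_pi_apply 0)
    have e2 := lintegral_map (μ := pathLaw C pol 0) hm2 (measurable_pi_apply 0)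
    rw [← e1, ← e2]
    unfold pathLaw trajFrom
    have e3 := trajLaw_map_zero C (pol.policy θ) (C.ρ ⊗ₘ pol.policy θ)
    have e4 := trajLaw_map_zero C (pol.policy 0) (C.ρ ⊗ₘ pol.policy 0)
    rw [e3, e4]
    exact lintegral_compProd_policy pol θ C.ρ hm
  | succ n ih =>
    have hm := hF.comp (measurable_histSnoc (Z := S × A) n)
    have hw := (measurable_logRatio pol θ).exp.ennreal_ofReal
    have hW : Measurable fun h : Π _ : Finset.Iic n, S × A =>
        ENNReal.ofReal (Real.exp (logRatioHist pol n θ h)) :=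
      (measurable_logRatioHist pol n θ).exp.ennreal_ofReal
    have e0 : ∫⁻ τ, F (Preorder.frestrictLe (n + 1) τ) ∂pathLaw C pol θ =
        ∫⁻ τ, (F ∘ histSnoc n) (Preorder.frestrictLe n τ, τ (n + 1)) ∂pathLaw C pol θ := by
      simp only [Function.comp_apply, histSnoc_frestrictLe]
    have e1 := e0.trans
      (lintegral_trajLaw_succ C (pol.policy θ) (C.ρ ⊗ₘ pol.policy θ) n hm)
    have hG : Measurable fun h : Π _ : Finset.Iic n, S × A =>
        ∫⁻ z, (F ∘ histSnoc n) (h, z) ∂saStep C (pol.policy θ)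
          (h ⟨n, Finset.mem_Iic.2 le_rfl⟩) := by
      have : Measurable fun h : Π _ : Finset.Iic n, S × A =>
          ∫⁻ z, (F ∘ histSnoc n) (h, z) ∂((saStep C (pol.policy θ)).comap
            (fun h : Π _ : Finset.Iic n, S × A => h ⟨n, Finset.mem_Iic.2 le_rfl⟩)
            (measurable_pi_apply _) h) := hm.lintegral_kernel_prod_right'
      exact this
    have e2 := lintegral_trajLaw_succ C (pol.policy 0) (C.ρ ⊗ₘ pol.policy 0) n
      (F := fun x => (F ∘ histSnoc n) x * ENNReal.ofReal (Real.exp (pol.logRatio θ x.2)) *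
        ENNReal.ofReal (Real.exp (logRatioHist pol n θ x.1)))
      ((hm.mul (hw.comp measurable_snd)).mul (hW.comp measurable_fst))
    have e3 : ∀ τ : ℕ → S × A, F (Preorder.frestrictLe (n + 1) τ) *
        ENNReal.ofReal (pathRatio pol (n + 1) θ τ) =
        (F ∘ histSnoc n) (Preorder.frestrictLe n τ, τ (n + 1)) *
          ENNReal.ofReal (Real.exp (pol.logRatio θ (τ (n + 1)))) *
          ENNReal.ofReal (Real.exp (logRatioHist pol n θ (Preorder.frestrictLe n τ))) :=
      fun τ => by
        rw [exp_logRatioHist, pathRatio_succ, Function.comp_apply, histSnoc_frestrictLe,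
          ENNReal.ofReal_mul (pathRatio_pos pol n θ τ).le]
        ring
    simp_rw [e3]
    refine e1.trans (Eq.trans ?_ e2.symm)
    refine (ih hG).trans (lintegral_congr fun τ => ?_)
    -- The next state has the same law C.P (τ n) under both parameters, so one more step only
    -- multiplies the density by one policy ratio.
    have e4 := lintegral_compProd_policy pol θ (C.P (τ n))
      (f := fun z => (F ∘ histSnoc n) (Preorder.frestrictLe n τ, z))
      (hm.comp measurable_prodMk_left)
    have e5 := lintegral_mul_const (μ := saStep C (pol.policy 0) (τ n))
      (ENNReal.ofReal (pathRatio pol n θ τ))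
      (f := fun z => (F ∘ histSnoc n) (Preorder.frestrictLe n τ, z) *
        ENNReal.ofReal (Real.exp (pol.logRatio θ z)))
      ((hm.comp measurable_prodMk_left).mul hw)
    rw [← saStep_apply, ← saStep_apply] at e4
    simp only [exp_logRatioHist]
    rw [e5, ← e4]
    rfl

lemma map_pathLaw_eq_withDensity (n : ℕ) (θ : Param d) :
    (pathLaw C pol θ).map (Preorder.frestrictLe n) =
      ((pathLaw C pol 0).map (Preorder.frestrictLe n)).withDensity
        fun h => ENNReal.ofReal (Real.exp (logRatioHist pol n θ h)) := by
  have hW : Measurable fun h : Π _ : Finset.Iic n, S × A =>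
      ENNReal.ofReal (Real.exp (logRatioHist pol n θ h)) :=
    (measurable_logRatioHist pol n θ).exp.ennreal_ofReal
  refine Measure.ext_of_lintegral _ fun F hF => ?_
  rw [lintegral_map hF (by fun_prop), lintegral_withDensity_eq_lintegral_mul _ hW hF,
    lintegral_map (hW.mul hF) (by fun_prop), lintegral_pathLaw C pol n θ hF]
  simp only [Pi.mul_apply, exp_logRatioHist, mul_comm]

lemma lintegral_pathRatio (n : ℕ) (θ : Param d) :
    ∫⁻ τ, ENNReal.ofReal (pathRatio pol n θ τ) ∂pathLaw C pol 0 = 1 := by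
  have := lintegral_pathLaw C pol n θ (F := fun _ => 1) measurable_const
  simpa using this.symm

lemma integrable_pathRatio (n : ℕ) (θ : Param d) :
    Integrable (pathRatio pol n θ) (pathLaw C pol 0) := by
  refine ⟨(measurable_pathRatio pol n θ).aestronglyMeasurable, ?_⟩
  rw [hasFiniteIntegral_iff_ofReal
    (Filter.Eventually.of_forall fun τ => (pathRatio_pos pol n θ τ).le), lintegral_pathRatio]
  exact ENNReal.one_lt_top

lemma integral_pathRatio (n : ℕ) (θ : Param d) :
    ∫ τ, pathRatio pol n θ τ ∂pathLaw C pol 0 = 1 := by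
  rw [integral_eq_lintegral_of_nonneg_ae
    (Filter.Eventually.of_forall fun τ => (pathRatio_pos pol n θ τ).le)
    (measurable_pathRatio pol n θ).aestronglyMeasurable, lintegral_pathRatio, ENNReal.toReal_one]

lemma integral_pathLaw {E : Type*} [NormedAddCommGroup E] [NormedSpace ℝ E] (n : ℕ)
    (θ : Param d) {f : (Π _ : Finset.Iic n, S × A) → E} (hf : StronglyMeasurable f) :
    ∫ τ, f (Preorder.frestrictLe n τ) ∂pathLaw C pol θ =
      ∫ τ, pathRatio pol n θ τ • f (Preorder.frestrictLe n τ) ∂pathLaw C pol 0 := by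
  have hm : Measurable (Preorder.frestrictLe (π := fun _ => S × A) n) := by fun_prop
  have hW : Measurable fun h : Π _ : Finset.Iic n, S × A =>
      ENNReal.ofReal (Real.exp (logRatioHist pol n θ h)) :=
    (measurable_logRatioHist pol n θ).exp.ennreal_ofReal
  rw [← integral_map hm.aemeasurable hf.aestronglyMeasurable, map_pathLaw_eq_withDensity,
    integral_withDensity_eq_integral_toReal_smul hW
      (Filter.Eventually.of_forall fun h => ENNReal.ofReal_lt_top),
    integral_map (f := fun h => (ENNReal.ofReal (Real.exp (logRatioHist pol n θ h))).toReal • f h)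
      hm.aemeasurable (hW.ennreal_toReal.stronglyMeasurable.smul hf).aestronglyMeasurable]
  congr with τ
  rw [ENNReal.toReal_ofReal (Real.exp_pos _).le, exp_logRatioHist]

/-! ### Continuity of the values -/

/-- Scheffé's argument. Since |f| ≤ 1, the integrand is at most 2(W₀ - W)⁺ + (W - W₀); the second
part has integral zero, and the first is dominated by W₀ and tends to zero pointwise. No domination
of W itself is needed. -/
lemma continuous_integral_of_density {X E : Type*} [MeasurableSpace X] {Q : Measure X}
    [TopologicalSpace E] [FirstCountableTopology E] {W : E → X → ℝ} {f : X → ℝ}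
    (hW0 : ∀ θ x, 0 ≤ W θ x) (hc : ∀ x, Continuous fun θ => W θ x) (hm : ∀ θ, Measurable (W θ))
    (hI : ∀ θ, Integrable (W θ) Q) (h1 : ∀ θ, ∫ x, W θ x ∂Q = 1) (hf : Measurable f)
    (hfB : ∀ x, |f x| ≤ 1) : Continuous fun θ => ∫ x, f x * W θ x ∂Q := by
  refine continuous_iff_continuousAt.2 fun θ₀ => ?_
  have hpos : Filter.Tendsto (fun θ => ∫ x, max (W θ₀ x - W θ x) 0 ∂Q) (nhds θ₀) (nhds 0) := by
    have h := tendsto_integral_filter_of_dominated_convergence (μ := Q) (l := nhds θ₀)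
      (F := fun θ x => max (W θ₀ x - W θ x) 0) (f := fun _ => 0) (W θ₀)
      (Filter.Eventually.of_forall fun θ =>
        (((hm θ₀).sub (hm θ)).max measurable_const).aestronglyMeasurable)
      (Filter.Eventually.of_forall fun θ => Filter.Eventually.of_forall fun x => by
        rw [Real.norm_of_nonneg (le_max_right _ _)]
        exact max_le (by linarith [hW0 θ x]) (hW0 θ₀ x)) (hI θ₀)
      (Filter.Eventually.of_forall fun x => by
        have : Continuous fun θ => max (W θ₀ x - W θ x) 0 :=
          (continuous_const.sub (hc x)).max continuous_const
        simpa using this.tendsto θ₀)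
    simpa using h
  have hfI : ∀ θ, Integrable (fun x => f x * W θ x) Q := fun θ =>
    (hI θ).bdd_mul hf.aestronglyMeasurable (Filter.Eventually.of_forall hfB)
  have hpI : ∀ θ, Integrable (fun x => max (W θ₀ x - W θ x) 0) Q := fun θ =>
    ((hI θ₀).sub (hI θ)).pos_part
  rw [ContinuousAt, tendsto_iff_norm_sub_tendsto_zero]
  have hlim : Filter.Tendsto (fun θ => 2 * ∫ x, max (W θ₀ x - W θ x) 0 ∂Q) (nhds θ₀)
      (nhds 0) := by simpa using hpos.const_mul 2
  refine squeeze_zero (fun _ => norm_nonneg _) (fun θ => ?_) hlim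
  rw [← integral_sub (hfI θ) (hfI θ₀)]
  have hb : ∫ x, (2 * max (W θ₀ x - W θ x) 0 + (W θ x - W θ₀ x)) ∂Q =
      2 * ∫ x, max (W θ₀ x - W θ x) 0 ∂Q := by
    have e := integral_add ((hpI θ).const_mul 2) ((hI θ).sub (hI θ₀))
    rw [integral_const_mul, integral_sub' (hI θ) (hI θ₀), h1, h1, sub_self, add_zero] at e
    exact e
  rw [← hb]
  refine norm_integral_le_of_norm_le (((hpI θ).const_mul 2).add ((hI θ).sub (hI θ₀)))
    (Filter.Eventually.of_forall fun x => ?_)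
  rw [← mul_sub, norm_mul]
  refine (mul_le_of_le_one_left (norm_nonneg _) (hfB x)).trans ?_
  rw [Real.norm_eq_abs, abs_le]
  constructor
  · linarith [le_max_left (W θ₀ x - W θ x) 0, le_max_right (W θ₀ x - W θ x) 0]
  · linarith [le_max_left (W θ₀ x - W θ x) 0, le_max_right (W θ₀ x - W θ x) 0]

/-- The expected reward at time `n` under `π_θ`. -/
noncomputable def stepReward (i : Fin (m + 1)) (n : ℕ) (θ : Param d) : ℝ :=
  ∫ τ, C.reward i (τ n) ∂pathLaw C pol θ

lemma val_eq_tsum (i : Fin (m + 1)) (θ : Param d) :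
    val C pol i θ = ∑' n, C.γ ^ n * stepReward C pol i n θ := value_eq_tsum C _ i

lemma abs_stepReward_le (i : Fin (m + 1)) (n : ℕ) (θ : Param d) :
    |stepReward C pol i n θ| ≤ 1 := abs_integral_le_of_abs_le fun _ => abs_reward_le C i _

lemma stepReward_eq (i : Fin (m + 1)) (n : ℕ) (θ : Param d) :
    stepReward C pol i n θ =
      ∫ τ, C.reward i (τ n) * pathRatio pol n θ τ ∂pathLaw C pol 0 := by
  have h := integral_pathLaw C pol n θ
    (f := fun h => C.reward i (h ⟨n, Finset.mem_Iic.2 le_rfl⟩))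
    ((C.measurable_reward i).comp (measurable_pi_apply _)).stronglyMeasurable
  simpa [mul_comm, stepReward] using h

lemma continuous_stepReward (i : Fin (m + 1)) (n : ℕ) : Continuous (stepReward C pol i n) := by
  have e : stepReward C pol i n = fun θ => _ := funext fun θ => stepReward_eq C pol i n θ
  rw [e]
  exact continuous_integral_of_density (fun θ τ => (pathRatio_pos pol n θ τ).le)
    (continuous_pathRatio pol n) (measurable_pathRatio pol n) (integrable_pathRatio C pol n)
    (integral_pathRatio C pol n) ((C.measurable_reward i).comp (measurable_pi_apply n))
    fun τ => abs_reward_le C i _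

/-- Continuity holds at every parameter, without bounds on the score. It makes the strictly feasible
set open and allows first-exit arguments for steps that might leave that set. -/
lemma continuous_val (i : Fin (m + 1)) : Continuous (val C pol i) := by
  have e : val C pol i = fun θ => _ := funext fun θ => val_eq_tsum C pol i θ
  rw [e]
  refine continuous_tsum (fun n => (continuous_stepReward C pol i n).const_mul _)
    (summable_geometric_of_lt_one C.γ_pos.le C.γ_lt_one) fun n θ => ?_
  rw [norm_mul, Real.norm_of_nonneg (pow_nonneg C.γ_pos.le n)]
  exact mul_le_of_le_one_right (pow_nonneg C.γ_pos.le n) (abs_stepReward_le C pol i n θ)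

end Likelihood

/-! ## Policy gradients and smoothness -/

/-- On a ball of radius r the exponent moves by at most Gr, so exp (L x) ≤ exp (Gr) exp (L x₀). A
single integrable weight at x₀ thus dominates the derivatives on the whole ball. -/
lemma hasDerivAt_integral_mul_exp {X : Type*} [MeasurableSpace X] {Q : Measure X}
    {L L' c c' : ℝ → X → ℝ} {x₀ r G B B' : ℝ} (hr : 0 < r) (hG : 0 ≤ G)
    (hL : ∀ x ∈ Metric.ball x₀ r, ∀ a, HasDerivAt (fun x => L x a) (L' x a) x)
    (hc : ∀ x ∈ Metric.ball x₀ r, ∀ a, HasDerivAt (fun x => c x a) (c' x a) x)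
    (hLb : ∀ x ∈ Metric.ball x₀ r, ∀ a, |L' x a| ≤ G)
    (hcb : ∀ x ∈ Metric.ball x₀ r, ∀ a, |c x a| ≤ B)
    (hcb' : ∀ x ∈ Metric.ball x₀ r, ∀ a, |c' x a| ≤ B')
    (mL : ∀ x, Measurable (L x)) (mc : ∀ x, Measurable (c x))
    (hI : Integrable (fun a => Real.exp (L x₀ a)) Q) :
    HasDerivAt (fun x => ∫ a, c x a * Real.exp (L x a) ∂Q)
      (∫ a, (c' x₀ a + c x₀ a * L' x₀ a) * Real.exp (L x₀ a) ∂Q) x₀ := by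
  have h0 : x₀ ∈ Metric.ball x₀ r := Metric.mem_ball_self hr
  have hd : ∀ x ∈ Metric.ball x₀ r, ∀ a, HasDerivAt (fun x => c x a * Real.exp (L x a))
      ((c' x a + c x a * L' x a) * Real.exp (L x a)) x := fun x hx a => by
    convert! (hc x hx a).mul (hL x hx a).exp using 1
    ring
  have hgrow : ∀ x ∈ Metric.ball x₀ r, ∀ a, L x a ≤ G * r + L x₀ a := fun x hx a => by
    have := (convex_ball x₀ r).norm_image_sub_le_of_norm_hasDerivWithin_le (f := fun x => L x a)
      (f' := fun x => L' x a) (C := G) (fun y hy => (hL y hy a).hasDerivWithinAt)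
      (fun y hy => hLb y hy a) h0 hx
    have h2 : ‖x - x₀‖ ≤ r := by rw [← dist_eq_norm]; exact (Metric.mem_ball.1 hx).le
    have h3 := (le_abs_self _).trans (this.trans (mul_le_mul_of_nonneg_left h2 hG))
    linarith
  have hm : ∀ x, Measurable fun a => c x a * Real.exp (L x a) := fun x => (mc x).mul (mL x).exp
  refine (hasDerivAt_integral_of_dominated_loc_of_deriv_le
    (bound := fun a => (B' + B * G) * Real.exp (G * r) * Real.exp (L x₀ a))
    (F' := fun x a => (c' x a + c x a * L' x a) * Real.exp (L x a))
    (Metric.ball_mem_nhds x₀ hr) (Filter.Eventually.of_forall fun x => (hm x).aestronglyMeasurable)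
    ?_ ?_ ?_ (hI.const_mul _) (Filter.Eventually.of_forall fun a x hx => hd x hx a)).2
  · exact hI.bdd_mul (mc x₀).aestronglyMeasurable (Filter.Eventually.of_forall (hcb x₀ h0))
  · exact (measurable_of_hasDerivAt hm (hd x₀ h0)).aestronglyMeasurable
  · refine Filter.Eventually.of_forall fun a x hx => ?_
    rw [norm_mul, Real.norm_eq_abs, Real.norm_of_nonneg (Real.exp_pos _).le, mul_assoc,
      ← Real.exp_add]
    have hB : 0 ≤ B := (abs_nonneg _).trans (hcb x hx a)
    have hB' : 0 ≤ B' := (abs_nonneg _).trans (hcb' x hx a)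
    refine mul_le_mul ?_ (Real.exp_le_exp.2 (hgrow x hx a)) (Real.exp_pos _).le
      (add_nonneg hB' (mul_nonneg hB hG))
    refine (abs_add_le _ _).trans (add_le_add (hcb' x hx a) ?_)
    rw [abs_mul]
    exact mul_le_mul (hcb x hx a) (hLb x hx a) (abs_nonneg _) hB

lemma abs_taylor_two_le {f f' f'' : ℝ → ℝ} {K : ℝ}
    (h1 : ∀ x ∈ Set.Icc (0 : ℝ) 1, HasDerivAt f (f' x) x)
    (h2 : ∀ x ∈ Set.Icc (0 : ℝ) 1, HasDerivAt f' (f'' x) x)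
    (hK : ∀ x ∈ Set.Icc (0 : ℝ) 1, |f'' x| ≤ K) : |f 1 - f 0 - f' 0| ≤ K / 2 := by
  have hlip : ∀ x ∈ Set.Icc (0 : ℝ) 1, |f' x - f' 0| ≤ K * x := fun x hx => by
    have := (convex_Icc (0 : ℝ) 1).norm_image_sub_le_of_norm_hasDerivWithin_le (f := f')
      (f' := f'') (C := K) (fun y hy => (h2 y hy).hasDerivWithinAt) hK
      (Set.left_mem_Icc.2 zero_le_one) hx
    simpa [abs_of_nonneg hx.1] using this
  have hg : ∀ x ∈ Set.Icc (0 : ℝ) 1,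
      HasDerivAt (fun x => f x - f 0 - f' 0 * x) (f' x - f' 0) x := fun x hx => by
    have h3 := ((h1 x hx).sub_const (f 0)).sub ((hasDerivAt_id x).const_mul (f' 0))
    rw [mul_one] at h3
    exact h3
  have := image_norm_le_of_norm_deriv_right_le_deriv_boundary
    (f := fun x => f x - f 0 - f' 0 * x) (f' := fun x => f' x - f' 0) (a := 0) (b := 1)
    (fun x hx => (hg x hx).continuousAt.continuousWithinAt)
    (fun x hx => (hg x (Set.Ico_subset_Icc_self hx)).hasDerivWithinAt)
    (B := fun x => K / 2 * x ^ 2) (B' := fun x => K * x) (by simp)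
    (fun x => by
      convert! (hasDerivAt_pow 2 x).const_mul (K / 2) using 1
      simp
      ring)
    (fun x hx => hlip x (Set.Ico_subset_Icc_self hx)) (Set.right_mem_Icc.2 zero_le_one)
  simpa using this

section PolicyGradient

variable {S A : Type*} [MeasurableSpace S] [MeasurableSpace A] {m d : ℕ}
  (C : CMDP S A m) (pol : PolicyClass S A d)

lemma integral_trajLaw_succ (π : Kernel S A) [IsMarkovKernel π] (μ₀ : Measure (S × A))
    [IsProbabilityMeasure μ₀] (n : ℕ) {F : (Π _ : Finset.Iic n, S × A) × (S × A) → ℝ}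
    (hF : Measurable F) {B : ℝ} (hB : ∀ x, |F x| ≤ B) :
    ∫ τ, F (Preorder.frestrictLe n τ, τ (n + 1)) ∂trajLaw C π μ₀ =
      ∫ τ, ∫ z, F (Preorder.frestrictLe n τ, z) ∂saStep C π (τ n) ∂trajLaw C π μ₀ := by
  have h := Kernel.map_frestrictLe_trajMeasure_compProd_eq_map_trajMeasure
    (X := fun _ => S × A) (μ₀ := μ₀)
    (κ := fun n => (saStep C π).comap
      (fun h : (Π _ : Finset.Iic n, S × A) => h ⟨n, Finset.mem_Iic.2 le_rfl⟩)
      (measurable_pi_apply _)) (a := n)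
  have h2 := congrArg (fun μ => ∫ x, F x ∂μ) h
  beta_reduce at h2
  have hm : Measurable fun τ : ℕ → S × A => (Preorder.frestrictLe n τ, τ (n + 1)) := by fun_prop
  have hm2 : Measurable fun τ : ℕ → S × A => Preorder.frestrictLe n τ := by fun_prop
  have : IsProbabilityMeasure ((Kernel.trajMeasure (X := fun _ => S × A) μ₀
      (fun n => (saStep C π).comap
      (fun h : (Π _ : Finset.Iic n, S × A) => h ⟨n, Finset.mem_Iic.2 le_rfl⟩)
      (measurable_pi_apply _))).map (Preorder.frestrictLe n)) :=
    Measure.isProbabilityMeasure_map hm2.aemeasurable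
  rw [integral_map hm.aemeasurable hF.aestronglyMeasurable, Measure.integral_compProd
      (integrable_of_bounded hF.aestronglyMeasurable hB),
    integral_map hm2.aemeasurable
      hF.stronglyMeasurable.integral_kernel_prod_right'.aestronglyMeasurable] at h2
  exact h2.symm

/-- Extends a history of `n + 1` steps to a trajectory. -/
def histExtend {Z : Type*} (n : ℕ) (h : Π _ : Finset.Iic n, Z) : ℕ → Z :=
  fun k => h ⟨min k n, Finset.mem_Iic.2 (min_le_right _ _)⟩

lemma measurable_histExtend {Z : Type*} [MeasurableSpace Z] (n : ℕ) :
    Measurable (histExtend (Z := Z) n) :=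
  measurable_pi_iff.2 fun _ => measurable_pi_apply _

/-- Change of measure for functions of the first `n + 1` steps of a trajectory. -/
lemma integral_pathLaw_of_dependsOn {E : Type*} [NormedAddCommGroup E] [NormedSpace ℝ E] (n : ℕ)
    (θ : Param d) {f : (ℕ → S × A) → E} (hf : StronglyMeasurable f)
    (hdep : ∀ τ τ', (∀ k ≤ n, τ k = τ' k) → f τ = f τ') :
    ∫ τ, f τ ∂pathLaw C pol θ = ∫ τ, pathRatio pol n θ τ • f τ ∂pathLaw C pol 0 := by
  have h := integral_pathLaw C pol n θ (hf.comp_measurable (measurable_histExtend n))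
  have e : ∀ τ, f (histExtend n (Preorder.frestrictLe n τ)) = f τ := fun τ =>
    hdep _ _ fun k hk => by simp [histExtend, hk]
  simpa only [Function.comp_apply, e] using h

/-- On the open set `U`, the score is bounded by `Mg` and its derivative by `Mh`. -/
structure ScoreBoundOn (U : Set (Param d)) (Mg Mh : ℝ) : Prop where
  isOpen : IsOpen U
  norm_score_le : ∀ θ ∈ U, ∀ z : S × A, ‖pol.score θ z‖ ≤ Mg
  norm_fderiv_le : ∀ θ ∈ U, ∀ z : S × A, ‖fderiv ℝ (fun θ' => pol.score θ' z) θ‖ ≤ Mh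

variable {pol} {U : Set (Param d)} {Mg Mh : ℝ}

lemma exists_ball_line_mem (hU : IsOpen U) {θ v : Param d} {x : ℝ} (hx : θ + x • v ∈ U) :
    ∃ r > 0, ∀ y ∈ Metric.ball x r, θ + y • v ∈ U := by
  have hc : Continuous fun y : ℝ => θ + y • v := by fun_prop
  exact Metric.isOpen_iff.1 (hU.preimage hc) x hx

lemma abs_inner_score_le (h : ScoreBoundOn pol U Mg Mh) {θ : Param d} (hθ : θ ∈ U) (v : Param d)
    (z : S × A) : |inner ℝ (pol.score θ z) v| ≤ Mg * ‖v‖ :=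
  (abs_real_inner_le_norm _ _).trans
    (mul_le_mul_of_nonneg_right (h.norm_score_le θ hθ z) (norm_nonneg _))

lemma measurable_inner_score (θ v : Param d) :
    Measurable fun z : S × A => inner ℝ (pol.score θ z) v :=
  (measurable_score pol θ).inner_const

lemma integrable_density (θ : Param d) (s : S) :
    Integrable (fun a => pol.density θ s a) pol.base := by
  refine ⟨((measurable_density_uncurry pol θ).comp measurable_prodMk_left).aestronglyMeasurable, ?_⟩
  rw [hasFiniteIntegral_iff_ofReal
    (Filter.Eventually.of_forall fun a => (pol.density_pos θ s a).le), pol.lintegral_density]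
  exact ENNReal.one_lt_top

lemma integral_density (θ : Param d) (s : S) : ∫ a, pol.density θ s a ∂pol.base = 1 := by
  rw [integral_eq_lintegral_of_nonneg_ae
    (Filter.Eventually.of_forall fun a => (pol.density_pos θ s a).le)
    (integrable_density θ s).aestronglyMeasurable, pol.lintegral_density, ENNReal.toReal_one]

lemma exp_logDensity (θ : Param d) (z : S × A) :
    Real.exp (pol.logDensity θ z) = pol.density θ z.1 z.2 :=
  Real.exp_log (pol.density_pos θ z.1 z.2)

lemma integral_policy_eq (θ : Param d) (s : S) (f : A → ℝ) :
    ∫ a, f a ∂pol.policy θ s = ∫ a, pol.density θ s a * f a ∂pol.base := by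
  have h : Measurable (Function.uncurry fun s a => ENNReal.ofReal (pol.density θ s a)) :=
    (pol.measurable_density θ).ennreal_ofReal
  rw [PolicyClass.policy, Kernel.withDensity_apply _ h, Kernel.const_apply,
    integral_withDensity_eq_integral_toReal_smul
      (f := fun a => ENNReal.ofReal (pol.density θ s a)) (h.comp measurable_prodMk_left)
      (Filter.Eventually.of_forall fun a => ENNReal.ofReal_lt_top)]
  congr with a
  rw [ENNReal.toReal_ofReal (pol.density_pos θ s a).le, smul_eq_mul]

/-- The score has mean zero. -/
lemma integral_inner_score (h : ScoreBoundOn pol U Mg Mh) {θ : Param d} (hθ : θ ∈ U)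
    (v : Param d) (s : S) : ∫ a, inner ℝ (pol.score θ (s, a)) v ∂pol.policy θ s = 0 := by
  obtain ⟨r, hr, hball⟩ := exists_ball_line_mem h.isOpen (θ := θ) (v := v) (x := 0) (by simpa)
  by_cases hA : Nonempty A
  swap
  · have := not_nonempty_iff.1 hA
    exact integral_of_isEmpty
  have hMg : 0 ≤ Mg := (norm_nonneg _).trans (h.norm_score_le θ hθ (s, hA.some))
  -- Differentiate the identity that the density has total mass 1.
  have hd := hasDerivAt_integral_mul_exp (Q := pol.base) (x₀ := 0) (r := r) (G := Mg * ‖v‖)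
    (L := fun x a => pol.logDensity (θ + x • v) (s, a))
    (L' := fun x a => inner ℝ (pol.score (θ + x • v) (s, a)) v)
    (c := fun _ _ => 1) (c' := fun _ _ => 0) (B := 1) (B' := 0) hr (by positivity)
    (fun x _ a => hasDerivAt_logDensity_line pol θ v (s, a) x)
    (fun x _ a => hasDerivAt_const x 1)
    (fun x hx a => abs_inner_score_le h (hball x hx) v _) (by simp) (by simp)
    (fun x => (measurable_logDensity pol _).comp measurable_prodMk_left)
    (fun x => measurable_const)
    (by simpa only [exp_logDensity] using integrable_density (pol := pol) (θ + (0 : ℝ) • v) s)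
  simp only [exp_logDensity, one_mul, integral_density, zero_add, zero_smul, add_zero] at hd
  rw [integral_policy_eq]
  simp_rw [mul_comm (pol.density θ s _)]
  exact hd.unique (hasDerivAt_const 0 1)

variable (pol) in
/-- The sum of the scores of the first `n + 1` steps of a trajectory. -/
noncomputable def scoreSum (n : ℕ) (θ : Param d) (τ : ℕ → S × A) : Param d :=
  ∑ k ∈ Finset.range (n + 1), pol.score θ (τ k)

lemma measurable_scoreSum (n : ℕ) (θ : Param d) : Measurable (scoreSum pol n θ) :=
  Finset.measurable_fun_sum _ fun k _ => (measurable_score pol θ).comp (measurable_pi_apply k)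

lemma norm_scoreSum_le (h : ScoreBoundOn pol U Mg Mh) {θ : Param d} (hθ : θ ∈ U) (n : ℕ)
    (τ : ℕ → S × A) : ‖scoreSum pol n θ τ‖ ≤ (n + 1) * Mg := by
  refine (norm_sum_le_of_le _ fun k _ => h.norm_score_le θ hθ (τ k)).trans ?_
  simp

lemma scoreSum_congr (n : ℕ) (θ : Param d) {τ τ' : ℕ → S × A} (h : ∀ k ≤ n, τ k = τ' k) :
    scoreSum pol n θ τ = scoreSum pol n θ τ' :=
  Finset.sum_congr rfl fun k hk => by rw [h k (Nat.lt_succ_iff.1 (Finset.mem_range.1 hk))]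

lemma measurable_inner_scoreSum (n : ℕ) (θ v : Param d) :
    Measurable fun τ => inner ℝ (scoreSum pol n θ τ) v :=
  (measurable_scoreSum n θ).inner_const

lemma abs_inner_scoreSum_le (h : ScoreBoundOn pol U Mg Mh) {θ : Param d} (hθ : θ ∈ U) (n : ℕ)
    (v : Param d) (τ : ℕ → S × A) : |inner ℝ (scoreSum pol n θ τ) v| ≤ (n + 1) * Mg * ‖v‖ :=
  (abs_real_inner_le_norm _ _).trans
    (mul_le_mul_of_nonneg_right (norm_scoreSum_le h hθ n τ) (norm_nonneg _))

/-- The scores of successive steps are orthogonal. -/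
lemma integral_inner_scoreSum_mul (h : ScoreBoundOn pol U Mg Mh) {θ : Param d} (hθ : θ ∈ U)
    (v : Param d) (n : ℕ) :
    ∫ τ, inner ℝ (scoreSum pol n θ τ) v * inner ℝ (pol.score θ (τ (n + 1))) v
      ∂pathLaw C pol θ = 0 := by
  have hm := (measurable_inner_scoreSum (pol := pol) n θ v).comp
    (measurable_histExtend (Z := S × A) n)
  have hF : Measurable fun x : (Π _ : Finset.Iic n, S × A) × (S × A) =>
      inner ℝ (scoreSum pol n θ (histExtend n x.1)) v * inner ℝ (pol.score θ x.2) v :=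
    (hm.comp measurable_fst).mul ((measurable_inner_score θ v).comp measurable_snd)
  have e := integral_trajLaw_succ C (pol.policy θ) (C.ρ ⊗ₘ pol.policy θ) n hF
    (B := (n + 1) * Mg * ‖v‖ * (Mg * ‖v‖)) fun x => by
      rw [abs_mul]
      have h1 := abs_inner_scoreSum_le h hθ n v (histExtend n x.1)
      exact mul_le_mul h1 (abs_inner_score_le h hθ v _) (abs_nonneg _) ((abs_nonneg _).trans h1)
  have e1 : ∀ τ : ℕ → S × A, scoreSum pol n θ (histExtend n (Preorder.frestrictLe n τ)) =
      scoreSum pol n θ τ := fun τ => scoreSum_congr n θ fun k hk => by simp [histExtend, hk]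
  simp only [e1] at e
  refine e.trans ?_
  -- Given the past, the next score has conditional mean zero, and the earlier scores are constants.
  have h0 : ∀ z, ∫ z', inner ℝ (pol.score θ z') v ∂saStep C (pol.policy θ) z = 0 := fun z => by
    rw [saStep_apply, Measure.integral_compProd (integrable_of_bounded
      (measurable_inner_score θ v).aestronglyMeasurable (abs_inner_score_le h hθ v))]
    simp [integral_inner_score h hθ]
  simp_rw [integral_const_mul, h0, mul_zero, integral_zero]

/-- By orthogonality the second moment grows linearly in the number of steps. The triangle
inequality would give quadratic growth, hence a third power of 1 / (1 - γ) in the smoothness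
constant instead of the second. -/
lemma integral_sq_inner_scoreSum_le (h : ScoreBoundOn pol U Mg Mh) {θ : Param d} (hθ : θ ∈ U)
    (v : Param d) (n : ℕ) :
    ∫ τ, inner ℝ (scoreSum pol n θ τ) v ^ 2 ∂pathLaw C pol θ ≤ (n + 1) * (Mg * ‖v‖) ^ 2 := by
  have hb : ∀ k, ∫ τ, inner ℝ (pol.score θ (τ k)) v ^ 2 ∂pathLaw C pol θ ≤ (Mg * ‖v‖) ^ 2 :=
    fun k => (le_abs_self _).trans (abs_integral_le_of_abs_le fun τ => by
      rw [abs_pow]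
      exact pow_le_pow_left₀ (abs_nonneg _) (abs_inner_score_le h hθ v _) 2)
  induction n with
  | zero => simpa [scoreSum] using hb 0
  | succ n ih =>
    have hm1 := measurable_inner_scoreSum (pol := pol) n θ v
    have hm2 : Measurable fun τ : ℕ → S × A => inner ℝ (pol.score θ (τ (n + 1))) v :=
      (measurable_inner_score θ v).comp (measurable_pi_apply (n + 1))
    have hb1 := abs_inner_scoreSum_le h hθ n v
    have hb2 : ∀ τ : ℕ → S × A, |inner ℝ (pol.score θ (τ (n + 1))) v| ≤ Mg * ‖v‖ := fun τ =>
      abs_inner_score_le h hθ v _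
    have i1 : Integrable (fun τ => inner ℝ (scoreSum pol n θ τ) v ^ 2) (pathLaw C pol θ) :=
      integrable_of_bounded (hm1.pow_const 2).aestronglyMeasurable
        (B := ((n + 1) * Mg * ‖v‖) ^ 2) fun τ => by
          rw [norm_pow]; exact pow_le_pow_left₀ (norm_nonneg _) (hb1 τ) 2
    have i2 : Integrable (fun τ : ℕ → S × A => inner ℝ (pol.score θ (τ (n + 1))) v ^ 2)
        (pathLaw C pol θ) :=
      integrable_of_bounded (hm2.pow_const 2).aestronglyMeasurable
        (B := (Mg * ‖v‖) ^ 2) fun τ => by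
          rw [norm_pow]; exact pow_le_pow_left₀ (norm_nonneg _) (hb2 τ) 2
    have i3 : Integrable (fun τ : ℕ → S × A => inner ℝ (scoreSum pol n θ τ) v *
        inner ℝ (pol.score θ (τ (n + 1))) v) (pathLaw C pol θ) :=
      integrable_of_bounded (hm1.mul hm2).aestronglyMeasurable
        (B := (n + 1) * Mg * ‖v‖ * (Mg * ‖v‖)) fun τ => by
          rw [norm_mul]
          exact mul_le_mul (hb1 τ) (hb2 τ) (norm_nonneg _) ((abs_nonneg _).trans (hb1 τ))
    have e : ∀ τ, inner ℝ (scoreSum pol (n + 1) θ τ) v ^ 2 =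
        inner ℝ (scoreSum pol n θ τ) v ^ 2 + inner ℝ (pol.score θ (τ (n + 1))) v ^ 2 +
          2 * (inner ℝ (scoreSum pol n θ τ) v * inner ℝ (pol.score θ (τ (n + 1))) v) :=
      fun τ => by
        rw [scoreSum, Finset.sum_range_succ, inner_add_left, ← scoreSum]
        ring
    simp_rw [e]
    have e1 := integral_add (i1.add i2) (i3.const_mul 2)
    have e2 := integral_add i1 i2
    rw [integral_const_mul, integral_inner_scoreSum_mul C h hθ v n, mul_zero, add_zero] at e1
    refine (e1.trans e2).le.trans ?_
    push_cast
    linarith [hb (n + 1)]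

variable (pol) in
/-- The gradient of the expected reward at time `n`. -/
noncomputable def gradReward (i : Fin (m + 1)) (n : ℕ) (θ : Param d) : Param d :=
  ∫ τ, C.reward i (τ n) • scoreSum pol n θ τ ∂pathLaw C pol θ

lemma measurable_reward_smul_scoreSum (i : Fin (m + 1)) (n : ℕ) (θ : Param d) :
    Measurable fun τ : ℕ → S × A => C.reward i (τ n) • scoreSum pol n θ τ :=
  ((C.measurable_reward i).comp (measurable_pi_apply n)).smul (measurable_scoreSum n θ)

lemma norm_reward_smul_scoreSum_le (h : ScoreBoundOn pol U Mg Mh) {θ : Param d} (hθ : θ ∈ U)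
    (i : Fin (m + 1)) (n : ℕ) (τ : ℕ → S × A) :
    ‖C.reward i (τ n) • scoreSum pol n θ τ‖ ≤ (n + 1) * Mg := by
  rw [norm_smul]
  exact (mul_le_of_le_one_left (norm_nonneg _) (abs_reward_le C i _)).trans
    (norm_scoreSum_le h hθ n τ)

lemma norm_gradReward_le (h : ScoreBoundOn pol U Mg Mh) {θ : Param d} (hθ : θ ∈ U)
    (i : Fin (m + 1)) (n : ℕ) : ‖gradReward C pol i n θ‖ ≤ (n + 1) * Mg := by
  have := norm_integral_le_of_norm_le_const (μ := pathLaw C pol θ)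
    (Filter.Eventually.of_forall (norm_reward_smul_scoreSum_le C h hθ i n))
  rwa [probReal_univ, mul_one] at this

lemma inner_gradReward (h : ScoreBoundOn pol U Mg Mh) {θ : Param d} (hθ : θ ∈ U)
    (i : Fin (m + 1)) (n : ℕ) (v : Param d) :
    inner ℝ (gradReward C pol i n θ) v =
      ∫ τ, C.reward i (τ n) * inner ℝ (scoreSum pol n θ τ) v * pathRatio pol n θ τ
        ∂pathLaw C pol 0 := by
  have hI : Integrable (fun τ : ℕ → S × A => C.reward i (τ n) • scoreSum pol n θ τ)
      (pathLaw C pol θ) :=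
    integrable_of_bounded (measurable_reward_smul_scoreSum C i n θ).aestronglyMeasurable
      (norm_reward_smul_scoreSum_le C h hθ i n)
  rw [gradReward, real_inner_comm, ← integral_inner hI, integral_pathLaw_of_dependsOn C pol n θ]
  · congr with τ
    rw [real_inner_comm, real_inner_smul_left, smul_eq_mul]
    ring
  · exact ((measurable_reward_smul_scoreSum C i n θ).const_inner).stronglyMeasurable
  · intro τ τ' hτ
    rw [scoreSum_congr n θ hτ, hτ n le_rfl]

end PolicyGradient

/-! ### Second-order bounds along segments of the strictly feasible set -/

section Smoothness

variable {S A : Type*} [MeasurableSpace S] [MeasurableSpace A] {m d : ℕ}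
  (C : CMDP S A m) {pol : PolicyClass S A d} {U : Set (Param d)} {Mg Mh : ℝ}

lemma hasDerivAt_inner_score_line (θ v : Param d) (z : S × A) (x : ℝ) :
    HasDerivAt (fun x : ℝ => inner ℝ (pol.score (θ + x • v) z) v)
      (inner ℝ (fderiv ℝ (fun θ' => pol.score θ' z) (θ + x • v) v) v) x := by
  have h1 := ((contDiff_score pol z).differentiable one_ne_zero (θ + x • v)).hasFDerivAt
  have h2 : HasDerivAt (fun x : ℝ => θ + x • v) v x := by
    have := ((hasDerivAt_id x).smul_const v).const_add θ
    rwa [one_smul] at this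
  have h3 := (h1.comp_hasDerivAt x h2).inner ℝ (hasDerivAt_const x v)
  simpa using h3

lemma hasDerivAt_log_pathRatio_line (n : ℕ) (θ v : Param d) (τ : ℕ → S × A) (x : ℝ) :
    HasDerivAt (fun x : ℝ => ∑ k ∈ Finset.range (n + 1), pol.logRatio (θ + x • v) (τ k))
      (inner ℝ (scoreSum pol n (θ + x • v) τ) v) x := by
  rw [scoreSum, sum_inner]
  exact HasDerivAt.fun_sum fun k _ => (hasDerivAt_logDensity_line pol θ v (τ k) x).sub_const _

lemma hasDerivAt_inner_scoreSum_line (n : ℕ) (θ v : Param d) (τ : ℕ → S × A) (x : ℝ) :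
    HasDerivAt (fun x : ℝ => inner ℝ (scoreSum pol n (θ + x • v) τ) v)
      (∑ k ∈ Finset.range (n + 1),
        inner ℝ (fderiv ℝ (fun θ' => pol.score θ' (τ k)) (θ + x • v) v) v) x := by
  simp_rw [scoreSum, sum_inner]
  exact HasDerivAt.fun_sum fun k _ => hasDerivAt_inner_score_line θ v (τ k) x

lemma abs_sum_inner_fderiv_le (h : ScoreBoundOn pol U Mg Mh) {θ : Param d} (hθ : θ ∈ U)
    (v : Param d) (n : ℕ) (τ : ℕ → S × A) :
    |∑ k ∈ Finset.range (n + 1), inner ℝ (fderiv ℝ (fun θ' => pol.score θ' (τ k)) θ v) v| ≤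
      (n + 1) * (Mh * ‖v‖ ^ 2) := by
  have := norm_sum_le_of_le (Finset.range (n + 1)) (f := fun k =>
    inner ℝ (fderiv ℝ (fun θ' => pol.score θ' (τ k)) θ v) v) (n := fun _ => Mh * ‖v‖ ^ 2)
    fun k _ => by
      rw [Real.norm_eq_abs]
      refine (abs_real_inner_le_norm _ _).trans ?_
      rw [pow_two, ← mul_assoc]
      refine mul_le_mul_of_nonneg_right ?_ (norm_nonneg _)
      exact (ContinuousLinearMap.le_opNorm _ _).trans
        (mul_le_mul_of_nonneg_right (h.norm_fderiv_le θ hθ _) (norm_nonneg _))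
  simpa using this

lemma hasDerivAt_stepReward_line (h : ScoreBoundOn pol U Mg Mh) (hMg : 0 ≤ Mg)
    (i : Fin (m + 1)) (n : ℕ) {θ v : Param d} {x : ℝ} (hx : θ + x • v ∈ U) :
    HasDerivAt (fun x : ℝ => stepReward C pol i n (θ + x • v))
      (∫ τ, C.reward i (τ n) * inner ℝ (scoreSum pol n (θ + x • v) τ) v *
        pathRatio pol n (θ + x • v) τ ∂pathLaw C pol 0) x := by
  obtain ⟨r, hr, hball⟩ := exists_ball_line_mem h.isOpen hx
  have hd := hasDerivAt_integral_mul_exp (Q := pathLaw C pol 0) (x₀ := x) (r := r)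
    (G := (n + 1) * Mg * ‖v‖)
    (L := fun x τ => ∑ k ∈ Finset.range (n + 1), pol.logRatio (θ + x • v) (τ k))
    (L' := fun x τ => inner ℝ (scoreSum pol n (θ + x • v) τ) v)
    (c := fun _ τ => C.reward i (τ n)) (c' := fun _ _ => 0) (B := 1) (B' := 0) hr (by positivity)
    (fun x _ τ => hasDerivAt_log_pathRatio_line n θ v τ x)
    (fun x _ τ => hasDerivAt_const x _)
    (fun x hx τ => abs_inner_scoreSum_le h (hball x hx) n v τ)
    (fun x _ τ => abs_reward_le C i _) (by simp)
    (fun x => Finset.measurable_fun_sum _ fun k _ =>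
      (measurable_logRatio pol _).comp (measurable_pi_apply k))
    (fun x => (C.measurable_reward i).comp (measurable_pi_apply n))
    (integrable_pathRatio C pol n _)
  simp only [zero_add] at hd
  have e : (fun x : ℝ => stepReward C pol i n (θ + x • v)) = _ :=
    funext fun x => stepReward_eq C pol i n (θ + x • v)
  rw [e]
  exact hd

lemma hasDerivAt_stepReward_line_deriv (h : ScoreBoundOn pol U Mg Mh) (hMg : 0 ≤ Mg)
    (i : Fin (m + 1)) (n : ℕ) {θ v : Param d} {x : ℝ} (hx : θ + x • v ∈ U) :
    HasDerivAt (fun x : ℝ => ∫ τ, C.reward i (τ n) * inner ℝ (scoreSum pol n (θ + x • v) τ) v *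
        pathRatio pol n (θ + x • v) τ ∂pathLaw C pol 0)
      (∫ τ, (C.reward i (τ n) * (∑ k ∈ Finset.range (n + 1),
          inner ℝ (fderiv ℝ (fun θ' => pol.score θ' (τ k)) (θ + x • v) v) v) +
        C.reward i (τ n) * inner ℝ (scoreSum pol n (θ + x • v) τ) v *
          inner ℝ (scoreSum pol n (θ + x • v) τ) v) *
        pathRatio pol n (θ + x • v) τ ∂pathLaw C pol 0) x := by
  obtain ⟨r, hr, hball⟩ := exists_ball_line_mem h.isOpen hx
  have hr1 : ∀ {a b : ℝ} (τ : ℕ → S × A), |a| ≤ b → |C.reward i (τ n) * a| ≤ b :=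
    fun τ hab => by
      rw [abs_mul]
      exact (mul_le_of_le_one_left (abs_nonneg _) (abs_reward_le C i _)).trans hab
  exact hasDerivAt_integral_mul_exp (Q := pathLaw C pol 0) (x₀ := x) (r := r)
    (G := (n + 1) * Mg * ‖v‖)
    (L := fun x τ => ∑ k ∈ Finset.range (n + 1), pol.logRatio (θ + x • v) (τ k))
    (L' := fun x τ => inner ℝ (scoreSum pol n (θ + x • v) τ) v)
    (c := fun x τ => C.reward i (τ n) * inner ℝ (scoreSum pol n (θ + x • v) τ) v)
    (c' := fun x τ => C.reward i (τ n) * ∑ k ∈ Finset.range (n + 1),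
          inner ℝ (fderiv ℝ (fun θ' => pol.score θ' (τ k)) (θ + x • v) v) v)
    (B := (n + 1) * Mg * ‖v‖) (B' := (n + 1) * (Mh * ‖v‖ ^ 2)) hr (by positivity)
    (fun x _ τ => hasDerivAt_log_pathRatio_line n θ v τ x)
    (fun x _ τ => (hasDerivAt_inner_scoreSum_line n θ v τ x).const_mul _)
    (fun x hx τ => abs_inner_scoreSum_le h (hball x hx) n v τ)
    (fun x hx τ => hr1 τ (abs_inner_scoreSum_le h (hball x hx) n v τ))
    (fun x hx τ => hr1 τ (abs_sum_inner_fderiv_le h (hball x hx) v n τ))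
    (fun x => Finset.measurable_fun_sum _ fun k _ =>
      (measurable_logRatio pol _).comp (measurable_pi_apply k))
    (fun x => ((C.measurable_reward i).comp (measurable_pi_apply n)).mul
      (measurable_inner_scoreSum n _ v))
    (integrable_pathRatio C pol n _)

/-- The term with the Hessian of the log-likelihood is bounded pointwise. For the squared score sum
one returns from the reference law to the law of π_θ, under which the scores are orthogonal. -/
lemma abs_stepReward_deriv_two_le (h : ScoreBoundOn pol U Mg Mh)
    (i : Fin (m + 1)) (n : ℕ) {θ v : Param d} (hθ : θ ∈ U) :
    |∫ τ, (C.reward i (τ n) * (∑ k ∈ Finset.range (n + 1),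
          inner ℝ (fderiv ℝ (fun θ' => pol.score θ' (τ k)) θ v) v) +
        C.reward i (τ n) * inner ℝ (scoreSum pol n θ τ) v * inner ℝ (scoreSum pol n θ τ) v) *
        pathRatio pol n θ τ ∂pathLaw C pol 0| ≤ (n + 1) * ((Mg ^ 2 + Mh) * ‖v‖ ^ 2) := by
  set K := (n + 1) * (Mh * ‖v‖ ^ 2) with hK
  have hms : StronglyMeasurable fun τ : ℕ → S × A =>
      K + inner ℝ (scoreSum pol n θ τ) v ^ 2 :=
    (((measurable_inner_scoreSum n θ v).pow_const 2).const_add K).stronglyMeasurable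
  have hsq : Integrable (fun τ : ℕ → S × A => inner ℝ (scoreSum pol n θ τ) v ^ 2)
      (pathLaw C pol θ) :=
    integrable_of_bounded ((measurable_inner_scoreSum n θ v).pow_const 2).aestronglyMeasurable
      (B := ((n + 1) * Mg * ‖v‖) ^ 2) fun τ => by
        rw [norm_pow]
        exact pow_le_pow_left₀ (norm_nonneg _) (abs_inner_scoreSum_le h hθ n v τ) 2
  have e := integral_pathLaw_of_dependsOn C pol n θ hms fun τ τ' hτ => by
    rw [scoreSum_congr n θ hτ]
  rw [integral_add (integrable_const K) hsq, integral_const, probReal_univ, one_smul] at e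
  have hle := integral_sq_inner_scoreSum_le C h hθ v n
  have hbd : Integrable (fun τ : ℕ → S × A =>
      pathRatio pol n θ τ • (K + inner ℝ (scoreSum pol n θ τ) v ^ 2)) (pathLaw C pol 0) := by
    simp_rw [smul_eq_mul, mul_comm (pathRatio pol n θ _)]
    refine (integrable_pathRatio C pol n θ).bdd_mul (c := |K| + ((n + 1) * Mg * ‖v‖) ^ 2)
      hms.aestronglyMeasurable (Filter.Eventually.of_forall fun τ => ?_)
    refine (norm_add_le _ _).trans (add_le_add le_rfl ?_)
    rw [norm_pow]
    exact pow_le_pow_left₀ (norm_nonneg _) (abs_inner_scoreSum_le h hθ n v τ) 2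
  have hfin := norm_integral_le_of_norm_le (f := fun τ : ℕ → S × A =>
    (C.reward i (τ n) * (∑ k ∈ Finset.range (n + 1),
          inner ℝ (fderiv ℝ (fun θ' => pol.score θ' (τ k)) θ v) v) +
        C.reward i (τ n) * inner ℝ (scoreSum pol n θ τ) v * inner ℝ (scoreSum pol n θ τ) v) *
        pathRatio pol n θ τ) hbd (Filter.Eventually.of_forall fun τ => by
      rw [norm_mul, Real.norm_of_nonneg (pathRatio_pos pol n θ τ).le, smul_eq_mul,
        mul_comm (pathRatio pol n θ τ)]
      refine mul_le_mul_of_nonneg_right ?_ (pathRatio_pos pol n θ τ).le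
      rw [mul_assoc, ← mul_add, norm_mul]
      refine (mul_le_of_le_one_left (norm_nonneg _) (abs_reward_le C i _)).trans ?_
      refine (norm_add_le _ _).trans (add_le_add (abs_sum_inner_fderiv_le h hθ v n τ) ?_)
      rw [← pow_two, norm_pow, Real.norm_eq_abs, sq_abs])
  rw [Real.norm_eq_abs, ← e] at hfin
  refine hfin.trans ((add_le_add le_rfl hle).trans (le_of_eq ?_))
  rw [hK]
  ring

lemma abs_stepReward_taylor_le (h : ScoreBoundOn pol U Mg Mh) (hMg : 0 ≤ Mg)
    (i : Fin (m + 1)) (n : ℕ) {θ v : Param d} (hseg : ∀ x ∈ Set.Icc (0 : ℝ) 1, θ + x • v ∈ U) :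
    |stepReward C pol i n (θ + v) - stepReward C pol i n θ - inner ℝ (gradReward C pol i n θ) v| ≤
      (n + 1) * ((Mg ^ 2 + Mh) * ‖v‖ ^ 2 / 2) := by
  have h0 : θ ∈ U := by simpa using hseg 0 (Set.left_mem_Icc.2 zero_le_one)
  have := abs_taylor_two_le
    (fun x hx => hasDerivAt_stepReward_line C h hMg i n (hseg x hx))
    (fun x hx => hasDerivAt_stepReward_line_deriv C h hMg i n (hseg x hx))
    (fun x hx => abs_stepReward_deriv_two_le C h i n (hseg x hx))
  simp only [one_smul, zero_smul, add_zero] at this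
  rw [inner_gradReward C h h0, mul_div_assoc'] 
  exact this

/-! ### The infinite-horizon value -/

lemma hasSum_discount_succ : HasSum (fun n : ℕ => C.γ ^ n * ((n : ℝ) + 1)) (1 / (1 - C.γ) ^ 2) := by
  have hn : ‖C.γ‖ < 1 := by rw [Real.norm_of_nonneg C.γ_pos.le]; exact C.γ_lt_one
  have h1 := hasSum_coe_mul_geometric_of_norm_lt_one hn
  have h2 := hasSum_geometric_of_norm_lt_one hn
  have hγ : 1 - C.γ ≠ 0 := by linarith [C.γ_lt_one]
  convert! h1.add h2 using 1
  · funext n; ring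
  · field_simp; ring

variable (pol) in
/-- The policy gradient `∑ₙ γⁿ ∇ E[r_i(s_n, a_n)]`. -/
noncomputable def policyGrad (i : Fin (m + 1)) (θ : Param d) : Param d :=
  ∑' n, C.γ ^ n • gradReward C pol i n θ

lemma norm_discount_gradReward_le (h : ScoreBoundOn pol U Mg Mh) {θ : Param d} (hθ : θ ∈ U)
    (i : Fin (m + 1)) (n : ℕ) :
    ‖C.γ ^ n • gradReward C pol i n θ‖ ≤ C.γ ^ n * ((n : ℝ) + 1) * Mg := by
  rw [norm_smul, Real.norm_of_nonneg (pow_nonneg C.γ_pos.le n), mul_assoc]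
  exact mul_le_mul_of_nonneg_left (norm_gradReward_le C h hθ i n) (pow_nonneg C.γ_pos.le n)

lemma summable_discount_gradReward (h : ScoreBoundOn pol U Mg Mh) {θ : Param d} (hθ : θ ∈ U)
    (i : Fin (m + 1)) : Summable fun n => C.γ ^ n • gradReward C pol i n θ :=
  Summable.of_norm_bounded ((hasSum_discount_succ C).summable.mul_right Mg)
    (norm_discount_gradReward_le C h hθ i)

lemma norm_policyGrad_le (h : ScoreBoundOn pol U Mg Mh) {θ : Param d} (hθ : θ ∈ U)
    (i : Fin (m + 1)) : ‖policyGrad C pol i θ‖ ≤ Mg / (1 - C.γ) ^ 2 := by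
  have := tsum_of_norm_bounded ((hasSum_discount_succ C).mul_right Mg)
    (norm_discount_gradReward_le C h hθ i)
  rwa [one_div_mul_eq_div] at this

/-- Sum the Taylor estimates of the single steps with ∑ γⁿ (n + 1) = 1 / (1 - γ)². The linear term
is the series `policyGrad`, since differentiability of the value is only deduced from this estimate.
-/
lemma abs_val_taylor_policyGrad_le (h : ScoreBoundOn pol U Mg Mh) (hMg : 0 ≤ Mg)
    (i : Fin (m + 1)) {θ v : Param d} (hseg : ∀ x ∈ Set.Icc (0 : ℝ) 1, θ + x • v ∈ U) :
    |val C pol i (θ + v) - val C pol i θ - inner ℝ (policyGrad C pol i θ) v| ≤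
      (Mg ^ 2 + Mh) / (1 - C.γ) ^ 2 * ‖v‖ ^ 2 / 2 := by
  have h0 : θ ∈ U := by simpa using hseg 0 (Set.left_mem_Icc.2 zero_le_one)
  have s1 := summable_discount C fun n => abs_stepReward_le C pol i n (θ + v)
  have s2 := summable_discount C fun n => abs_stepReward_le C pol i n θ
  have s3 := summable_discount_gradReward C h h0 i
  have s4 : HasSum (fun n => C.γ ^ n * inner ℝ (gradReward C pol i n θ) v)
      (inner ℝ (policyGrad C pol i θ) v) := by
    have := s3.hasSum.mapL ((innerSL ℝ) v)
    simpa [real_inner_smul_right, real_inner_comm, policyGrad] using this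
  have s5 := (s1.hasSum.sub s2.hasSum).sub s4
  rw [val_eq_tsum, val_eq_tsum, ← s5.tsum_eq]
  have s6 := (hasSum_discount_succ C).mul_right ((Mg ^ 2 + Mh) * ‖v‖ ^ 2 / 2)
  have := tsum_of_norm_bounded (f := fun n => C.γ ^ n * stepReward C pol i n (θ + v) -
    C.γ ^ n * stepReward C pol i n θ - C.γ ^ n * inner ℝ (gradReward C pol i n θ) v) s6
    fun n => by
      rw [← mul_sub, ← mul_sub, norm_mul, Real.norm_of_nonneg (pow_nonneg C.γ_pos.le n), mul_assoc]
      exact mul_le_mul_of_nonneg_left (abs_stepReward_taylor_le C h hMg i n hseg)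
        (pow_nonneg C.γ_pos.le n)
  refine this.trans (le_of_eq ?_)
  ring

/-- Small balls around θ lie in U, where the Taylor remainder is O(‖v‖²). -/
lemma gradVal_eq_policyGrad (h : ScoreBoundOn pol U Mg Mh) (hMg : 0 ≤ Mg) {θ : Param d}
    (hθ : θ ∈ U) (i : Fin (m + 1)) : gradVal C pol i θ = policyGrad C pol i θ := by
  refine HasGradientAt.gradient ?_
  rw [hasGradientAt_iff_isLittleO_nhds_zero]
  set K := (Mg ^ 2 + Mh) / (1 - C.γ) ^ 2 / 2
  have hO : (fun v => val C pol i (θ + v) - val C pol i θ - inner ℝ (policyGrad C pol i θ) v)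
      =O[nhds 0] fun v : Param d => ‖v‖ ^ 2 := by
    refine Asymptotics.IsBigO.of_bound K ?_
    obtain ⟨r, hr, hball⟩ := Metric.isOpen_iff.1 h.isOpen θ hθ
    filter_upwards [Metric.ball_mem_nhds (0 : Param d) hr] with v hv
    have := abs_val_taylor_policyGrad_le C h hMg i (θ := θ) (v := v) fun x hx => hball (by
      rw [Metric.mem_ball, dist_eq_norm, add_sub_cancel_left, norm_smul, Real.norm_of_nonneg hx.1]
      rw [mem_ball_zero_iff] at hv
      exact (mul_le_of_le_one_left (norm_nonneg _) hx.2).trans_lt hv)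
    rw [Real.norm_eq_abs, norm_pow, norm_norm]
    refine this.trans (le_of_eq ?_)
    simp only [K]
    ring
  refine hO.trans_isLittleO ?_
  exact (Asymptotics.isLittleO_norm_pow_id one_lt_two)

/-- The set of strictly feasible parameters. -/
def strictlyFeasible (C : CMDP S A m) (pol : PolicyClass S A d) : Set (Param d) :=
  {θ | ∀ i : Fin m, 0 < val C pol i.succ θ}

lemma isOpen_strictlyFeasible : IsOpen (strictlyFeasible C pol) := by
  simp only [strictlyFeasible, Set.ofPred_forall]
  exact isOpen_iInter_of_finite fun i => isOpen_lt continuous_const (continuous_val C pol _)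

lemma strictlyFeasible_subset : strictlyFeasible C pol ⊆ feasible C pol :=
  fun _ hθ i => (hθ i).le

/-- Differentiation needs bounds on neighbourhoods; restricting to the strictly feasible set makes
the domain open. -/
lemma BoundedScore.scoreBoundOn {C : CMDP S A m} (h : BoundedScore C pol Mg Mh) :
    ScoreBoundOn pol (strictlyFeasible C pol) Mg Mh where
  isOpen := isOpen_strictlyFeasible C
  norm_score_le θ hθ z := (h θ (strictlyFeasible_subset C hθ) z).1
  norm_fderiv_le θ hθ z := (h θ (strictlyFeasible_subset C hθ) z).2

end Smoothness

/-! ## Concentration of sums of independent bounded vectors -/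

section Concentration

variable {F : Type*} [NormedAddCommGroup F] [InnerProductSpace ℝ F]

/-- As a function of the square of its argument, cosh is a power series with nonnegative
coefficients, hence convex on [0, ∞). -/
lemma cosh_le_convex_comb {a b c p q : ℝ} (hp : 0 ≤ p) (hq : 0 ≤ q) (hpq : p + q = 1)
    (h : c ^ 2 = p * a ^ 2 + q * b ^ 2) :
    Real.cosh c ≤ p * Real.cosh a + q * Real.cosh b := by
  refine hasSum_le (fun n => ?_) (Real.hasSum_cosh c)
    (((Real.hasSum_cosh a).mul_left p).add ((Real.hasSum_cosh b).mul_left q))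
  rw [mul_div_assoc', mul_div_assoc', ← add_div]
  refine div_le_div_of_nonneg_right ?_ (by positivity)
  rw [pow_mul, pow_mul, pow_mul, h]
  exact (convexOn_pow n).2 (sq_nonneg a) (sq_nonneg b) hp hq hpq

lemma exp_le_add_exp_sq {b : ℝ} (hb : 0 ≤ b) : Real.exp b ≤ b + Real.exp (b ^ 2) := by
  rcases le_total b 1 with h | h
  · have h1 := Real.abs_exp_sub_one_sub_id_le (x := b) (by rwa [abs_of_nonneg hb])
    have h2 := Real.add_one_le_exp (b ^ 2)
    linarith [le_abs_self (Real.exp b - 1 - b)]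
  · have : Real.exp b ≤ Real.exp (b ^ 2) := Real.exp_le_exp.2 (by nlinarith)
    linarith

/-- The potential behind the dimension-free bound. ‖x + y‖² is a convex combination of (‖x‖ - ‖y‖)²
and (‖x‖ + ‖y‖)² with weights given by the angle, so convexity reduces the claim to real numbers.
The remaining first-order term is linear in y and vanishes in the mean for centred y. -/
lemma cosh_norm_add_le (x y : F) :
    Real.cosh ‖x + y‖ ≤ Real.cosh ‖x‖ * Real.exp (‖y‖ ^ 2)
      + Real.sinh ‖x‖ / ‖x‖ * inner ℝ x y := by
  have hexp : 1 ≤ Real.exp (‖y‖ ^ 2) := Real.one_le_exp (sq_nonneg _)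
  have hy := exp_le_add_exp_sq (norm_nonneg y)
  rw [← Real.cosh_add_sinh] at hy
  have hsy : ‖y‖ ≤ Real.sinh ‖y‖ := Real.self_le_sinh_iff.2 (norm_nonneg y)
  rcases eq_or_ne x 0 with rfl | hx
  · simp only [zero_add, norm_zero, Real.cosh_zero, one_mul, inner_zero_left, mul_zero, add_zero]
    linarith
  rcases eq_or_ne y 0 with rfl | hy0
  · simp
  have ha : 0 < ‖x‖ := norm_pos_iff.2 hx
  have hb : 0 < ‖y‖ := norm_pos_iff.2 hy0
  set s := inner ℝ x y / (‖x‖ * ‖y‖) with hs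
  have hs1 : |s| ≤ 1 := abs_real_inner_div_norm_mul_norm_le_one x y
  have hin : inner ℝ x y = s * (‖x‖ * ‖y‖) := by rw [hs]; field_simp
  have h1 := cosh_le_convex_comb (c := ‖x + y‖) (a := ‖x‖ - ‖y‖) (b := ‖x‖ + ‖y‖)
    (p := (1 - s) / 2) (q := (1 + s) / 2) (by linarith [(abs_le.1 hs1).2])
    (by linarith [(abs_le.1 hs1).1]) (by ring) (by
      rw [norm_add_sq_real, hin]; ring)
  rw [Real.cosh_sub, Real.cosh_add] at h1
  have hsa : 0 ≤ Real.sinh ‖x‖ := Real.sinh_nonneg_iff.2 ha.le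
  have hsc : Real.sinh ‖x‖ ≤ Real.cosh ‖x‖ := (Real.sinh_lt_cosh _).le
  have h2 : s * Real.sinh ‖x‖ * (Real.sinh ‖y‖ - ‖y‖) ≤
      Real.cosh ‖x‖ * (Real.sinh ‖y‖ - ‖y‖) := by
    refine mul_le_mul_of_nonneg_right ?_ (by linarith)
    exact (mul_le_of_le_one_left hsa (abs_le.1 hs1).2).trans hsc
  have h3 : Real.sinh ‖x‖ / ‖x‖ * inner ℝ x y = s * Real.sinh ‖x‖ * ‖y‖ := by
    rw [hin]; field_simp
  rw [h3]
  have hc : 0 < Real.cosh ‖x‖ := Real.cosh_pos _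
  nlinarith

variable [MeasurableSpace F] [BorelSpace F] [SecondCountableTopology F] [CompleteSpace F]
  {Z : Type*} [MeasurableSpace Z] {μ : Measure Z} [IsProbabilityMeasure μ]

lemma integral_cosh_norm_add_le {X : Z → F} (hX : Measurable X) {R : ℝ} (hR : ∀ z, ‖X z‖ ≤ R)
    (h0 : ∫ z, X z ∂μ = 0) (x : F) :
    ∫ z, Real.cosh ‖x + X z‖ ∂μ ≤ Real.cosh ‖x‖ * Real.exp (R ^ 2) := by
  have hI : Integrable X μ := integrable_of_bounded hX.aestronglyMeasurable hR
  have hmc : Measurable fun z => Real.cosh ‖x + X z‖ :=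
    Real.continuous_cosh.measurable.comp (hX.const_add x).norm
  have hIc : Integrable (fun z => Real.cosh ‖x + X z‖) μ :=
    integrable_of_bounded hmc.aestronglyMeasurable (B := Real.cosh (‖x‖ + R)) fun z => by
      rw [Real.norm_of_nonneg (Real.cosh_pos _).le, Real.cosh_le_cosh, abs_of_nonneg
        (norm_nonneg _)]
      exact ((norm_add_le _ _).trans (add_le_add le_rfl (hR z))).trans (le_abs_self _)
  calc _ ≤ ∫ z, (Real.cosh ‖x‖ * Real.exp (R ^ 2)
        + Real.sinh ‖x‖ / ‖x‖ * inner ℝ x (X z)) ∂μ := by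
        refine integral_mono hIc ((integrable_const _).add ((hI.const_inner x).const_mul _))
          fun z => (cosh_norm_add_le x (X z)).trans (add_le_add ?_ le_rfl)
        refine mul_le_mul_of_nonneg_left (Real.exp_le_exp.2 ?_) (Real.cosh_pos _).le
        exact pow_le_pow_left₀ (norm_nonneg _) (hR z) 2
    _ = _ := by
        rw [integral_add (integrable_const _) ((hI.const_inner x).const_mul _),
          integral_const_mul _ fun z => inner ℝ x (X z), integral_inner hI, h0]
        simp

lemma integral_cosh_norm_sum_le {X : Z → F} (hX : Measurable X) {R : ℝ} (hR : ∀ z, ‖X z‖ ≤ R)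
    (h0 : ∫ z, X z ∂μ = 0) (n : ℕ) :
    ∫ b, Real.cosh ‖∑ j, X (b j)‖ ∂(Measure.pi fun _ : Fin n => μ) ≤ Real.exp (n * R ^ 2) := by
  induction n with
  | zero => simp
  | succ n ih =>
    have hR0 : 0 ≤ R := by
      obtain ⟨z⟩ := nonempty_of_isProbabilityMeasure μ
      exact (norm_nonneg _).trans (hR z)
    have hS : Measurable fun b : Fin n → Z => ∑ j, X (b j) :=
      Finset.measurable_fun_sum _ fun j _ => hX.comp (measurable_pi_apply j)
    have hSn : ∀ b : Fin n → Z, ‖∑ j, X (b j)‖ ≤ n * R := fun b => by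
      simpa using norm_sum_le_of_le Finset.univ fun j _ => hR (b j)
    have e := (measurePreserving_piFinSuccAbove (fun _ : Fin (n + 1) => μ) 0).symm.integral_comp'
      (fun b => Real.cosh ‖∑ j, X (b j)‖)
    rw [← e]
    have hm : Measurable fun x : Z × (Fin n → Z) => Real.cosh ‖(∑ j, X (x.2 j)) + X x.1‖ :=
      Real.continuous_cosh.measurable.comp
        ((hS.comp measurable_snd).add (hX.comp measurable_fst)).norm
    have hI : Integrable (fun x : Z × (Fin n → Z) => Real.cosh ‖(∑ j, X (x.2 j)) + X x.1‖)
        (μ.prod (Measure.pi fun _ : Fin n => μ)) :=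
      integrable_of_bounded hm.aestronglyMeasurable (B := Real.cosh (n * R + R)) fun x => by
        rw [Real.norm_of_nonneg (Real.cosh_pos _).le, Real.cosh_le_cosh, abs_of_nonneg
          (norm_nonneg _)]
        exact ((norm_add_le _ _).trans (add_le_add (hSn _) (hR _))).trans (le_abs_self _)
    have e2 : ∀ x : Z × (Fin n → Z), Real.cosh ‖∑ j, X ((MeasurableEquiv.piFinSuccAbove
        (fun _ : Fin (n + 1) => Z) 0).symm x j)‖ = Real.cosh ‖(∑ j, X (x.2 j)) + X x.1‖ :=
      fun x => by
        rw [Fin.sum_univ_succ, add_comm]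
        simp [MeasurableEquiv.piFinSuccAbove_symm_apply]
    simp_rw [e2]
    rw [integral_prod_symm _ hI]
    have hmS : Measurable fun b : Fin n → Z => Real.cosh ‖∑ j, X (b j)‖ :=
      Real.continuous_cosh.measurable.comp hS.norm
    have hIS : Integrable (fun b : Fin n → Z => Real.cosh ‖∑ j, X (b j)‖)
        (Measure.pi fun _ : Fin n => μ) :=
      integrable_of_bounded hmS.aestronglyMeasurable (B := Real.cosh (n * R)) fun x => by
        rw [Real.norm_of_nonneg (Real.cosh_pos _).le, Real.cosh_le_cosh, abs_of_nonneg
          (norm_nonneg _)]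
        exact (hSn _).trans (le_abs_self _)
    have hI2 := hI.integral_prod_right
    have hstep : ∫ b, ∫ z, Real.cosh ‖∑ j, X (b j) + X z‖ ∂μ ∂(Measure.pi fun _ : Fin n => μ) ≤
        ∫ b, Real.cosh ‖∑ j, X (b j)‖ * Real.exp (R ^ 2) ∂(Measure.pi fun _ : Fin n => μ) :=
      integral_mono hI2 (hIS.mul_const _)
        fun b => integral_cosh_norm_add_le hX hR h0 (∑ j, X (b j))
    refine hstep.trans ?_
    rw [integral_mul_const]
    refine (mul_le_mul_of_nonneg_right ih (Real.exp_pos _).le).trans (le_of_eq ?_)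
    rw [← Real.exp_add]
    push_cast
    ring_nf

lemma measure_norm_sum_ge_le {X : Z → F} (hX : Measurable X) {R : ℝ} (hR0 : 0 < R)
    (hR : ∀ z, ‖X z‖ ≤ R) (h0 : ∫ z, X z ∂μ = 0) {n : ℕ} (hn : 0 < n) {t : ℝ} (ht : 0 ≤ t) :
    (Measure.pi fun _ : Fin n => μ).real {b | t ≤ ‖∑ j, X (b j)‖} ≤
      2 * Real.exp (-(t ^ 2 / (4 * n * R ^ 2))) := by
  have hn' : (0 : ℝ) < n := Nat.cast_pos.2 hn
  -- The minimizer of the Chernoff exponent n (l R)² - l t.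
  set l := t / (2 * n * R ^ 2) with hl
  have hl0 : 0 ≤ l := by positivity
  have hY : Measurable fun z => l • X z := hX.const_smul l
  have hYb : ∀ z, ‖l • X z‖ ≤ l * R := fun z => by
    rw [norm_smul, Real.norm_of_nonneg hl0]
    exact mul_le_mul_of_nonneg_left (hR z) hl0
  have h := integral_cosh_norm_sum_le (μ := μ) hY hYb (by rw [integral_smul, h0, smul_zero]) n
  have hsum : ∀ b : Fin n → Z, ‖∑ j, l • X (b j)‖ = l * ‖∑ j, X (b j)‖ := fun b => by
    rw [← Finset.smul_sum, norm_smul, Real.norm_of_nonneg hl0]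
  have hS : Measurable fun b : Fin n → Z => ∑ j, l • X (b j) :=
    Finset.measurable_fun_sum _ fun j _ => hY.comp (measurable_pi_apply j)
  have hmS : Measurable fun b : Fin n → Z => Real.cosh ‖∑ j, l • X (b j)‖ :=
    Real.continuous_cosh.measurable.comp hS.norm
  have hIS : Integrable (fun b : Fin n → Z => Real.cosh ‖∑ j, l • X (b j)‖)
      (Measure.pi fun _ : Fin n => μ) :=
    integrable_of_bounded hmS.aestronglyMeasurable (B := Real.cosh (n * (l * R))) fun b => by
      rw [Real.norm_of_nonneg (Real.cosh_pos _).le, Real.cosh_le_cosh, abs_of_nonneg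
        (norm_nonneg _)]
      refine le_trans ?_ (le_abs_self _)
      simpa using norm_sum_le_of_le Finset.univ fun j _ => hYb (b j)
  have hM := mul_meas_ge_le_integral_of_nonneg
    (Filter.Eventually.of_forall fun b => (Real.cosh_pos _).le) hIS (Real.cosh (l * t))
  have hsub : {b : Fin n → Z | t ≤ ‖∑ j, X (b j)‖} ⊆
      {b | Real.cosh (l * t) ≤ Real.cosh ‖∑ j, l • X (b j)‖} := fun b hb => by
    simp only [Set.mem_ofPred_eq] at hb ⊢
    rw [Real.cosh_le_cosh, hsum, abs_of_nonneg (by positivity), abs_of_nonneg (by positivity)]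
    exact mul_le_mul_of_nonneg_left hb hl0
  have hle : Real.cosh (l * t) * (Measure.pi fun _ : Fin n => μ).real
      {b | t ≤ ‖∑ j, X (b j)‖} ≤ Real.exp (n * (l * R) ^ 2) :=
    (mul_le_mul_of_nonneg_left (measureReal_mono hsub) (Real.cosh_pos _).le).trans (hM.trans h)
  have hcosh : Real.exp (l * t) / 2 ≤ Real.cosh (l * t) := by
    rw [Real.cosh_eq]; linarith [Real.exp_pos (-(l * t))]
  have h2 : Real.exp (l * t) / 2 * (Measure.pi fun _ : Fin n => μ).real
      {b | t ≤ ‖∑ j, X (b j)‖} ≤ Real.exp (n * (l * R) ^ 2) :=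
    (mul_le_mul_of_nonneg_right hcosh measureReal_nonneg).trans hle
  have e1 : -(t ^ 2 / (4 * n * R ^ 2)) = n * (l * R) ^ 2 - l * t := by
    rw [hl]; field_simp; ring
  rw [e1, Real.exp_sub, mul_div_assoc', le_div_iff₀ (Real.exp_pos _)]
  linarith

/-- Dimension-free Hoeffding inequality for empirical means. -/
lemma measure_norm_mean_sub_ge_le {X : Z → F} (hX : Measurable X) {R : ℝ} (hR0 : 0 < R)
    (hR : ∀ z, ‖X z‖ ≤ R) {n : ℕ} (hn : 0 < n) {t : ℝ} (ht : 0 ≤ t) :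
    (Measure.pi fun _ : Fin n => μ).real
      {b | t ≤ ‖(1 / (n : ℝ)) • ∑ j, X (b j) - ∫ z, X z ∂μ‖} ≤
      2 * Real.exp (-(n * t ^ 2 / (16 * R ^ 2))) := by
  have hn' : (0 : ℝ) < n := Nat.cast_pos.2 hn
  have hI : Integrable X μ := integrable_of_bounded hX.aestronglyMeasurable hR
  have hE : ‖∫ z, X z ∂μ‖ ≤ R := by
    have := norm_integral_le_of_norm_le_const (μ := μ) (Filter.Eventually.of_forall hR)
    rwa [probReal_univ, mul_one] at this
  -- Centring doubles the radius, which accounts for the 16 in the exponent.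
  have h := measure_norm_sum_ge_le (μ := μ) (X := fun z => X z - ∫ z, X z ∂μ)
    (hX.sub_const _) (R := 2 * R) (by positivity)
    (fun z => (norm_sub_le _ _).trans (by linarith [hR z])) (by
      rw [integral_sub hI (integrable_const _)]; simp) hn (t := n * t) (by positivity)
  have e : -((n * t) ^ 2 / (4 * n * (2 * R) ^ 2)) = -(n * t ^ 2 / (16 * R ^ 2)) := by
    field_simp; ring
  rw [e] at h
  refine le_trans (measureReal_mono fun b hb => ?_) h
  simp only [Set.mem_ofPred_eq] at hb ⊢
  rw [Finset.sum_sub_distrib, Finset.sum_const, Finset.card_univ, Fintype.card_fin,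
    ← Nat.cast_smul_eq_nsmul ℝ]
  have e2 : ∑ j, X (b j) - (n : ℝ) • ∫ z, X z ∂μ =
      (n : ℝ) • ((1 / (n : ℝ)) • ∑ j, X (b j) - ∫ z, X z ∂μ) := by
    rw [smul_sub, smul_smul, mul_one_div_cancel hn'.ne', one_smul]
  rw [e2, norm_smul, Real.norm_of_nonneg hn'.le]
  exact mul_le_mul_of_nonneg_left hb hn'.le

end Concentration

/-! ## The estimators -/

section Estimators

variable {S A : Type*} [MeasurableSpace S] [MeasurableSpace A] {m d : ℕ}
  (C : CMDP S A m) (pol : PolicyClass S A d) {U : Set (Param d)} {Mg Mh : ℝ}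

/-- The first `H` steps of a trajectory. -/
def truncate {Z : Type*} (H : ℕ) (τ : ℕ → Z) : Fin H → Z := fun h => τ h

lemma measurable_truncate {Z : Type*} [MeasurableSpace Z] (H : ℕ) :
    Measurable (truncate (Z := Z) H) :=
  measurable_pi_iff.2 fun _ => measurable_pi_apply _

/-- The law of the first `H` steps of a trajectory of `π_θ`. -/
noncomputable def truncLaw (H : ℕ) (θ : Param d) : Measure (Fin H → S × A) :=
  (pathLaw C pol θ).map (truncate H)

instance (H : ℕ) (θ : Param d) : IsProbabilityMeasure (truncLaw C pol H θ) :=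
  Measure.isProbabilityMeasure_map (measurable_truncate H).aemeasurable

/-- The discounted reward of a truncated trajectory. -/
noncomputable def valSample {H : ℕ} (i : Fin (m + 1)) (y : Fin H → S × A) : ℝ :=
  ∑ t : Fin H, C.γ ^ (t : ℕ) * C.reward i (y t)

/-- The GPOMDP gradient of a truncated trajectory. -/
noncomputable def gradSample {H : ℕ} (i : Fin (m + 1)) (θ : Param d) (y : Fin H → S × A) :
    Param d :=
  ∑ t : Fin H, ∑ t' ∈ Finset.Iic t, (C.γ ^ (t : ℕ) * C.reward i (y t)) • pol.score θ (y t')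

lemma measurable_valSample {H : ℕ} (i : Fin (m + 1)) : Measurable (valSample C (H := H) i) :=
  Finset.measurable_fun_sum _ fun t _ =>
    ((C.measurable_reward i).comp (measurable_pi_apply t)).const_mul _

lemma measurable_gradSample_uncurry {H : ℕ} (i : Fin (m + 1)) :
    Measurable fun x : Param d × (Fin H → S × A) => gradSample C pol i x.1 x.2 := by
  refine Finset.measurable_fun_sum _ fun t _ => Finset.measurable_fun_sum _ fun t' _ => ?_
  have h1 : Measurable fun x : Param d × (Fin H → S × A) => C.reward i (x.2 t) :=
    (C.measurable_reward i).comp ((measurable_pi_apply t).comp measurable_snd)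
  have h2 : Measurable fun x : Param d × (Fin H → S × A) => (x.1, x.2 t') :=
    measurable_fst.prodMk ((measurable_pi_apply t').comp measurable_snd)
  have h3 : Measurable fun x : Param d × (Fin H → S × A) => pol.score x.1 (x.2 t') :=
    (measurable_score_uncurry pol).comp h2
  exact (h1.const_mul _).smul h3

lemma measurable_gradSample {H : ℕ} (i : Fin (m + 1)) (θ : Param d) :
    Measurable fun y : Fin H → S × A => gradSample C pol i θ y := by
  have h := measurable_gradSample_uncurry C pol (H := H) i
  have h2 : Measurable fun y : Fin H → S × A => (θ, y) := measurable_prodMk_left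
  have h3 := h.comp h2
  exact h3

lemma sum_geometric_le (H : ℕ) : ∑ t ∈ Finset.range H, C.γ ^ t ≤ 1 / (1 - C.γ) := by
  rw [one_div]
  exact (summable_geometric_of_lt_one C.γ_pos.le C.γ_lt_one).sum_le_tsum _
    (fun n _ => pow_nonneg C.γ_pos.le n) |>.trans_eq
      (tsum_geometric_of_lt_one C.γ_pos.le C.γ_lt_one)

lemma abs_valSample_le {H : ℕ} (i : Fin (m + 1)) (y : Fin H → S × A) :
    |valSample C i y| ≤ 1 / (1 - C.γ) := by
  refine (Finset.abs_sum_le_sum_abs _ _).trans (le_trans ?_ (sum_geometric_le C H))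
  rw [← Fin.sum_univ_eq_sum_range]
  refine Finset.sum_le_sum fun t _ => ?_
  rw [abs_mul, abs_of_nonneg (pow_nonneg C.γ_pos.le _)]
  exact mul_le_of_le_one_right (pow_nonneg C.γ_pos.le _) (abs_reward_le C i _)

lemma gradSample_truncate {H : ℕ} (i : Fin (m + 1)) (θ : Param d) (τ : ℕ → S × A) :
    gradSample C pol i θ (truncate H τ) =
      ∑ t ∈ Finset.range H, C.γ ^ t • (C.reward i (τ t) • scoreSum pol t θ τ) := by
  rw [← Fin.sum_univ_eq_sum_range
    (fun t => C.γ ^ t • (C.reward i (τ t) • scoreSum pol t θ τ)) H]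
  refine Finset.sum_congr rfl fun t _ => ?_
  rw [← Finset.smul_sum, mul_smul, scoreSum, Nat.range_succ_eq_Iic, ← Fin.map_valEmbedding_Iic,
    Finset.sum_map]
  rfl

lemma exists_truncate_eq {Z : Type*} (z : Z) {H : ℕ} (y : Fin H → Z) :
    ∃ τ : ℕ → Z, truncate H τ = y :=
  ⟨fun k => if h : k < H then y ⟨k, h⟩ else z, by funext k; simp [truncate]⟩

variable {pol}

lemma norm_gradSample_le (h : ScoreBoundOn pol U Mg Mh) {θ : Param d} (hθ : θ ∈ U) (hMg : 0 ≤ Mg)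
    {H : ℕ} (i : Fin (m + 1)) (y : Fin H → S × A) :
    ‖gradSample C pol i θ y‖ ≤ Mg / (1 - C.γ) ^ 2 := by
  rcases Nat.eq_zero_or_pos H with rfl | hH
  · simp only [gradSample, Finset.univ_eq_empty, Finset.sum_empty, norm_zero]
    positivity
  obtain ⟨τ, rfl⟩ := exists_truncate_eq (y ⟨0, hH⟩) y
  rw [gradSample_truncate]
  refine (norm_sum_le_of_le _ (f := fun t => C.γ ^ t • (C.reward i (τ t) • scoreSum pol t θ τ))
    (n := fun t => C.γ ^ t * ((t : ℝ) + 1) * Mg) fun t _ => ?_).trans ?_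
  · rw [norm_smul, Real.norm_of_nonneg (pow_nonneg C.γ_pos.le t), mul_assoc]
    exact mul_le_mul_of_nonneg_left (norm_reward_smul_scoreSum_le C h hθ i t τ)
      (pow_nonneg C.γ_pos.le t)
  · have h1 := hasSum_discount_succ C
    rw [← Finset.sum_mul, div_eq_mul_one_div, mul_comm Mg]
    refine mul_le_mul_of_nonneg_right ?_ hMg
    rw [← h1.tsum_eq]
    exact h1.summable.sum_le_tsum _ fun n _ =>
      mul_nonneg (pow_nonneg C.γ_pos.le n) (by positivity)

variable (pol)

lemma integral_valSample (H : ℕ) (i : Fin (m + 1)) (θ : Param d) :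
    ∫ y, valSample C i y ∂truncLaw C pol H θ =
      ∑ t ∈ Finset.range H, C.γ ^ t * stepReward C pol i t θ := by
  rw [truncLaw, integral_map (measurable_truncate H).aemeasurable
    (measurable_valSample C i).aestronglyMeasurable, ← Fin.sum_univ_eq_sum_range
    (fun t => C.γ ^ t * stepReward C pol i t θ) H]
  simp only [valSample, stepReward, truncate]
  rw [integral_finsetSum]
  · simp_rw [integral_const_mul]
  · intro t _
    exact (integrable_of_bounded
      ((C.measurable_reward i).comp (measurable_pi_apply (t : ℕ))).aestronglyMeasurable
      fun τ => abs_reward_le C i _).const_mul _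

variable {pol}

lemma integral_gradSample (h : ScoreBoundOn pol U Mg Mh) {θ : Param d} (hθ : θ ∈ U) (H : ℕ)
    (i : Fin (m + 1)) :
    ∫ y, gradSample C pol i θ y ∂truncLaw C pol H θ =
      ∑ t ∈ Finset.range H, C.γ ^ t • gradReward C pol i t θ := by
  rw [truncLaw, integral_map (measurable_truncate H).aemeasurable
    (measurable_gradSample C pol i θ).aestronglyMeasurable]
  simp only [gradSample_truncate]
  rw [integral_finsetSum]
  · simp_rw [integral_smul, gradReward]
  · intro t _
    have hI : Integrable (fun τ : ℕ → S × A => C.reward i (τ t) • scoreSum pol t θ τ)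
        (pathLaw C pol θ) :=
      integrable_of_bounded (measurable_reward_smul_scoreSum C i t θ).aestronglyMeasurable
        (norm_reward_smul_scoreSum_le C h hθ i t)
    exact hI.smul (C.γ ^ t)

variable (pol)

lemma abs_val_sub_truncated_le (H : ℕ) (i : Fin (m + 1)) (θ : Param d) :
    |val C pol i θ - ∑ t ∈ Finset.range H, C.γ ^ t * stepReward C pol i t θ| ≤
      C.γ ^ H / (1 - C.γ) := by
  have s1 := summable_discount C fun n => abs_stepReward_le C pol i n θ
  rw [val_eq_tsum, ← s1.sum_add_tsum_nat_add H, add_sub_cancel_left]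
  have := abs_tsum_discount_le C (f := fun n => C.γ ^ H * stepReward C pol i (n + H) θ)
    (B := C.γ ^ H) fun n => by
      rw [abs_mul, abs_of_nonneg (pow_nonneg C.γ_pos.le H)]
      exact mul_le_of_le_one_right (pow_nonneg C.γ_pos.le H) (abs_stepReward_le C pol i _ θ)
  simpa only [← mul_assoc, ← pow_add] using this

variable {pol}

lemma norm_policyGrad_sub_truncated_le (h : ScoreBoundOn pol U Mg Mh) {θ : Param d} (hθ : θ ∈ U)
    (hMg : 0 ≤ Mg) (H : ℕ) (i : Fin (m + 1)) :
    ‖policyGrad C pol i θ - ∑ t ∈ Finset.range H, C.γ ^ t • gradReward C pol i t θ‖ ≤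
      Mg * (C.γ ^ H * (H + 1)) / (1 - C.γ) ^ 2 := by
  have s1 := summable_discount_gradReward C h hθ i
  rw [policyGrad, ← s1.sum_add_tsum_nat_add H, add_sub_cancel_left]
  have hs := (hasSum_discount_succ C).mul_right (Mg * (C.γ ^ H * (H + 1)))
  have := tsum_of_norm_bounded (f := fun n => C.γ ^ (n + H) • gradReward C pol i (n + H) θ) hs
    fun n => by
      refine (norm_discount_gradReward_le C h hθ i (n + H)).trans ?_
      rw [pow_add]
      push_cast
      -- This product form separates the tail index from H, so that the tail is the full series
      -- times γ^H (H + 1).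
      have h1 : (n : ℝ) + H + 1 ≤ (n + 1) * (H + 1) := by
        have : (0 : ℝ) ≤ n * H := by positivity
        linarith
      have h2 : 0 ≤ C.γ ^ n * C.γ ^ H * Mg :=
        mul_nonneg (mul_nonneg (pow_nonneg C.γ_pos.le n) (pow_nonneg C.γ_pos.le H)) hMg
      have := mul_le_mul_of_nonneg_left h1 h2
      linarith
  rwa [one_div_mul_eq_div] at this

end Estimators

/-! ### Accuracy and measurability of the sampled batches -/

section Batches

variable {S A : Type*} [MeasurableSpace S] [MeasurableSpace A] {m d : ℕ}
  (C : CMDP S A m) (pol : PolicyClass S A d) (p : LBInput) {U : Set (Param d)} {Mg Mh : ℝ}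

lemma batchLaw_eq (θ : Param d) :
    batchLaw C pol p θ = Measure.pi fun _ : Fin p.n => truncLaw C pol p.H θ := rfl

instance (θ : Param d) : IsProbabilityMeasure (batchLaw C pol p θ) := by
  rw [batchLaw_eq]; infer_instance

lemma valHat_eq (i : Fin (m + 1)) (b : Batch S A p) :
    valHat C p i b = (1 / (p.n : ℝ)) • ∑ j, valSample C i (b j) := rfl

lemma gradHat_eq (i : Fin (m + 1)) (θ : Param d) (b : Batch S A p) :
    gradHat C pol p i θ b = (1 / (p.n : ℝ)) • ∑ j, gradSample C pol i θ (b j) := rfl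

lemma measure_valHat_bad_le (hn : 0 < p.n) (θ : Param d) (i : Fin (m + 1)) {u : ℝ} (hu : 0 ≤ u) :
    (batchLaw C pol p θ).real
      {b | u + C.γ ^ p.H / (1 - C.γ) < |valHat C p i b - val C pol i θ|} ≤
      2 * Real.exp (-(p.n * u ^ 2 * (1 - C.γ) ^ 2 / 16)) := by
  have hγ : 0 < 1 - C.γ := by linarith [C.γ_lt_one]
  have h := measure_norm_mean_sub_ge_le (μ := truncLaw C pol p.H θ) (measurable_valSample C i)
    (R := 1 / (1 - C.γ)) (by positivity) (abs_valSample_le C i) hn hu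
  have e : -(p.n * u ^ 2 / (16 * (1 / (1 - C.γ)) ^ 2)) =
      -(p.n * u ^ 2 * (1 - C.γ) ^ 2 / 16) := by field_simp
  rw [e, ← batchLaw_eq] at h
  refine le_trans (measureReal_mono fun b hb => ?_) h
  simp only [Set.mem_ofPred_eq] at hb ⊢
  rw [← valHat_eq, integral_valSample, Real.norm_eq_abs]
  have h1 := abs_val_sub_truncated_le C pol p.H i θ
  have h2 := abs_sub_le (valHat C p i b)
    (∑ t ∈ Finset.range p.H, C.γ ^ t * stepReward C pol i t θ) (val C pol i θ)
  rw [abs_sub_comm] at h1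
  linarith

variable {pol}

lemma measure_gradHat_bad_le (h : ScoreBoundOn pol U Mg Mh) (hMg : 0 < Mg) (hn : 0 < p.n)
    {θ : Param d} (hθ : θ ∈ U) (i : Fin (m + 1)) {u : ℝ} (hu : 0 ≤ u) :
    (batchLaw C pol p θ).real
      {b | u + Mg * (C.γ ^ p.H * (p.H + 1)) / (1 - C.γ) ^ 2 <
        ‖gradHat C pol p i θ b - gradVal C pol i θ‖} ≤
      2 * Real.exp (-(p.n * u ^ 2 * (1 - C.γ) ^ 4 / (16 * Mg ^ 2))) := by
  have hγ : 0 < 1 - C.γ := by linarith [C.γ_lt_one]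
  have hc := measure_norm_mean_sub_ge_le (μ := truncLaw C pol p.H θ)
    (measurable_gradSample C pol i θ)
    (R := Mg / (1 - C.γ) ^ 2) (by positivity) (norm_gradSample_le C h hθ hMg.le i) hn hu
  have e : -(p.n * u ^ 2 / (16 * (Mg / (1 - C.γ) ^ 2) ^ 2)) =
      -(p.n * u ^ 2 * (1 - C.γ) ^ 4 / (16 * Mg ^ 2)) := by field_simp
  rw [e, ← batchLaw_eq] at hc
  refine le_trans (measureReal_mono fun b hb => ?_) hc
  simp only [Set.mem_ofPred_eq] at hb ⊢
  rw [← gradHat_eq, integral_gradSample C h hθ]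
  rw [gradVal_eq_policyGrad C h hMg.le hθ] at hb
  have h1 := norm_policyGrad_sub_truncated_le C h hθ hMg.le p.H i
  have h2 := norm_sub_le_norm_sub_add_norm_sub (gradHat C pol p i θ b)
    (∑ t ∈ Finset.range p.H, C.γ ^ t • gradReward C pol i t θ) (policyGrad C pol i θ)
  rw [norm_sub_rev] at h1
  linarith

variable (pol)

/-- The estimates of a batch drawn at `θ` are `e₀`- and `e₁`-accurate. -/
def AccurateBatch (e₀ e₁ : ℝ) (θ : Param d) (b : Batch S A p) : Prop :=
  (∀ i : Fin (m + 1), |valHat C p i b - val C pol i θ| ≤ e₀) ∧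
    ∀ i : Fin (m + 1), ‖gradHat C pol p i θ b - gradVal C pol i θ‖ ≤ e₁

variable {pol}

/-- A union bound over the 2(m + 1) estimates. The thresholds e₀, e₁ are prescribed by the
algorithm; u₀, u₁ are the parts left for random deviation once the truncation bias is paid. -/
lemma measure_not_accurateBatch_le (h : ScoreBoundOn pol U Mg Mh) (hMg : 0 < Mg) (hn : 0 < p.n)
    {θ : Param d} (hθ : θ ∈ U) {e₀ e₁ u₀ u₁ q₀ q₁ : ℝ} (hu₀ : 0 ≤ u₀) (hu₁ : 0 ≤ u₁)
    (he₀ : u₀ + C.γ ^ p.H / (1 - C.γ) ≤ e₀)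
    (he₁ : u₁ + Mg * (C.γ ^ p.H * (p.H + 1)) / (1 - C.γ) ^ 2 ≤ e₁)
    (hq₀ : 2 * Real.exp (-(p.n * u₀ ^ 2 * (1 - C.γ) ^ 2 / 16)) ≤ q₀)
    (hq₁ : 2 * Real.exp (-(p.n * u₁ ^ 2 * (1 - C.γ) ^ 4 / (16 * Mg ^ 2))) ≤ q₁) :
    batchLaw C pol p θ {b | ¬ AccurateBatch C pol p e₀ e₁ θ b} ≤
      ENNReal.ofReal ((m + 1) * (q₀ + q₁)) := by
  rw [← ofReal_measureReal]
  refine ENNReal.ofReal_le_ofReal ?_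
  have hsub : {b | ¬ AccurateBatch C pol p e₀ e₁ θ b} ⊆
      (⋃ i : Fin (m + 1), {b | u₀ + C.γ ^ p.H / (1 - C.γ) < |valHat C p i b - val C pol i θ|}) ∪
      ⋃ i : Fin (m + 1), {b | u₁ + Mg * (C.γ ^ p.H * (p.H + 1)) / (1 - C.γ) ^ 2 <
        ‖gradHat C pol p i θ b - gradVal C pol i θ‖} := by
    intro b hb
    simp only [AccurateBatch, Set.mem_ofPred_eq, not_and_or, not_forall, not_le] at hb
    rcases hb with ⟨i, hi⟩ | ⟨i, hi⟩
    · exact Or.inl (Set.mem_iUnion.2 ⟨i, lt_of_le_of_lt he₀ hi⟩)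
    · exact Or.inr (Set.mem_iUnion.2 ⟨i, lt_of_le_of_lt he₁ hi⟩)
  have hi₀ := fun i => (measure_valHat_bad_le C pol p hn θ i hu₀).trans hq₀
  have hi₁ := fun i => (measure_gradHat_bad_le C p h hMg hn hθ i hu₁).trans hq₁
  have h₀ := (measureReal_iUnion_fintype_le (μ := batchLaw C pol p θ) fun i : Fin (m + 1) =>
    {b | u₀ + C.γ ^ p.H / (1 - C.γ) < |valHat C p i b - val C pol i θ|}).trans
    (Finset.sum_le_sum fun i _ => hi₀ i)
  have h₁ := (measureReal_iUnion_fintype_le (μ := batchLaw C pol p θ) fun i : Fin (m + 1) =>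
    {b | u₁ + Mg * (C.γ ^ p.H * (p.H + 1)) / (1 - C.γ) ^ 2 <
        ‖gradHat C pol p i θ b - gradVal C pol i θ‖}).trans
    (Finset.sum_le_sum fun i _ => hi₁ i)
  simp only [Finset.sum_const, Finset.card_univ, Fintype.card_fin, nsmul_eq_mul] at h₀ h₁
  push_cast at h₀ h₁
  refine (measureReal_mono hsub).trans ((measureReal_union_le _ _).trans ?_)
  linarith

/-! ### Measurability -/

variable (pol)

lemma measurable_valHat (i : Fin (m + 1)) :
    Measurable fun b : Batch S A p => valHat C p i b := by
  simp_rw [valHat_eq]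
  have h : ∀ j, Measurable fun b : Batch S A p => valSample C i (b j) := fun j =>
    (measurable_valSample C i).comp (measurable_pi_apply j)
  exact (Finset.measurable_fun_sum _ fun j _ => h j).const_smul (1 / (p.n : ℝ))

lemma measurable_gradHat (i : Fin (m + 1)) :
    Measurable fun x : Param d × Batch S A p => gradHat C pol p i x.1 x.2 := by
  simp_rw [gradHat_eq]
  have h : ∀ j, Measurable fun x : Param d × Batch S A p => gradSample C pol i x.1 (x.2 j) :=
    fun j => by
      have h2 : Measurable fun x : Param d × Batch S A p => (x.1, x.2 j) :=
        measurable_fst.prodMk ((measurable_pi_apply j).comp measurable_snd)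
      have h3 := (measurable_gradSample_uncurry C pol (H := p.H) i).comp h2
      exact h3
  exact (Finset.measurable_fun_sum _ fun j _ => h j).const_smul (1 / (p.n : ℝ))

lemma measurable_gradVal (i : Fin (m + 1)) : Measurable (gradVal C pol i) := by
  unfold gradVal gradient
  exact (InnerProductSpace.toDual ℝ (Param d)).symm.continuous.measurable.comp
    (measurable_fderiv ℝ _)

lemma measurableSet_accurateBatch (e₀ e₁ : ℝ) :
    MeasurableSet {x : Param d × Batch S A p | AccurateBatch C pol p e₀ e₁ x.1 x.2} := by
  simp only [AccurateBatch, Set.ofPred_and, Set.ofPred_forall]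
  refine (MeasurableSet.iInter fun i => ?_).inter (MeasurableSet.iInter fun i => ?_)
  · exact measurableSet_le (((measurable_valHat C p i).comp measurable_snd).sub
      ((continuous_val C pol i).measurable.comp measurable_fst)).norm measurable_const
  · exact measurableSet_le ((measurable_gradHat C pol p i).sub
      ((measurable_gradVal C pol i).comp measurable_fst)).norm measurable_const

lemma measurable_barrierGradHat :
    Measurable fun x : Param d × Batch S A p => barrierGradHat C pol p x.1 x.2 := by
  have h1 : ∀ i : Fin m, Measurable fun x : Param d × Batch S A p => valHat C p i.succ x.2 :=
    fun i => (measurable_valHat C p i.succ).comp measurable_snd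
  have h2 : ∀ i : Fin m, Measurable fun x : Param d × Batch S A p =>
      (valHat C p i.succ x.2)⁻¹ • gradHat C pol p i.succ x.1 x.2 :=
    fun i => (h1 i).inv.smul (measurable_gradHat C pol p i.succ)
  exact (measurable_gradHat C pol p 0).add
    ((Finset.measurable_fun_sum _ fun i _ => h2 i).const_smul p.η)

lemma measurable_alphaLow (i : Fin m) :
    Measurable fun b : Batch S A p => alphaLow C p i b :=
  ((measurable_valHat C p _).sub_const _).sub_const _

lemma measurable_betaUp (i : Fin m) :
    Measurable fun x : Param d × Batch S A p => betaUp C pol p i x.1 x.2 := by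
  have h := measurable_barrierGradHat C pol p
  have h2 := measurable_gradHat C pol p i.succ
  have h3 : Measurable fun x : Param d × Batch S A p =>
      ‖barrierGradHat C pol p x.1 x.2‖⁻¹ • barrierGradHat C pol p x.1 x.2 := h.norm.inv.smul h
  have h4 : Measurable fun x : Param d × Batch S A p =>
      |inner ℝ (gradHat C pol p i.succ x.1 x.2)
        (‖barrierGradHat C pol p x.1 x.2‖⁻¹ • barrierGradHat C pol p x.1 x.2)| :=
    (Measurable.inner (𝕜 := ℝ) h2 h3).norm
  exact (h4.add_const _).add_const _

lemma measurable_stepsize :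
    Measurable fun x : Param d × Batch S A p => stepsize C pol p x.1 x.2 := by
  have hα : ∀ i : Fin m, Measurable fun x : Param d × Batch S A p => alphaLow C p i x.2 :=
    fun i => (measurable_alphaLow C p i).comp measurable_snd
  have hβ := measurable_betaUp C pol p
  have hs : Measurable fun x : Param d × Batch S A p => smoothHat C pol p x.1 x.2 :=
    (measurable_const.add (Finset.measurable_fun_sum _ fun i _ =>
      measurable_const.div (hα i))).add ((Finset.measurable_fun_sum _ fun i _ =>
        ((hβ i).pow_const 2).div ((hα i).pow_const 2)).const_mul _)
  refine (measurable_const.div hs).min (Measurable.mul ?_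
    (measurable_const.div (measurable_barrierGradHat C pol p).norm))
  exact Measurable.iInf fun i => (hα i).div
    ((((hα i).const_mul _).sqrt).add ((hβ i).norm.const_mul 2))

lemma measurable_lbStep :
    Measurable fun x : (Param d × Bool) × Batch S A p => lbStep C pol p x.1 x.2 := by
  have hθ : Measurable fun x : (Param d × Bool) × Batch S A p => (x.1.1, x.2) :=
    (measurable_fst.comp measurable_fst).prodMk measurable_snd
  have hg := (measurable_barrierGradHat C pol p).comp hθ
  have hs := (measurable_stepsize C pol p).comp hθ
  unfold lbStep
  refine Measurable.ite ((measurable_snd.comp measurable_fst) (measurableSet_singleton true))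
    measurable_fst (Measurable.ite (measurableSet_le hg.norm measurable_const) ?_ ?_)
  · exact (measurable_fst.comp measurable_fst).prodMk measurable_const
  · exact ((measurable_fst.comp measurable_fst).add (hs.smul hg)).prodMk measurable_const

lemma measurable_lbState (θ₀ : Param d) {T : ℕ} (t : ℕ) :
    Measurable fun ω : Fin T → Batch S A p => lbState C pol p θ₀ ω t := by
  induction t with
  | zero => exact measurable_const
  | succ t ih =>
    by_cases h : t < T
    · simp only [lbState, h, dite_true]
      exact (measurable_lbStep C pol p).comp (ih.prodMk (measurable_pi_apply _))
    · simpa only [lbState, h, dite_false] using ih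

lemma measurable_lbIterate (θ₀ : Param d) {T : ℕ} (t : ℕ) :
    Measurable fun ω : Fin T → Batch S A p => lbIterate C pol p θ₀ ω t :=
  measurable_fst.comp (measurable_lbState C pol p θ₀ t)

/-- The parameter enters only through the likelihood ratio against the reference law, and that ratio
is jointly measurable. -/
lemma measurable_truncLaw (H : ℕ) : Measurable (truncLaw C pol H) := by
  refine Measure.measurable_of_measurable_coe _ fun s hs => ?_
  have hF : Measurable fun h : Π _ : Finset.Iic H, S × A =>
      s.indicator (fun _ => (1 : ENNReal)) (truncate H (histExtend H h)) :=
    (measurable_const.indicator hs).comp ((measurable_truncate H).comp (measurable_histExtend H))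
  have e : ∀ θ, truncLaw C pol H θ s = ∫⁻ τ, s.indicator (fun _ => (1 : ENNReal)) (truncate H τ) *
      ENNReal.ofReal (pathRatio pol H θ τ) ∂pathLaw C pol 0 := fun θ => by
    have h1 : ∀ τ : ℕ → S × A,
        truncate H (histExtend H (Preorder.frestrictLe H τ)) = truncate H τ := fun τ => by
      funext k
      simp [truncate, histExtend, k.2.le]
    have h2 := lintegral_pathLaw C pol H θ hF
    simp only [h1] at h2
    rw [← h2, ← lintegral_map (measurable_const.indicator hs) (measurable_truncate H)]
    exact (lintegral_indicator_one hs).symm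
  simp_rw [e]
  have hm : Measurable fun x : Param d × (ℕ → S × A) =>
      s.indicator (fun _ => (1 : ENNReal)) (truncate H x.2) *
        ENNReal.ofReal (pathRatio pol H x.1 x.2) :=
    ((measurable_const.indicator hs).comp ((measurable_truncate H).comp measurable_snd)).mul
      (measurable_pathRatio_uncurry pol H).ennreal_ofReal
  exact hm.lintegral_prod_right'

lemma measurable_batchLaw : Measurable (batchLaw C pol p) := by
  refine Measurable.measure_of_isPiSystem_of_isProbabilityMeasure generateFrom_pi.symm
    isPiSystem_pi ?_
  rintro s ⟨t, ht, rfl⟩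
  simp_rw [batchLaw_eq, Measure.pi_pi]
  exact Finset.measurable_fun_prod _ fun j _ =>
    (Measure.measurable_coe (show MeasurableSet (t j) from ht j (Set.mem_univ j))).comp
      (measurable_truncLaw C pol p.H)

/-- The law of the batch of iteration `t` given the previous batches. -/
noncomputable def batchKernel (θ₀ : Param d) (t : ℕ) :
    Kernel (Fin t → Batch S A p) (Batch S A p) where
  toFun ω := batchLaw C pol p (lbIterate C pol p θ₀ ω t)
  measurable' := (measurable_batchLaw C pol p).comp (measurable_lbIterate C pol p θ₀ t)

instance (θ₀ : Param d) (t : ℕ) : IsMarkovKernel (batchKernel C pol p θ₀ t) :=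
  ⟨fun ω => inferInstanceAs (IsProbabilityMeasure
    (batchLaw C pol p (lbIterate C pol p θ₀ ω t)))⟩

lemma measurable_snoc {Z : Type*} [MeasurableSpace Z] (t : ℕ) :
    Measurable fun x : (Fin t → Z) × Z =>
      (Fin.snoc (α := fun _ => Z) x.1 x.2 : Fin (t + 1) → Z) := by
  refine measurable_pi_iff.2 fun k => ?_
  by_cases h : (k : ℕ) < t
  · simp only [Fin.snoc, h, dite_true]
    exact (measurable_pi_apply _).comp measurable_fst
  · simp only [Fin.snoc, h, dite_false]
    exact measurable_snd

/-- Writes the recursion as composition with a Markov kernel. This rests on the measurable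
dependence of the batch law on the past. -/
lemma lbLaw_succ (θ₀ : Param d) (t : ℕ) :
    lbLaw C pol p θ₀ (t + 1) = ((lbLaw C pol p θ₀ t).bind
      ((Kernel.id ×ₖ batchKernel C pol p θ₀ t).map fun x =>
        (Fin.snoc (α := fun _ => Batch S A p) x.1 x.2 : Fin (t + 1) → Batch S A p))) := by
  rw [lbLaw]
  congr with ω : 1
  rw [Kernel.map_apply _ (measurable_snoc t), Kernel.prod_apply, Kernel.id_apply,
    Measure.dirac_prod, Measure.map_map (measurable_snoc t) measurable_prodMk_left]
  rfl

instance isProbabilityMeasure_lbLaw (θ₀ : Param d) (T : ℕ) :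
    IsProbabilityMeasure (lbLaw C pol p θ₀ T) := by
  induction T with
  | zero => unfold lbLaw; infer_instance
  | succ t ih =>
    rw [lbLaw_succ]
    have : IsMarkovKernel ((Kernel.id ×ₖ batchKernel C pol p θ₀ t).map fun x =>
        (Fin.snoc (α := fun _ => Batch S A p) x.1 x.2 : Fin (t + 1) → Batch S A p)) :=
      Kernel.IsMarkovKernel.map _ (measurable_snoc t)
    infer_instance

lemma lbState_snoc (θ₀ : Param d) {T : ℕ} (ω : Fin T → Batch S A p) (b : Batch S A p) {t : ℕ}
    (ht : t ≤ T) : lbState C pol p θ₀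
      (Fin.snoc (α := fun _ => Batch S A p) ω b : Fin (T + 1) → Batch S A p) t =
        lbState C pol p θ₀ ω t := by
  induction t with
  | zero => rfl
  | succ t ih =>
    have h1 : t < T := ht
    have h2 : t < T + 1 := by omega
    simp only [lbState, h1, h2, dite_true, ih h1.le]
    congr 1
    simp [Fin.snoc, h1]

/-- All batches drawn at parameters of `U` are accurate. -/
def AccurateRun (U : Set (Param d)) (e₀ e₁ : ℝ) (θ₀ : Param d) {T : ℕ}
    (ω : Fin T → Batch S A p) : Prop :=
  ∀ t : Fin T, lbIterate C pol p θ₀ ω t ∈ U →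
    AccurateBatch C pol p e₀ e₁ (lbIterate C pol p θ₀ ω t) (ω t)

lemma measurableSet_accurateRun (hU : IsOpen U) (e₀ e₁ : ℝ) (θ₀ : Param d) (T : ℕ) :
    MeasurableSet {ω : Fin T → Batch S A p | AccurateRun C pol p U e₀ e₁ θ₀ ω} := by
  simp only [AccurateRun, Set.ofPred_forall, imp_iff_not_or, Set.ofPred_or]
  refine MeasurableSet.iInter fun t => MeasurableSet.union ?_ ?_
  · exact ((measurable_lbIterate C pol p θ₀ t) hU.measurableSet).compl
  · exact ((measurable_lbIterate C pol p θ₀ (t : ℕ)).prodMk (measurable_pi_apply t))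
      (measurableSet_accurateBatch C pol p e₀ e₁)

lemma accurateRun_snoc (e₀ e₁ : ℝ) (θ₀ : Param d) {T : ℕ} (ω : Fin T → Batch S A p)
    (b : Batch S A p) : AccurateRun C pol p U e₀ e₁ θ₀
      (Fin.snoc (α := fun _ => Batch S A p) ω b : Fin (T + 1) → Batch S A p) ↔
    AccurateRun C pol p U e₀ e₁ θ₀ ω ∧ (lbIterate C pol p θ₀ ω T ∈ U →
      AccurateBatch C pol p e₀ e₁ (lbIterate C pol p θ₀ ω T) b) := by
  rw [AccurateRun, Fin.forall_fin_succ']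
  simp only [Fin.snoc_castSucc, Fin.snoc_last, lbIterate, Fin.val_castSucc, Fin.val_last,
    lbState_snoc C pol p θ₀ ω b le_rfl]
  refine and_congr_left fun _ => forall_congr' fun t => ?_
  rw [lbState_snoc C pol p θ₀ ω b t.2.le]
  rfl

/-- A union bound in which each batch is controlled conditionally on its predecessors. Only iterates
in U are constrained, because the score bounds hold only there; for the runs of interest the
deterministic analysis shows afterwards that no iterate leaves U. -/
lemma measure_not_accurateRun_le (hU : IsOpen U) {e₀ e₁ q : ℝ} (hq : 0 ≤ q)
    (hb : ∀ θ ∈ U, batchLaw C pol p θ {b | ¬ AccurateBatch C pol p e₀ e₁ θ b} ≤ ENNReal.ofReal q)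
    (θ₀ : Param d) (T : ℕ) :
    lbLaw C pol p θ₀ T {ω | ¬ AccurateRun C pol p U e₀ e₁ θ₀ ω} ≤ ENNReal.ofReal (T * q) := by
  induction T with
  | zero =>
    have : {ω : Fin 0 → Batch S A p | ¬ AccurateRun C pol p U e₀ e₁ θ₀ ω} = ∅ := by
      ext ω; simp [AccurateRun]
    simp [this]
  | succ T ih =>
    have hm := (measurableSet_accurateRun C pol p hU e₀ e₁ θ₀ (T + 1)).compl
    have hm' := (measurableSet_accurateRun C pol p hU e₀ e₁ θ₀ T).compl
    rw [lbLaw_succ, ← Set.compl_ofPred, Measure.bind_apply hm (Kernel.aemeasurable _)]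
    have hle : ∀ ω, ((Kernel.id ×ₖ batchKernel C pol p θ₀ T).map fun x =>
        (Fin.snoc (α := fun _ => Batch S A p) x.1 x.2 : Fin (T + 1) → Batch S A p)) ω
          {ω | AccurateRun C pol p U e₀ e₁ θ₀ ω}ᶜ ≤
        ({ω | AccurateRun C pol p U e₀ e₁ θ₀ ω}ᶜ).indicator 1 ω + ENNReal.ofReal q := by
      intro ω
      rw [Kernel.map_apply _ (measurable_snoc T), Kernel.prod_apply, Kernel.id_apply,
        Measure.dirac_prod, Measure.map_map (measurable_snoc T) measurable_prodMk_left,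
        Measure.map_apply ((measurable_snoc T).comp measurable_prodMk_left) hm]
      by_cases hω : AccurateRun C pol p U e₀ e₁ θ₀ ω
      · rw [Set.indicator_of_notMem (by simpa using hω), zero_add]
        by_cases hin : lbIterate C pol p θ₀ ω T ∈ U
        · refine le_trans (measure_mono fun b hb => ?_) (hb _ hin)
          simp only [Set.preimage_compl, Set.mem_compl_iff, Set.mem_preimage, Function.comp_apply,
            Set.mem_ofPred_eq, accurateRun_snoc] at hb ⊢
          exact fun h => hb ⟨hω, fun _ => h⟩
        · refine le_of_eq_of_le ?_ zero_le
          convert! measure_empty (μ := batchKernel C pol p θ₀ T ω)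
          ext b
          simp [accurateRun_snoc, hω, hin]
      · rw [Set.indicator_of_mem (by simpa using hω)]
        exact le_add_right prob_le_one
    refine (lintegral_mono hle).trans ?_
    rw [lintegral_add_right _ measurable_const, lintegral_indicator_one hm', lintegral_const,
      measure_univ, mul_one]
    refine (add_le_add_left ih _).trans ?_
    rw [← ENNReal.ofReal_add (by positivity) hq]
    refine ENNReal.ofReal_le_ofReal (le_of_eq ?_)
    push_cast
    ring

end Batches

/-! ## Log barrier steps for smooth constrained problems -/

/-- A constrained maximization problem with objective `V 0` and constraints `V i.succ ≥ 0`, smooth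
on the strictly feasible set. -/
structure SmoothProblem (E : Type*) [NormedAddCommGroup E] [InnerProductSpace ℝ E] (m : ℕ) where
  V : Fin (m + 1) → E → ℝ
  g : Fin (m + 1) → E → E
  M : ℝ
  L : ℝ
  B : ℝ
  M_pos : 0 < M
  L_pos : 0 < L
  B_pos : 0 < B
  continuous_V : ∀ i : Fin m, Continuous (V i.succ)
  -- Smoothness is required only along strictly feasible segments, so safety of a step must be
  -- proved before the estimate can be used on it.
  taylor : ∀ (i : Fin (m + 1)) (θ v : E),
    (∀ x ∈ Set.Icc (0 : ℝ) 1, ∀ j : Fin m, 0 < V j.succ (θ + x • v)) →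
      |V i (θ + v) - V i θ - inner ℝ (g i θ) v| ≤ M * ‖v‖ ^ 2 / 2
  norm_g_le : ∀ (i : Fin (m + 1)) (θ : E), (∀ j : Fin m, 0 < V j.succ θ) → ‖g i θ‖ ≤ L
  V_le : ∀ (i : Fin (m + 1)) (θ : E), V i θ ≤ B

/-- With a = √(Mα), the hypothesis reads (a + 2β)Δ ≤ α. In particular aΔ ≤ α, and as a² = Mα this
gives MΔ² ≤ aΔ. Both conclusions follow. -/
lemma step_length_bounds {M α β Δ : ℝ} (hM : 0 < M) (hα : 0 < α) (hβ : 0 ≤ β) (hΔ : 0 ≤ Δ)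
    (h : Δ ≤ α / (√(M * α) + 2 * β)) : β * Δ + M * Δ ^ 2 / 2 ≤ α / 2 ∧ M * Δ ^ 2 ≤ α := by
  set a := √(M * α) with ha
  have ha0 : 0 < a := Real.sqrt_pos.2 (mul_pos hM hα)
  have ha2 : a ^ 2 = M * α := Real.sq_sqrt (mul_pos hM hα).le
  have hD : 0 < a + 2 * β := by positivity
  rw [le_div_iff₀ hD] at h
  have hβΔ : 0 ≤ β * Δ := mul_nonneg hβ hΔ
  have haΔ : 0 ≤ a * Δ := mul_nonneg ha0.le hΔ
  have h1 : M * Δ ^ 2 ≤ a * Δ := by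
    have h2 : (M * Δ ^ 2) * α ≤ (a * Δ) * α := by
      have : (M * Δ ^ 2) * α = (a * Δ) * (a * Δ) := by
        calc _ = (M * α) * Δ ^ 2 := by ring
          _ = _ := by rw [← ha2]; ring
      rw [this]
      exact mul_le_mul_of_nonneg_left (by linarith) haΔ
    exact le_of_mul_le_mul_right h2 hα
  constructor <;> linarith

lemma sub_two_mul_sq_le_log {y : ℝ} (hy : |y| ≤ 1 / 2) : y - 2 * y ^ 2 ≤ Real.log (1 + y) := by
  have h := Real.abs_log_sub_add_sum_range_le (x := -y) (by rw [abs_neg]; linarith) 1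
  simp only [Finset.sum_range_one, abs_neg, sub_neg_eq_add] at h
  norm_num at h
  have h2 : y ^ 2 / (1 - |y|) ≤ 2 * y ^ 2 := by
    rw [div_le_iff₀ (by linarith)]
    nlinarith [sq_nonneg y]
  have h3 := (abs_le.1 h).1
  linarith

namespace SmoothProblem

variable {E : Type*} [NormedAddCommGroup E] [InnerProductSpace ℝ E] {m : ℕ}
  (P : SmoothProblem E m)

/-- Strict feasibility. -/
def StrictlyFeasible (θ : E) : Prop := ∀ j : Fin m, 0 < P.V j.succ θ

/-- The gradient of the log barrier function. -/
noncomputable def barrierGrad (η : ℝ) (θ : E) : E :=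
  P.g 0 θ + η • ∑ i : Fin m, (P.V i.succ θ)⁻¹ • P.g i.succ θ

/-- The log barrier function. -/
noncomputable def barrier (η : ℝ) (θ : E) : ℝ :=
  P.V 0 θ + η * ∑ i : Fin m, Real.log (P.V i.succ θ)

variable {P} {θ v : E} {α β : Fin m → ℝ}

/-- The length bound keeps the possible first-order loss plus the second-order loss below α / 2,
hence below half of the current value. Feasibility of the segment is assumed here and removed by a
first-exit argument. -/
lemma half_le_of_segment (hα : ∀ i, 0 < α i) (hαV : ∀ i, α i ≤ P.V i.succ θ)
    (hβ : ∀ i, 0 ≤ β i) (hβg : ∀ i, |inner ℝ (P.g i.succ θ) v| ≤ β i * ‖v‖)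
    (hv : ∀ i, ‖v‖ ≤ α i / (√(P.M * α i) + 2 * β i)) {y : ℝ} (hy : y ∈ Set.Icc (0 : ℝ) 1)
    (hseg : ∀ x ∈ Set.Icc (0 : ℝ) 1, P.StrictlyFeasible (θ + x • (y • v))) (i : Fin m) :
    P.V i.succ θ / 2 ≤ P.V i.succ (θ + y • v) := by
  have h1 := (step_length_bounds P.M_pos (hα i) (hβ i) (norm_nonneg v) (hv i)).1
  have h2 := (abs_le.1 (P.taylor i.succ θ (y • v) hseg)).1
  rw [real_inner_smul_right, norm_smul, Real.norm_of_nonneg hy.1] at h2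
  have h3 : -(β i * ‖v‖) ≤ y * inner ℝ (P.g i.succ θ) v := by
    have := (abs_le.1 (hβg i)).1
    have h4 : 0 ≤ β i * ‖v‖ := mul_nonneg (hβ i) (norm_nonneg v)
    nlinarith [hy.1, hy.2]
  have h5 : P.M * (y * ‖v‖) ^ 2 / 2 ≤ P.M * ‖v‖ ^ 2 / 2 := by
    have : (y * ‖v‖) ^ 2 ≤ ‖v‖ ^ 2 := pow_le_pow_left₀ (mul_nonneg hy.1 (norm_nonneg _))
      (mul_le_of_le_one_left (norm_nonneg _) hy.2) 2
    have := mul_le_mul_of_nonneg_left this P.M_pos.le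
    linarith
  linarith [hαV i]

/-- Steps that respect the length bound stay strictly feasible. -/
lemma strictlyFeasible_segment (hα : ∀ i, 0 < α i) (hαV : ∀ i, α i ≤ P.V i.succ θ)
    (hβ : ∀ i, 0 ≤ β i) (hβg : ∀ i, |inner ℝ (P.g i.succ θ) v| ≤ β i * ‖v‖)
    (hv : ∀ i, ‖v‖ ≤ α i / (√(P.M * α i) + 2 * β i)) :
    ∀ x ∈ Set.Icc (0 : ℝ) 1, P.StrictlyFeasible (θ + x • v) := by
  have hline : Continuous fun x : ℝ => θ + x • v := by fun_prop
  by_contra! hcon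
  obtain ⟨x₀, hx₀, hbad⟩ := hcon
  -- First-exit argument: take the smallest x at which some constraint is not positive.
  let bad : Set ℝ := Set.Icc 0 1 ∩ ⋃ i : Fin m, {x | P.V i.succ (θ + x • v) ≤ 0}
  have hcomp : IsCompact bad := isCompact_Icc.inter_right
    (isClosed_iUnion_of_finite fun i =>
      isClosed_le ((P.continuous_V i).comp hline) continuous_const)
  have hne : bad.Nonempty := by
    simp only [StrictlyFeasible, not_forall, not_lt] at hbad
    obtain ⟨i, hi⟩ := hbad
    exact ⟨x₀, hx₀, Set.mem_iUnion.2 ⟨i, hi⟩⟩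
  obtain ⟨x, ⟨hx, hxbad⟩, hmin⟩ := hcomp.exists_isLeast hne
  obtain ⟨i, hi⟩ := Set.mem_iUnion.1 hxbad
  change P.V i.succ (θ + x • v) ≤ 0 at hi
  have hx0 : 0 < x := by
    refine lt_of_le_of_ne hx.1 fun h0 => ?_
    rw [← h0, zero_smul, add_zero] at hi
    linarith [hα i, hαV i]
  have hgood : ∀ y ∈ Set.Ico 0 x, P.StrictlyFeasible (θ + y • v) := fun y hy => by
    by_contra hy2
    simp only [StrictlyFeasible, not_forall, not_lt] at hy2
    obtain ⟨j, hj⟩ := hy2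
    have := hmin (show y ∈ bad from ⟨⟨hy.1, hy.2.le.trans hx.2⟩, Set.mem_iUnion.2 ⟨j, hj⟩⟩)
    linarith [hy.2]
  have hhalf : ∀ y ∈ Set.Ico 0 x, P.V i.succ θ / 2 ≤ P.V i.succ (θ + y • v) := fun y hy => by
    refine half_le_of_segment hα hαV hβ hβg hv ⟨hy.1, hy.2.le.trans hx.2⟩ (fun z hz => ?_) i
    rw [smul_smul]
    exact hgood _ ⟨mul_nonneg hz.1 hy.1, (mul_le_of_le_one_left hy.1 hz.2).trans_lt hy.2⟩
  -- Before x the constraint keeps half of its value; by continuity it does so at x, which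
  -- contradicts the choice of x.
  have hcl : IsClosed {y : ℝ | P.V i.succ θ / 2 ≤ P.V i.succ (θ + y • v)} :=
    isClosed_le continuous_const ((P.continuous_V i).comp hline)
  have hsub := closure_minimal hhalf hcl
  rw [closure_Ico hx0.ne] at hsub
  have := hsub (Set.right_mem_Icc.2 hx0.le)
  change P.V i.succ θ / 2 ≤ P.V i.succ (θ + x • v) at this
  linarith [hα i, hαV i]

/-- The relative change y of the constraint satisfies |y| ≤ 1/2, so log (1 + y) ≥ y - 2y². The
Taylor bound turns y into the first-order term, and y² is bounded through β and M. The coefficients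
5 and 4 are half of the 10 and 8 in the smoothness estimate of the algorithm. -/
lemma log_increment_ge (hα : ∀ i, 0 < α i) (hαV : ∀ i, α i ≤ P.V i.succ θ)
    (hβ : ∀ i, 0 ≤ β i) (hβg : ∀ i, |inner ℝ (P.g i.succ θ) v| ≤ β i * ‖v‖)
    (hv : ∀ i, ‖v‖ ≤ α i / (√(P.M * α i) + 2 * β i)) (i : Fin m) :
    inner ℝ (P.g i.succ θ) v / P.V i.succ θ
        - ‖v‖ ^ 2 * (5 * P.M / α i + 4 * (β i ^ 2 / α i ^ 2)) ≤
      Real.log (P.V i.succ (θ + v)) - Real.log (P.V i.succ θ) := by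
  have hfe := strictlyFeasible_segment hα hαV hβ hβg hv
  have hV : 0 < P.V i.succ θ := (hα i).trans_le (hαV i)
  have hV' : 0 < P.V i.succ (θ + v) := by
    simpa using hfe 1 (Set.right_mem_Icc.2 zero_le_one) i
  obtain ⟨h1, h2⟩ := step_length_bounds P.M_pos (hα i) (hβ i) (norm_nonneg v) (hv i)
  have ht := abs_le.1 (P.taylor i.succ θ v hfe)
  have hin := abs_le.1 (hβg i)
  have hMv : 0 ≤ P.M * ‖v‖ ^ 2 := mul_nonneg P.M_pos.le (sq_nonneg _)
  have hbv : 0 ≤ β i * ‖v‖ := mul_nonneg (hβ i) (norm_nonneg v)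
  have hα2 : 0 < α i ^ 2 := pow_pos (hα i) 2
  have ha := hα i
  have haV := hαV i
  set V := P.V i.succ θ
  set V' := P.V i.succ (θ + v)
  set u := inner ℝ (P.g i.succ θ) v
  set y := (V' - V) / V with hy
  have habs : |V' - V| ≤ β i * ‖v‖ + P.M * ‖v‖ ^ 2 / 2 :=
    abs_le.2 ⟨by linarith [ht.1, hin.1], by linarith [ht.2, hin.2]⟩
  have hy1 : |y| ≤ 1 / 2 := by
    rw [hy, abs_div, abs_of_pos hV, div_le_iff₀ hV]
    linarith
  have hlog : Real.log V' - Real.log V = Real.log (1 + y) := by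
    rw [← Real.log_div hV'.ne' hV.ne', hy]
    congr 1
    field_simp
    ring
  rw [hlog]
  refine le_trans ?_ (sub_two_mul_sq_le_log hy1)
  have hy2 : y ^ 2 ≤ ‖v‖ ^ 2 * (2 * (β i ^ 2 / α i ^ 2) + P.M / α i / 2) := by
    have hya : |y| ≤ (β i * ‖v‖ + P.M * ‖v‖ ^ 2 / 2) / α i := by
      rw [hy, abs_div, abs_of_pos hV]
      exact div_le_div₀ (by positivity) habs ha haV
    have h3 : y ^ 2 ≤ ((β i * ‖v‖ + P.M * ‖v‖ ^ 2 / 2) / α i) ^ 2 := by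
      rw [← sq_abs]; exact pow_le_pow_left₀ (abs_nonneg _) hya 2
    refine h3.trans ?_
    rw [div_pow, div_le_iff₀ hα2]
    have e : ‖v‖ ^ 2 * (2 * (β i ^ 2 / α i ^ 2) + P.M / α i / 2) * α i ^ 2 =
        2 * (β i * ‖v‖) ^ 2 + P.M * ‖v‖ ^ 2 * α i / 2 := by
      field_simp
    rw [e]
    nlinarith [sq_nonneg (β i * ‖v‖ - P.M * ‖v‖ ^ 2 / 2), mul_le_mul_of_nonneg_left h2 hMv]
  have hy3 : u / V - P.M / α i * ‖v‖ ^ 2 / 2 ≤ y := by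
    have : (u - P.M * ‖v‖ ^ 2 / 2) / V ≤ y := by
      rw [hy]; exact div_le_div_of_nonneg_right (by linarith [ht.1]) hV.le
    have h4 : P.M * ‖v‖ ^ 2 / 2 / V ≤ P.M * ‖v‖ ^ 2 / 2 / α i :=
      div_le_div_of_nonneg_left (by positivity) ha haV
    rw [sub_div] at this
    have e : P.M * ‖v‖ ^ 2 / 2 / α i = P.M / α i * ‖v‖ ^ 2 / 2 := by ring
    linarith
  have hpos : 0 ≤ P.M / α i * ‖v‖ ^ 2 := mul_nonneg (div_nonneg P.M_pos.le ha.le) (sq_nonneg _)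
  have e2 : ‖v‖ ^ 2 * (5 * P.M / α i + 4 * (β i ^ 2 / α i ^ 2)) =
      5 * (P.M / α i * ‖v‖ ^ 2) + 4 * (‖v‖ ^ 2 * (β i ^ 2 / α i ^ 2)) := by ring
  have e3 : ‖v‖ ^ 2 * (2 * (β i ^ 2 / α i ^ 2) + P.M / α i / 2) =
      2 * (‖v‖ ^ 2 * (β i ^ 2 / α i ^ 2)) + P.M / α i * ‖v‖ ^ 2 / 2 := by ring
  rw [e2]
  rw [e3] at hy2
  linarith

/-- The conditions under which `s` is an admissible stepsize in the direction `u` at `θ`. -/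
structure AdmissibleStep (P : SmoothProblem E m) (η : ℝ) (θ u : E) (α β : Fin m → ℝ) (s : ℝ) :
    Prop where
  α_pos : ∀ i, 0 < α i
  α_le : ∀ i, α i ≤ P.V i.succ θ
  β_nonneg : ∀ i, 0 ≤ β i
  abs_inner_le : ∀ i, |inner ℝ (P.g i.succ θ) u| ≤ β i * ‖u‖
  s_pos : 0 < s
  mul_smooth_le : s * (P.M + ∑ i, 10 * P.M * η / α i + 8 * η * ∑ i, β i ^ 2 / α i ^ 2) ≤ 1
  mul_norm_le : ∀ i, s * ‖u‖ ≤ α i / (√(P.M * α i) + 2 * β i)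

variable {η s : ℝ} {u : E}

namespace AdmissibleStep

variable (h : AdmissibleStep P η θ u α β s)
include h

lemma norm_smul_eq : ‖s • u‖ = s * ‖u‖ := by
  rw [norm_smul, Real.norm_of_nonneg h.s_pos.le]

lemma abs_inner_smul_le (i : Fin m) : |inner ℝ (P.g i.succ θ) (s • u)| ≤ β i * ‖s • u‖ := by
  rw [real_inner_smul_right, abs_mul, abs_of_pos h.s_pos, h.norm_smul_eq]
  have := mul_le_mul_of_nonneg_left (h.abs_inner_le i) h.s_pos.le
  linarith

lemma strictlyFeasible_segment :
    ∀ x ∈ Set.Icc (0 : ℝ) 1, P.StrictlyFeasible (θ + x • (s • u)) :=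
  SmoothProblem.strictlyFeasible_segment h.α_pos h.α_le h.β_nonneg h.abs_inner_smul_le
    fun i => h.norm_smul_eq.le.trans (h.mul_norm_le i)

lemma half_le (i : Fin m) : P.V i.succ θ / 2 ≤ P.V i.succ (θ + s • u) := by
  have := half_le_of_segment h.α_pos h.α_le h.β_nonneg h.abs_inner_smul_le
    (fun i => h.norm_smul_eq.le.trans (h.mul_norm_le i)) (y := 1)
    (Set.right_mem_Icc.2 zero_le_one) (by simpa using h.strictlyFeasible_segment) i
  simpa using this

lemma pos (i : Fin m) : 0 < P.V i.succ θ := (h.α_pos i).trans_le (h.α_le i)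

/-- The second-order losses are nonnegative, so those of a subset I are covered by the sum over all
constraints. The full set serves the ascent of the barrier, smaller sets serve the product bound. -/
lemma sum_log_increment_ge (hη : 0 ≤ η) (I : Finset (Fin m)) :
    s * inner ℝ (η • ∑ i ∈ I, (P.V i.succ θ)⁻¹ • P.g i.succ θ) u
      - s ^ 2 * ‖u‖ ^ 2 * (∑ i, 10 * P.M * η / α i + 8 * η * ∑ i, β i ^ 2 / α i ^ 2) / 2 ≤
    η * ∑ i ∈ I, (Real.log (P.V i.succ (θ + s • u)) - Real.log (P.V i.succ θ)) := by
  have h1 : ∀ i, s * inner ℝ ((P.V i.succ θ)⁻¹ • P.g i.succ θ) u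
      - s ^ 2 * ‖u‖ ^ 2 * (5 * P.M / α i + 4 * (β i ^ 2 / α i ^ 2)) ≤
      Real.log (P.V i.succ (θ + s • u)) - Real.log (P.V i.succ θ) := fun i => by
    have := log_increment_ge h.α_pos h.α_le h.β_nonneg h.abs_inner_smul_le
      (fun i => h.norm_smul_eq.le.trans (h.mul_norm_le i)) i
    rw [h.norm_smul_eq, real_inner_smul_right, mul_pow] at this
    rw [real_inner_smul_left]
    refine le_trans (le_of_eq ?_) this
    rw [div_eq_inv_mul]
    ring
  have h2 := mul_le_mul_of_nonneg_left (Finset.sum_le_sum fun i (_ : i ∈ I) => h1 i) hη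
  refine le_trans ?_ h2
  rw [Finset.sum_sub_distrib, ← Finset.mul_sum, ← Finset.mul_sum, real_inner_smul_left, sum_inner]
  have h3 : ∑ i ∈ I, (5 * P.M / α i + 4 * (β i ^ 2 / α i ^ 2)) ≤
      ∑ i, (5 * P.M / α i + 4 * (β i ^ 2 / α i ^ 2)) :=
    Finset.sum_le_sum_of_subset_of_nonneg (Finset.subset_univ I) fun i _ _ => by
      have := h.α_pos i
      have := P.M_pos
      positivity
  have h4 : ∑ i, 10 * P.M * η / α i + 8 * η * ∑ i, β i ^ 2 / α i ^ 2 =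
      2 * (η * ∑ i, (5 * P.M / α i + 4 * (β i ^ 2 / α i ^ 2))) := by
    simp only [Finset.mul_sum]
    rw [← Finset.sum_add_distrib]
    exact Finset.sum_congr rfl fun i _ => by ring
  rw [h4]
  have h5 := mul_le_mul_of_nonneg_left h3
    (mul_nonneg hη (mul_nonneg (sq_nonneg s) (sq_nonneg ‖u‖)))
  linarith

lemma second_order_le :
    s ^ 2 * ‖u‖ ^ 2 * (P.M + ∑ i, 10 * P.M * η / α i + 8 * η * ∑ i, β i ^ 2 / α i ^ 2) ≤
      s * ‖u‖ ^ 2 := by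
  have := mul_le_mul_of_nonneg_left h.mul_smooth_le (mul_nonneg h.s_pos.le (sq_nonneg ‖u‖))
  linarith

lemma sum_log_increment_ge' (hη : 0 ≤ η) (I : Finset (Fin m)) :
    s * (inner ℝ (η • ∑ i ∈ I, (P.V i.succ θ)⁻¹ • P.g i.succ θ) u - ‖u‖ ^ 2 / 2) ≤
    η * ∑ i ∈ I, (Real.log (P.V i.succ (θ + s • u)) - Real.log (P.V i.succ θ)) := by
  have h1 := h.sum_log_increment_ge hη I
  have h2 := h.second_order_le
  have h3 : 0 ≤ s ^ 2 * ‖u‖ ^ 2 * P.M := mul_nonneg (by positivity) P.M_pos.le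
  linarith

lemma barrier_increment_ge (hη : 0 ≤ η) :
    s * (inner ℝ (P.barrierGrad η θ) u - ‖u‖ ^ 2 / 2) ≤
      P.barrier η (θ + s • u) - P.barrier η θ := by
  have h1 := h.sum_log_increment_ge hη Finset.univ
  have h2 := h.second_order_le
  have h3 := (abs_le.1 (P.taylor 0 θ (s • u) h.strictlyFeasible_segment)).1
  rw [real_inner_smul_right, h.norm_smul_eq, mul_pow] at h3
  rw [Finset.sum_sub_distrib] at h1
  rw [barrierGrad, barrier, barrier, inner_add_left]
  linarith

end AdmissibleStep

/-! ### The lower bound on the constraint values -/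

variable (P) in
/-- Lower bounds on all products of constraint values. -/
def ProductBound (κ η : ℝ) (θ : E) : Prop :=
  ∀ I : Finset (Fin m), ∏ j ∈ Finset.range I.card, (κ ^ (m - j) * η) ≤ ∏ i ∈ I, P.V i.succ θ

/-- Singletons carry the information that is wanted, but a small constraint can lose value when
another small one has a larger gradient term. Products over all subsets give an invariant that
closes under steps. -/
lemma ProductBound.le_V {κ : ℝ} (h : P.ProductBound κ η θ) (i : Fin m) :
    κ ^ m * η ≤ P.V i.succ θ := by
  simpa using h {i}

lemma productBound_of_le {κ ν : ℝ} (hκ0 : 0 < κ) (hκ : κ ≤ 1) (hη : 0 < η) (hην : η ≤ ν)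
    (h : ∀ i : Fin m, ν ≤ P.V i.succ θ) : P.ProductBound κ η θ := fun I => by
  have h1 : ∏ j ∈ Finset.range I.card, (κ ^ (m - j) * η) ≤ ∏ _i ∈ I, η := by
    rw [Finset.prod_const, ← Finset.card_range I.card]
    refine (Finset.prod_le_prod (fun j _ => by positivity) fun j _ => ?_).trans
      (by rw [Finset.prod_const, Finset.card_range])
    exact mul_le_of_le_one_left hη.le (pow_le_one₀ hκ0.le hκ)
  exact h1.trans (Finset.prod_le_prod (fun _ _ => hη.le) fun i _ => hην.trans (h i))

variable {κ ν ℓ : ℝ}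

/-- A constraint with η ≤ r V_j contributes a vector of norm at most rL to the barrier gradient. -/
lemma norm_add_sum_le_of_large (hP : P.StrictlyFeasible θ) (hη : 0 < η)
    (J : Finset (Fin m)) {r : ℝ} (hr : 0 ≤ r) (hJ : ∀ j ∈ J, η ≤ r * P.V j.succ θ) :
    ‖P.g 0 θ + η • ∑ i ∈ J, (P.V i.succ θ)⁻¹ • P.g i.succ θ‖ ≤ P.L * (1 + m * r) := by
  have h1 : ‖η • ∑ i ∈ J, (P.V i.succ θ)⁻¹ • P.g i.succ θ‖ ≤ ∑ _i ∈ J, r * P.L := by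
    rw [Finset.smul_sum]
    refine norm_sum_le_of_le _ fun i hi => ?_
    rw [smul_smul, norm_smul, Real.norm_of_nonneg (mul_nonneg hη.le (inv_nonneg.2 (hP i).le)),
      ← div_eq_mul_inv]
    refine mul_le_mul ((div_le_iff₀ (hP i)).2 (hJ i hi)) (P.norm_g_le _ θ hP) (norm_nonneg _) hr
  have h2 : ∑ _i ∈ J, r * P.L ≤ m * (r * P.L) := by
    rw [Finset.sum_const, nsmul_eq_mul]
    refine mul_le_mul_of_nonneg_right ?_ (mul_nonneg hr P.L_pos.le)
    exact_mod_cast (Finset.card_le_univ J).trans_eq (Fintype.card_fin m)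
  have h3 := norm_add_le (P.g 0 θ) (η • ∑ i ∈ J, (P.V i.succ θ)⁻¹ • P.g i.succ θ)
  have h4 := P.norm_g_le 0 θ hP
  linarith

/-- If all constraints of `I` are small and the others are large, then a step in an approximate
barrier gradient direction does not decrease the product of the constraints of `I`. -/
lemma prod_le_prod_of_small (h : AdmissibleStep P η θ u α β s) (hη : 0 < η)
    (herr : ‖u - P.barrierGrad η θ‖ ≤ η / 8) (hηL : η / 8 ≤ P.L) {I : Finset (Fin m)}
    (hI : I.Nonempty) {r : ℝ} (hr : 1 ≤ r)
    (hJ : ∀ j ∉ I, η ≤ r * P.V j.succ θ)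
    (hmf : ∃ e : E, ‖e‖ = 1 ∧ ∀ i ∈ I, ℓ < inner ℝ e (P.g i.succ θ)) (hℓ : 0 < ℓ)
    (hsmall : ∀ i ∈ I, 3 * (P.L * ((2 + m) * r)) * P.V i.succ θ ≤ η * ℓ) :
    ∏ i ∈ I, P.V i.succ θ ≤ ∏ i ∈ I, P.V i.succ (θ + s • u) := by
  classical
  set G := η • ∑ i ∈ I, (P.V i.succ θ)⁻¹ • P.g i.succ θ with hG
  set W := P.L * ((2 + m) * r)
  -- G is the part of the barrier gradient that comes from I. The rest consists of the estimation
  -- error, the objective and the large constraints, together at most L + L(1 + mr).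
  have hwb : ‖u - G‖ ≤ W := by
    have e : u - G = (u - P.barrierGrad η θ) +
        (P.g 0 θ + η • ∑ i ∈ Iᶜ, (P.V i.succ θ)⁻¹ • P.g i.succ θ) := by
      rw [barrierGrad, ← Finset.sum_add_sum_compl I, smul_add, hG]
      abel
    have h1 := norm_add_sum_le_of_large h.pos hη Iᶜ (zero_le_one.trans hr)
      fun j hj => hJ j (Finset.mem_compl.1 hj)
    rw [e]
    refine (norm_add_le _ _).trans ((add_le_add (herr.trans hηL) h1).trans ?_)
    have h2 : P.L * 2 ≤ P.L * (2 * r) := mul_le_mul_of_nonneg_left (by linarith) P.L_pos.le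
    simp only [W]
    linarith
  -- In the MFCQ direction all terms of I are positive, so they do not cancel; already one of them
  -- has size ηℓ / V_i ≥ 3W.
  have hGn : 3 * W ≤ ‖G‖ := by
    obtain ⟨e, he, hel⟩ := hmf
    obtain ⟨i₀, hi₀⟩ := hI
    have h1 : inner ℝ e G ≤ ‖G‖ := by simpa [he] using real_inner_le_norm e G
    have h2 : η * (ℓ / P.V i₀.succ θ) ≤ inner ℝ e G := by
      rw [hG, real_inner_smul_right, inner_sum]
      refine mul_le_mul_of_nonneg_left ?_ hη.le
      have hterm : ∀ i ∈ I, ℓ / P.V i.succ θ ≤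
          inner ℝ e ((P.V i.succ θ)⁻¹ • P.g i.succ θ) := fun i hi => by
        rw [real_inner_smul_right, div_eq_inv_mul]
        exact mul_le_mul_of_nonneg_left (hel i hi).le (inv_nonneg.2 (h.pos i).le)
      refine (hterm i₀ hi₀).trans (Finset.single_le_sum (f := fun i =>
        inner ℝ e ((P.V i.succ θ)⁻¹ • P.g i.succ θ)) (fun i hi => ?_) hi₀)
      exact (div_nonneg hℓ.le (h.pos i).le).trans (hterm i hi)
    have h3 : 3 * W ≤ η * (ℓ / P.V i₀.succ θ) := by
      rw [← mul_div_assoc, le_div_iff₀ (h.pos i₀)]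
      exact hsmall i₀ hi₀
    linarith
  have hW0 : 0 ≤ W := (norm_nonneg _).trans hwb
  have hu : 2 * W ≤ ‖u‖ := by
    have := norm_sub_norm_le G u
    rw [norm_sub_rev] at this
    linarith
  -- The deviation of u from G is at most ‖u‖ / 2, so the first-order gain of the logarithms of I
  -- beats the second-order loss.
  have hin : ‖u‖ ^ 2 / 2 ≤ inner ℝ G u := by
    have e : inner ℝ G u = ‖u‖ ^ 2 - inner ℝ (u - G) u := by
      rw [inner_sub_left, real_inner_self_eq_norm_sq]; ring
    have h1 := real_inner_le_norm (u - G) u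
    have h2 : ‖u - G‖ * ‖u‖ ≤ ‖u‖ / 2 * ‖u‖ :=
      mul_le_mul_of_nonneg_right (by linarith) (norm_nonneg _)
    rw [e]
    linarith
  have hlog := h.sum_log_increment_ge' hη.le I
  have h0 : 0 ≤ η * ∑ i ∈ I,
      (Real.log (P.V i.succ (θ + s • u)) - Real.log (P.V i.succ θ)) :=
    (mul_nonneg h.s_pos.le (by linarith)).trans hlog
  have h1 := nonneg_of_mul_nonneg_right h0 hη
  rw [Finset.sum_sub_distrib] at h1
  have hp : ∀ i : Fin m, 0 < P.V i.succ (θ + s • u) := fun i => by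
    linarith [h.half_le i, h.pos i]
  rw [← Real.log_prod fun i _ => (hp i).ne', ← Real.log_prod fun i _ => (h.pos i).ne'] at h1
  exact (Real.log_le_log_iff (Finset.prod_pos fun i _ => h.pos i)
    (Finset.prod_pos fun i _ => hp i)).1 (by linarith)

/-- The product bound is preserved by the steps of the algorithm. -/
lemma ProductBound.step (hP : P.ProductBound κ η θ) (h : AdmissibleStep P η θ u α β s)
    (hη : 0 < η) (herr : ‖u - P.barrierGrad η θ‖ ≤ η / 8) (hηL : η / 8 ≤ P.L) (hℓ : 0 < ℓ)
    (hκ0 : 0 < κ) (hκ1 : κ ≤ 1) (hην : 2 ^ m * η ≤ ν)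
    (hκ : κ * (3 * 2 ^ m * ((2 + m) * 2 ^ m) * P.L) ≤ ℓ)
    (hmf : ∃ e : E, ‖e‖ = 1 ∧ ∀ i : Fin m, P.V i.succ θ ≤ ν → ℓ < inner ℝ e (P.g i.succ θ)) :
    P.ProductBound κ η (θ + s • u) := by
  classical
  intro I
  rcases I.eq_empty_or_nonempty with rfl | hI
  · simp
  set Q := ∏ j ∈ Finset.range I.card, (κ ^ (m - j) * η) with hQ
  have hkm : I.card ≤ m := (Finset.card_le_univ I).trans_eq (Fintype.card_fin m)
  have hk1 : 1 ≤ I.card := Finset.card_pos.2 hI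
  have h2k : (2 : ℝ) ^ I.card ≤ 2 ^ m := pow_le_pow_right₀ one_le_two hkm
  have hQ0 : 0 < Q := Finset.prod_pos fun j _ => by positivity
  -- Far above the bound, the loss of a factor 2 per constraint is affordable.
  rcases le_or_gt (2 ^ I.card * Q) (∏ i ∈ I, P.V i.succ θ) with hcase | hcase
  · have h1 : ∏ i ∈ I, (P.V i.succ θ / 2) ≤ ∏ i ∈ I, P.V i.succ (θ + s • u) :=
      Finset.prod_le_prod (fun i _ => (half_pos (h.pos i)).le) fun i _ => h.half_le i
    rw [Finset.prod_div_distrib, Finset.prod_const] at h1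
    refine le_trans ?_ h1
    rw [le_div_iff₀ (by positivity)]
    linarith
  refine (hP I).trans ?_
  -- Divide the bound for I ∪ {j} by the upper bound on the product over I.
  have hlarge : ∀ j ∉ I, κ ^ (m - I.card) * η ≤ 2 ^ m * P.V j.succ θ := fun j hj => by
    have h1 := hP (insert j I)
    rw [Finset.card_insert_of_notMem hj, Finset.prod_range_succ, Finset.prod_insert hj] at h1
    have h2 : Q * (κ ^ (m - I.card) * η) ≤ Q * (2 ^ I.card * P.V j.succ θ) := by
      refine h1.trans ?_
      have := mul_le_mul_of_nonneg_left hcase.le (h.pos j).le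
      linarith
    exact (le_of_mul_le_mul_left h2 hQ0).trans
      (mul_le_mul_of_nonneg_right h2k (h.pos j).le)
  -- Divide the upper bound on the product over I by the bound for I \ {i}. Consecutive levels
  -- differ by the factor κ, so small and large constraints are separated by κ up to powers of 2.
  have hsm : ∀ i ∈ I, P.V i.succ θ ≤ 2 ^ m * (κ ^ (m - I.card) * κ * η) := fun i hi => by
    have h1 := hP (I.erase i)
    rw [Finset.card_erase_of_mem hi] at h1
    set R := ∏ j ∈ Finset.range (I.card - 1), (κ ^ (m - j) * η) with hR
    have hR0 : 0 < R := Finset.prod_pos fun j _ => by positivity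
    have hQR : Q = R * (κ ^ (m - I.card) * κ * η) := by
      rw [hQ, hR, ← pow_succ]
      obtain ⟨k, hk⟩ := Nat.exists_eq_add_of_le' hk1
      rw [hk, Finset.prod_range_succ, Nat.add_sub_cancel]
      congr 3
      omega
    have h2 : R * P.V i.succ θ ≤ R * (2 ^ I.card * (κ ^ (m - I.card) * κ * η)) := by
      calc R * P.V i.succ θ ≤ (∏ j ∈ I.erase i, P.V j.succ θ) * P.V i.succ θ :=
            mul_le_mul_of_nonneg_right h1 (h.pos i).le
        _ = ∏ j ∈ I, P.V j.succ θ := Finset.prod_erase_mul _ _ hi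
        _ ≤ 2 ^ I.card * Q := hcase.le
        _ = _ := by rw [hQR]; ring
    exact (le_of_mul_le_mul_left h2 hR0).trans
      (mul_le_mul_of_nonneg_right h2k (by positivity))
  have hc0 : 0 < κ ^ (m - I.card) := by positivity
  have hc1 : κ ^ (m - I.card) ≤ 1 := pow_le_one₀ hκ0.le hκ1
  -- In the smallness condition the powers of κ cancel except for one factor, and that one is
  -- controlled by κ ≲ ℓ / L.
  refine prod_le_prod_of_small (r := 2 ^ m / κ ^ (m - I.card)) h hη herr hηL hI ?_ ?_ ?_ hℓ ?_
  · rw [le_div_iff₀ hc0, one_mul]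
    exact hc1.trans (one_le_pow₀ one_le_two)
  · intro j hj
    rw [div_mul_eq_mul_div, le_div_iff₀ hc0, mul_comm η]
    exact hlarge j hj
  · obtain ⟨e, he, hel⟩ := hmf
    refine ⟨e, he, fun i hi => hel i ((hsm i hi).trans (le_trans ?_ hην))⟩
    refine mul_le_mul_of_nonneg_left ?_ (by positivity)
    exact mul_le_of_le_one_left hη.le (mul_le_one₀ hc1 hκ0.le hκ1)
  · intro i hi
    have hLp := P.L_pos
    calc 3 * (P.L * ((2 + m) * (2 ^ m / κ ^ (m - I.card)))) * P.V i.succ θ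
        ≤ 3 * (P.L * ((2 + m) * (2 ^ m / κ ^ (m - I.card)))) *
            (2 ^ m * (κ ^ (m - I.card) * κ * η)) :=
          mul_le_mul_of_nonneg_left (hsm i hi) (by positivity)
      _ = η * (κ * (3 * 2 ^ m * ((2 + m) * 2 ^ m) * P.L)) := by
          field_simp
      _ ≤ η * ℓ := mul_le_mul_of_nonneg_left hκ hη.le

end SmoothProblem

/-- A lower bound, relative to the barrier parameter, on the stepsizes in terms of the constants of
a smooth problem. -/
noncomputable def stepLower (m : ℕ) (M L B c : ℝ) : ℝ :=
  min (1 / (M + 20 * m * M / c + 32 * m * (L + 2) ^ 2 / c ^ 2))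
    (c / 2 / (√(M * B) + 2 * (L + 2)) * (1 / (L + m * L / c + 1)))

lemma stepLower_pos (m : ℕ) {M L B c : ℝ} (hM : 0 < M) (hL : 0 < L) (hB : 0 < B) (hc : 0 < c) :
    0 < stepLower m M L B c :=
  lt_min (by positivity) (by positivity)

namespace SmoothProblem

variable {E : Type*} [NormedAddCommGroup E] [InnerProductSpace ℝ E] {m : ℕ}

/-! ### Steps computed from estimates -/

/-- `Vh` and `gh` estimate the values and the gradients at `θ` up to `e₀` and `e₁`. -/
structure Estimates (P : SmoothProblem E m) (e₀ e₁ : ℝ) (θ : E) (Vh : Fin (m + 1) → ℝ)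
    (gh : Fin (m + 1) → E) : Prop where
  abs_sub_le : ∀ i, |Vh i - P.V i θ| ≤ e₀
  norm_sub_le : ∀ i, ‖gh i - P.g i θ‖ ≤ e₁

/-- The errors `e₀`, `e₁` are small enough for constraint values of size at least `c * η`. -/
structure SmallErrors (P : SmoothProblem E m) (c η e₀ e₁ : ℝ) : Prop where
  c_pos : 0 < c
  η_pos : 0 < η
  η_le_one : η ≤ 1
  η_div_le : η / 8 ≤ P.L
  value_le : e₀ ≤ c * η / 4
  value_le' : e₀ * (2 * m * P.L / c ^ 2) ≤ η ^ 2 / 16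
  grad_le : e₁ * (1 + 2 * m / c) ≤ η / 16

/-- The estimated gradient of the log barrier function. -/
noncomputable def barrierGradEst (η : ℝ) (Vh : Fin (m + 1) → ℝ) (gh : Fin (m + 1) → E) : E :=
  gh 0 + η • ∑ i : Fin m, (Vh i.succ)⁻¹ • gh i.succ

/-- A lower bound, relative to `η`, on the stepsizes. -/
noncomputable def stepConst (P : SmoothProblem E m) (c : ℝ) : ℝ :=
  stepLower m P.M P.L P.B c

lemma stepConst_pos (P : SmoothProblem E m) {c : ℝ} (hc : 0 < c) : 0 < P.stepConst c :=
  stepLower_pos m P.M_pos P.L_pos P.B_pos hc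

variable {P : SmoothProblem E m} {c η e₀ e₁ : ℝ} {θ : E} {Vh : Fin (m + 1) → ℝ}
  {gh : Fin (m + 1) → E}

lemma SmallErrors.grad_le_one (he : P.SmallErrors c η e₀ e₁) : e₁ ≤ 1 := by
  have h1 := he.grad_le
  have h2 : 0 ≤ 2 * (m : ℝ) / c := div_nonneg (by positivity) he.c_pos.le
  by_contra! hcon
  nlinarith [he.η_le_one, he.η_pos]

/-- The error of each quotient splits into a gradient error over V̂ ≥ cη / 2 and an error of the
inverse, of order e₀ / (cη)². The latter is why the values must be estimated to order η². -/
lemma norm_barrierGradEst_sub_le (he : P.SmallErrors c η e₀ e₁) (h : P.Estimates e₀ e₁ θ Vh gh)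
    (hV : ∀ i : Fin m, c * η ≤ P.V i.succ θ) :
    ‖barrierGradEst η Vh gh - P.barrierGrad η θ‖ ≤ η / 8 := by
  have hc := he.c_pos
  have hη := he.η_pos
  have hw : 0 < c * η := mul_pos hc hη
  have hfe : P.StrictlyFeasible θ := fun i => hw.trans_le (hV i)
  have he0 : 0 ≤ e₀ := (abs_nonneg _).trans (h.abs_sub_le 0)
  have he1 : 0 ≤ e₁ := (norm_nonneg _).trans (h.norm_sub_le 0)
  have hterm : ∀ i : Fin m, ‖(Vh i.succ)⁻¹ • gh i.succ - (P.V i.succ θ)⁻¹ • P.g i.succ θ‖ ≤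
      2 * e₁ / (c * η) + 2 * P.L * e₀ / (c * η) ^ 2 := fun i => by
    have hd := abs_le.1 (h.abs_sub_le i.succ)
    have hVh : c * η / 2 ≤ Vh i.succ := by linarith [hV i, he.value_le, hd.1]
    have hVh0 : 0 < Vh i.succ := (half_pos hw).trans_le hVh
    have e : (Vh i.succ)⁻¹ • gh i.succ - (P.V i.succ θ)⁻¹ • P.g i.succ θ =
        (Vh i.succ)⁻¹ • (gh i.succ - P.g i.succ θ) +
          ((Vh i.succ)⁻¹ - (P.V i.succ θ)⁻¹) • P.g i.succ θ := by
      rw [smul_sub, sub_smul]; abel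
    rw [e]
    refine (norm_add_le _ _).trans (add_le_add ?_ ?_)
    · rw [norm_smul, Real.norm_of_nonneg (inv_nonneg.2 hVh0.le), ← div_eq_inv_mul]
      calc _ ≤ e₁ / (c * η / 2) := div_le_div₀ he1 (h.norm_sub_le _) (half_pos hw) hVh
        _ = _ := by field_simp
    · rw [norm_smul, inv_sub_inv hVh0.ne' (hfe i).ne', Real.norm_eq_abs, abs_div,
        abs_of_pos (mul_pos hVh0 (hfe i)), abs_sub_comm]
      calc _ ≤ e₀ / (c * η / 2 * (c * η)) * P.L := by
            refine mul_le_mul ?_ (P.norm_g_le _ θ hfe) (norm_nonneg _) (by positivity)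
            exact div_le_div₀ he0 (h.abs_sub_le _) (by positivity)
              (mul_le_mul hVh (hV i) hw.le hVh0.le)
        _ = _ := by field_simp
  have e : barrierGradEst η Vh gh - P.barrierGrad η θ = (gh 0 - P.g 0 θ) +
      η • ∑ i : Fin m, ((Vh i.succ)⁻¹ • gh i.succ - (P.V i.succ θ)⁻¹ • P.g i.succ θ) := by
    rw [barrierGradEst, barrierGrad, Finset.sum_sub_distrib, smul_sub]; abel
  have h1 : ‖η • ∑ i : Fin m, ((Vh i.succ)⁻¹ • gh i.succ - (P.V i.succ θ)⁻¹ • P.g i.succ θ)‖ ≤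
      η * (m * (2 * e₁ / (c * η) + 2 * P.L * e₀ / (c * η) ^ 2)) := by
    rw [norm_smul, Real.norm_of_nonneg hη.le]
    refine mul_le_mul_of_nonneg_left ?_ hη.le
    refine (norm_sum_le_of_le _ fun i _ => hterm i).trans_eq ?_
    rw [Finset.sum_const, Finset.card_univ, Fintype.card_fin, nsmul_eq_mul]
  rw [e]
  refine (norm_add_le _ _).trans ((add_le_add (h.norm_sub_le 0) h1).trans ?_)
  have e2 : e₁ + η * (m * (2 * e₁ / (c * η) + 2 * P.L * e₀ / (c * η) ^ 2)) =
      e₁ * (1 + 2 * m / c) + e₀ * (2 * m * P.L / c ^ 2) / η := by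
    field_simp
    ring
  have h2 : e₀ * (2 * m * P.L / c ^ 2) / η ≤ η / 16 := by
    rw [div_le_iff₀ hη]
    linarith [he.value_le']
  rw [e2]
  linarith [he.grad_le]

lemma norm_barrierGrad_le (hc : 0 < c) (hη : 0 < η) (hV : ∀ i : Fin m, c * η ≤ P.V i.succ θ) :
    ‖P.barrierGrad η θ‖ ≤ P.L + m * P.L / c := by
  have hw : 0 < c * η := mul_pos hc hη
  have hfe : P.StrictlyFeasible θ := fun i => hw.trans_le (hV i)
  refine (norm_add_sum_le_of_large hfe hη Finset.univ (inv_nonneg.2 hc.le) fun j _ => ?_).trans_eq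
    (by ring)
  rw [inv_mul_eq_div, le_div_iff₀ hc]
  linarith [hV j]

/-- The stepsize computed from estimates is admissible and not too small. -/
lemma Estimates.admissibleStep [Nonempty (Fin m)] (he : P.SmallErrors c η e₀ e₁)
    (h : P.Estimates e₀ e₁ θ Vh gh) (hV : ∀ i : Fin m, c * η ≤ P.V i.succ θ) {u : E}
    (hu : u = barrierGradEst η Vh gh) (hu0 : 0 < ‖u‖) {α β : Fin m → ℝ} {s : ℝ}
    (hα : ∀ i, α i = Vh i.succ - e₀)
    (hβ : ∀ i, β i = |inner ℝ (gh i.succ) (‖u‖⁻¹ • u)| + e₁)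
    (hs : s = min (1 / (P.M + ∑ i, 10 * P.M * η / α i + 8 * η * ∑ i, β i ^ 2 / α i ^ 2))
      ((⨅ i, α i / (√(P.M * α i) + 2 * |β i|)) * (1 / ‖u‖))) :
    AdmissibleStep P η θ u α β s ∧ P.stepConst c * η ≤ s := by
  have hc := he.c_pos
  have hη := he.η_pos
  have hM := P.M_pos
  have hL := P.L_pos
  have hB := P.B_pos
  have hw : 0 < c * η := mul_pos hc hη
  have hfe : P.StrictlyFeasible θ := fun i => hw.trans_le (hV i)
  have he1 : 0 ≤ e₁ := (norm_nonneg _).trans (h.norm_sub_le 0)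
  have hαlow : ∀ i, c * η / 2 ≤ α i := fun i => by
    have := (abs_le.1 (h.abs_sub_le i.succ)).1
    rw [hα]; linarith [hV i, he.value_le]
  have hα0 : ∀ i, 0 < α i := fun i => (half_pos hw).trans_le (hαlow i)
  have hαV : ∀ i, α i ≤ P.V i.succ θ := fun i => by
    have := (abs_le.1 (h.abs_sub_le i.succ)).2
    rw [hα]; linarith
  have hβ0 : ∀ i, 0 ≤ β i := fun i => by rw [hβ]; positivity
  have hunit : ‖‖u‖⁻¹ • u‖ = 1 := by
    rw [norm_smul, norm_inv, norm_norm, inv_mul_cancel₀ hu0.ne']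
  -- The error e₁ enters twice, once in the estimate of the gradient and once as confidence margin,
  -- and e₁ ≤ 1.
  have hβL : ∀ i, β i ≤ P.L + 2 := fun i => by
    rw [hβ]
    have h1 := abs_real_inner_le_norm (gh i.succ) (‖u‖⁻¹ • u)
    rw [hunit, mul_one] at h1
    have h2 := norm_sub_norm_le (gh i.succ) (P.g i.succ θ)
    linarith [h.norm_sub_le i.succ, P.norm_g_le i.succ θ hfe, he.grad_le_one]
  have hin : ∀ i, |inner ℝ (P.g i.succ θ) u| ≤ β i * ‖u‖ := fun i => by
    have e : u = ‖u‖ • (‖u‖⁻¹ • u) := by rw [smul_smul, mul_inv_cancel₀ hu0.ne', one_smul]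
    have h1 : |inner ℝ (P.g i.succ θ) (‖u‖⁻¹ • u)| ≤ β i := by
      have h2 := abs_real_inner_le_norm (gh i.succ - P.g i.succ θ) (‖u‖⁻¹ • u)
      rw [hunit, mul_one, inner_sub_left, abs_sub_comm] at h2
      have h3 := abs_sub_abs_le_abs_sub (inner ℝ (P.g i.succ θ) (‖u‖⁻¹ • u))
        (inner ℝ (gh i.succ) (‖u‖⁻¹ • u))
      rw [hβ]
      linarith [h.norm_sub_le i.succ]
    calc |inner ℝ (P.g i.succ θ) u| = ‖u‖ * |inner ℝ (P.g i.succ θ) (‖u‖⁻¹ • u)| := by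
          conv_lhs => rw [e]
          rw [real_inner_smul_right, abs_mul, abs_of_pos hu0]
      _ ≤ _ := by rw [mul_comm]; exact mul_le_mul_of_nonneg_right h1 hu0.le
  have hden : ∀ i, 0 < √(P.M * α i) + 2 * |β i| := fun i => by
    have : 0 < √(P.M * α i) := Real.sqrt_pos.2 (mul_pos hM (hα0 i))
    positivity
  have hMhat : 0 < P.M + ∑ i, 10 * P.M * η / α i + 8 * η * ∑ i, β i ^ 2 / α i ^ 2 := by
    have h1 : 0 ≤ ∑ i, 10 * P.M * η / α i := Finset.sum_nonneg fun i _ => by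
      have := hα0 i; positivity
    have h2 : 0 ≤ ∑ i, β i ^ 2 / α i ^ 2 := Finset.sum_nonneg fun i _ => by positivity
    positivity
  have hconst : P.stepConst c * η ≤ s := by
    rw [hs]
    refine le_min ?_ ?_
    · refine (mul_le_mul_of_nonneg_right (min_le_left _ _) hη.le).trans ?_
      rw [one_div_mul_eq_div, div_le_div_iff₀ (by positivity) hMhat, one_mul]
      have h1 : ∑ i, 10 * P.M * η / α i ≤ 20 * m * P.M / c := by
        refine (Finset.sum_le_card_nsmul _ _ (20 * P.M / c) fun i _ => ?_).trans_eq ?_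
        · calc _ ≤ 10 * P.M * η / (c * η / 2) :=
                div_le_div_of_nonneg_left (by positivity) (by positivity) (hαlow i)
            _ = _ := by field_simp; ring
        · rw [Finset.card_univ, Fintype.card_fin, nsmul_eq_mul]; ring
      have h2 : ∑ i, β i ^ 2 / α i ^ 2 ≤ m * ((P.L + 2) ^ 2 / (c * η / 2) ^ 2) := by
        refine (Finset.sum_le_card_nsmul _ _ ((P.L + 2) ^ 2 / (c * η / 2) ^ 2)
          fun i _ => ?_).trans_eq ?_
        · exact div_le_div₀ (by positivity) (pow_le_pow_left₀ (hβ0 i) (hβL i) 2) (by positivity)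
            (pow_le_pow_left₀ (by positivity) (hαlow i) 2)
        · rw [Finset.card_univ, Fintype.card_fin, nsmul_eq_mul]
      -- This term of the smoothness estimate is of order 1 / η because α is only known to be at
      -- least cη / 2. Hence the lower bound on the stepsize is proportional to η.
      have h3 : η * (8 * η * ∑ i, β i ^ 2 / α i ^ 2) ≤ 32 * m * (P.L + 2) ^ 2 / c ^ 2 := by
        calc _ ≤ η * (8 * η * (m * ((P.L + 2) ^ 2 / (c * η / 2) ^ 2))) := by gcongr
          _ = _ := by field_simp; ring
      have h4 : η * (P.M + ∑ i, 10 * P.M * η / α i) ≤ P.M + ∑ i, 10 * P.M * η / α i := by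
        refine mul_le_of_le_one_left (add_nonneg hM.le (Finset.sum_nonneg fun i _ => ?_))
          he.η_le_one
        have := hα0 i; positivity
      linarith
    · refine (mul_le_mul_of_nonneg_right (min_le_right _ _) hη.le).trans ?_
      have hun : ‖u‖ ≤ P.L + m * P.L / c + 1 := by
        have h1 := norm_barrierGradEst_sub_le he h hV
        rw [← hu] at h1
        have h2 := norm_sub_norm_le u (P.barrierGrad η θ)
        linarith [norm_barrierGrad_le hc hη hV, he.η_le_one]
      have hinf : c / 2 / (√(P.M * P.B) + 2 * (P.L + 2)) * η ≤
          ⨅ i, α i / (√(P.M * α i) + 2 * |β i|) := by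
        refine le_ciInf fun i => ?_
        have e : c / 2 / (√(P.M * P.B) + 2 * (P.L + 2)) * η =
            c * η / 2 / (√(P.M * P.B) + 2 * (P.L + 2)) := by ring
        rw [e]
        refine div_le_div₀ (hα0 i).le (hαlow i) (hden i) ?_
        rw [abs_of_nonneg (hβ0 i)]
        refine add_le_add (Real.sqrt_le_sqrt ?_) (by linarith [hβL i])
        exact mul_le_mul_of_nonneg_left ((hαV i).trans (P.V_le _ _)) hM.le
      have hinv : 1 / (P.L + m * P.L / c + 1) ≤ 1 / ‖u‖ := one_div_le_one_div_of_le hu0 hun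
      calc _ = c / 2 / (√(P.M * P.B) + 2 * (P.L + 2)) * η * (1 / (P.L + m * P.L / c + 1)) := by
            ring
        _ ≤ _ := mul_le_mul hinf hinv (by positivity) (le_trans (by positivity) hinf)
  have hs0 : 0 < s := (mul_pos (P.stepConst_pos hc) hη).trans_le hconst
  refine ⟨⟨hα0, hαV, hβ0, hin, hs0, ?_, fun i => ?_⟩, hconst⟩
  · rw [← le_div_iff₀ hMhat, hs]
    exact min_le_left _ _
  · have h1 : s ≤ (⨅ i, α i / (√(P.M * α i) + 2 * |β i|)) * (1 / ‖u‖) := by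
      rw [hs]; exact min_le_right _ _
    rw [mul_one_div, le_div_iff₀ hu0] at h1
    have h2 := ciInf_le (Set.finite_range fun i => α i / (√(P.M * α i) + 2 * |β i|)).bddBelow i
    rw [abs_of_nonneg (hβ0 i)] at h2
    exact h1.trans h2

/-- The increase of the barrier function along an admissible step. -/
lemma AdmissibleStep.barrier_ascent {u : E} {α β : Fin m → ℝ} {s r : ℝ}
    (h : AdmissibleStep P η θ u α β s) (hη : 0 ≤ η)
    (herr : ‖u - P.barrierGrad η θ‖ ≤ η / 8) (hu : η / 2 < ‖u‖) (hr : 0 ≤ r) (hrs : r ≤ s) :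
    r * (4 / 25 * ‖P.barrierGrad η θ‖ ^ 2) ≤ P.barrier η (θ + s • u) - P.barrier η θ := by
  refine le_trans ?_ (h.barrier_increment_ge hη)
  -- An iteration that does not stop has ‖u‖ > η / 2, so the error η / 8 is at most ‖u‖ / 4.
  have h1 : ‖u‖ ^ 2 / 4 ≤ inner ℝ (P.barrierGrad η θ) u - ‖u‖ ^ 2 / 2 := by
    have e : inner ℝ (P.barrierGrad η θ) u =
        ‖u‖ ^ 2 - inner ℝ (u - P.barrierGrad η θ) u := by
      rw [inner_sub_left, real_inner_self_eq_norm_sq]; ring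
    have h2 := real_inner_le_norm (u - P.barrierGrad η θ) u
    have h3 : ‖u - P.barrierGrad η θ‖ * ‖u‖ ≤ ‖u‖ / 4 * ‖u‖ :=
      mul_le_mul_of_nonneg_right (by linarith) (norm_nonneg _)
    rw [e]; linarith
  have h2 : ‖P.barrierGrad η θ‖ ≤ 5 / 4 * ‖u‖ := by
    have := norm_sub_norm_le (P.barrierGrad η θ) u
    rw [norm_sub_rev] at this
    linarith
  have h3 : 4 / 25 * ‖P.barrierGrad η θ‖ ^ 2 ≤ ‖u‖ ^ 2 / 4 := by
    have := pow_le_pow_left₀ (norm_nonneg _) h2 2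
    linarith
  exact mul_le_mul hrs (h3.trans h1) (by positivity) (hr.trans hrs)

/-! ### Convergence of the iteration -/

/-- The discrete analogue of x' = -a x², whose solutions satisfy x ≤ 1 / (at). The key inequality is
(1 - ax)(1 + ax) ≤ 1 when ax ≤ 1; otherwise y ≤ 0. -/
lemma mul_succ_le_one_of_le_sub_sq {a x y t : ℝ} (ha : 0 ≤ a) (hx : 0 ≤ x) (ht : 0 ≤ t)
    (h : x * (a * t) ≤ 1) (hy : y ≤ x - a * x ^ 2) : y * (a * (t + 1)) ≤ 1 := by
  have h1 : y * (a * (t + 1)) ≤ (x - a * x ^ 2) * (a * (t + 1)) :=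
    mul_le_mul_of_nonneg_right hy (by positivity)
  refine h1.trans ?_
  have e : (x - a * x ^ 2) * (a * (t + 1)) = (1 - a * x) * (x * (a * t) + a * x) := by ring
  rw [e]
  have hax : 0 ≤ a * x := mul_nonneg ha hx
  have hxt : 0 ≤ x * (a * t) := by positivity
  rcases le_total (a * x) 1 with h2 | h2 <;> nlinarith

/-- The state `x'` follows the state `x` in a run of the algorithm with accurate estimates. -/
structure IsStep (P : SmoothProblem E m) (η e₀ e₁ : ℝ) (x x' : E × Bool) : Prop where
  stopped : x.2 = true → x' = x
  active : x.2 = false → P.StrictlyFeasible x.1 →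
    ∃ (Vh : Fin (m + 1) → ℝ) (gh : Fin (m + 1) → E), P.Estimates e₀ e₁ x.1 Vh gh ∧
      (‖barrierGradEst η Vh gh‖ ≤ η / 2 → x' = (x.1, true)) ∧
      (η / 2 < ‖barrierGradEst η Vh gh‖ → ∃ (α β : Fin m → ℝ) (s : ℝ),
        (∀ i, α i = Vh i.succ - e₀) ∧
        (∀ i, β i = |inner ℝ (gh i.succ)
          (‖barrierGradEst η Vh gh‖⁻¹ • barrierGradEst η Vh gh)| + e₁) ∧
        s = min (1 / (P.M + ∑ i, 10 * P.M * η / α i + 8 * η * ∑ i, β i ^ 2 / α i ^ 2))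
          ((⨅ i, α i / (√(P.M * α i) + 2 * |β i|)) * (1 / ‖barrierGradEst η Vh gh‖)) ∧
        x' = (x.1 + s • barrierGradEst η Vh gh, false))

variable (P) in
/-- The invariant of the iteration, with target value `v`. -/
structure Invariant (κ η v R a Z : ℝ) (t : ℕ) (x : E × Bool) : Prop where
  feasible : P.StrictlyFeasible x.1
  product : P.ProductBound κ η x.1
  stopped : x.2 = true → v - P.V 0 x.1 ≤ R
  active : x.2 = false → v - P.barrier η x.1 ≤ Z ∨ (v - P.barrier η x.1) * (a * t) ≤ 1

/-- The hypotheses on the problem and on the constants under which the iteration converges. -/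
structure Convergent (P : SmoothProblem E m) (κ ν ℓ η e₀ e₁ v D : ℝ) : Prop where
  small : P.SmallErrors (κ ^ m) η e₀ e₁
  κ_pos : 0 < κ
  κ_le_one : κ ≤ 1
  ℓ_pos : 0 < ℓ
  D_pos : 0 < D
  κ_mul_le : κ * (3 * 2 ^ m * ((2 + m) * 2 ^ m) * P.L) ≤ ℓ
  η_le : 2 ^ m * η ≤ ν
  log_ge : 1 + Real.log (1 / κ ^ m) ≤ Real.log (1 / η)
  log_B_le : Real.log P.B ≤ Real.log (1 / η)
  mfcq : ∀ θ, P.StrictlyFeasible θ →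
    ∃ e : E, ‖e‖ = 1 ∧ ∀ i : Fin m, P.V i.succ θ ≤ ν → ℓ < inner ℝ e (P.g i.succ θ)
  domination : ∀ θ, (∀ i : Fin m, κ ^ m * η ≤ P.V i.succ θ) →
    v - P.V 0 θ ≤ m * η + D * ‖P.barrierGrad η θ‖

variable {κ ν ℓ v D : ℝ}

/-- Passing from the objective to the barrier costs mη log (1 / (κ^m η)). Together with the mη of
gradient domination this is at most 2mη log (1 / η), as η is small compared with κ^m. -/
lemma Convergent.gap_le (h : P.Convergent κ ν ℓ η e₀ e₁ v D)
    (hV : ∀ i : Fin m, κ ^ m * η ≤ P.V i.succ θ) :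
    v - P.barrier η θ ≤ 2 * m * η * Real.log (1 / η) + D * ‖P.barrierGrad η θ‖ := by
  have hη := h.small.η_pos
  have hc := h.small.c_pos
  have h1 := h.domination θ hV
  have h2 : ∑ _i : Fin m, Real.log (κ ^ m * η) ≤ ∑ i : Fin m, Real.log (P.V i.succ θ) :=
    Finset.sum_le_sum fun i _ => Real.log_le_log (mul_pos hc hη) (hV i)
  rw [Finset.sum_const, Finset.card_univ, Fintype.card_fin, nsmul_eq_mul,
    Real.log_mul hc.ne' hη.ne'] at h2
  have h3 := h.log_ge
  rw [one_div, one_div, Real.log_inv, Real.log_inv] at h3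
  rw [one_div, Real.log_inv, barrier]
  have h4 := mul_le_mul_of_nonneg_left h2 hη.le
  have h5 := mul_le_mul_of_nonneg_left h3 (mul_nonneg (Nat.cast_nonneg m) hη.le : 0 ≤ (m:ℝ) * η)
  linarith

/-- A stopping step certifies ‖∇B‖ ≤ η / 2 + η / 8 ≤ η, which bounds the gap by gradient domination.
A moving step increases the barrier, so a gap that has reached the level Z stays below it. -/
lemma Invariant.step [Nonempty (Fin m)] (h : P.Convergent κ ν ℓ η e₀ e₁ v D) {t : ℕ}
    {x x' : E × Bool}
    (hx : P.Invariant κ η v (m * η + D * η) (P.stepConst (κ ^ m) * η / (25 * D ^ 2))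
      (4 * m * η * Real.log (1 / η)) t x) (hstep : P.IsStep η e₀ e₁ x x') :
    P.Invariant κ η v (m * η + D * η) (P.stepConst (κ ^ m) * η / (25 * D ^ 2))
      (4 * m * η * Real.log (1 / η)) (t + 1) x' := by
  have hη := h.small.η_pos
  have hD := h.D_pos
  rcases hb : x.2 with _ | _
  · obtain ⟨Vh, gh, hest, hhalt, hgo⟩ := hstep.active hb hx.feasible
    have hV := hx.product.le_V
    have herr := norm_barrierGradEst_sub_le h.small hest hV
    rcases le_or_gt ‖barrierGradEst η Vh gh‖ (η / 2) with hle | hgt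
    · rw [hhalt hle]
      refine ⟨hx.feasible, hx.product, fun _ => ?_, fun hc => by simp at hc⟩
      refine (h.domination _ hV).trans ?_
      have h1 := norm_sub_norm_le (P.barrierGrad η x.1) (barrierGradEst η Vh gh)
      rw [norm_sub_rev] at h1
      have h2 : ‖P.barrierGrad η x.1‖ ≤ η := by linarith
      have := mul_le_mul_of_nonneg_left h2 hD.le
      linarith
    · obtain ⟨α, β, s, hα, hβ, hs, hx'⟩ := hgo hgt
      obtain ⟨hadm, hsc⟩ := hest.admissibleStep h.small hV rfl
        ((half_pos hη).trans hgt) hα hβ hs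
      rw [hx']
      refine ⟨fun i => ?_, hx.product.step hadm hη herr h.small.η_div_le h.ℓ_pos h.κ_pos
        h.κ_le_one h.η_le h.κ_mul_le (h.mfcq _ hx.feasible), fun hc => by simp at hc, fun _ => ?_⟩
      · linarith [hadm.half_le i, hadm.pos i]
      have hr : 0 ≤ P.stepConst (κ ^ m) * η :=
        mul_nonneg (P.stepConst_pos h.small.c_pos).le hη.le
      have hasc := hadm.barrier_ascent hη.le herr hgt hr hsc
      have hmono : 0 ≤ P.stepConst (κ ^ m) * η * (4 / 25 * ‖P.barrierGrad η x.1‖ ^ 2) := by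
        positivity
      have hcases := hx.active hb
      have hgap := h.gap_le hV
      set X := v - P.barrier η x.1 with hX
      set Y := v - P.barrier η (x.1 + s • barrierGradEst η Vh gh) with hY
      change Y ≤ _ ∨ Y * _ ≤ 1
      -- Above Z the logarithmic term of `gap_le` is at most X / 2, so X ≤ 2D‖∇B‖ and the ascent is
      -- quadratic in X.
      rcases le_or_gt X (4 * m * η * Real.log (1 / η)) with hsm | hlg
      · left; linarith
      right
      have hlog0 : 0 ≤ Real.log (1 / η) :=
        Real.log_nonneg (by rw [le_div_iff₀ hη, one_mul]; exact h.small.η_le_one)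
      have hX0 : 0 ≤ X := le_trans (by positivity) hlg.le
      have hgrad : X ≤ 2 * D * ‖P.barrierGrad η x.1‖ := by linarith
      have hsq : X ^ 2 ≤ (2 * D * ‖P.barrierGrad η x.1‖) ^ 2 := pow_le_pow_left₀ hX0 hgrad 2
      have hdec : Y ≤ X - P.stepConst (κ ^ m) * η / (25 * D ^ 2) * X ^ 2 := by
        have h1 : P.stepConst (κ ^ m) * η / (25 * D ^ 2) * X ^ 2 ≤
            P.stepConst (κ ^ m) * η * (4 / 25 * ‖P.barrierGrad η x.1‖ ^ 2) := by
          calc _ ≤ P.stepConst (κ ^ m) * η / (25 * D ^ 2) *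
                (2 * D * ‖P.barrierGrad η x.1‖) ^ 2 := by gcongr
            _ = _ := by field_simp; ring
        linarith
      push_cast
      exact mul_succ_le_one_of_le_sub_sq (by positivity) hX0 (Nat.cast_nonneg t)
        (hcases.resolve_left (not_le.2 hlg)) hdec
  · rw [hstep.stopped hb]
    exact ⟨hx.feasible, hx.product, hx.stopped, fun hc => by simp [hb] at hc⟩

/-- Safety and convergence of a run with accurate estimates. -/
lemma Convergent.run [Nonempty (Fin m)] (h : P.Convergent κ ν ℓ η e₀ e₁ v D) {T : ℕ}
    {x : ℕ → E × Bool} (hx0 : (x 0).2 = false)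
    (hslater : ∀ i : Fin m, ν ≤ P.V i.succ (x 0).1)
    (hstep : ∀ t < T, P.IsStep η e₀ e₁ (x t) (x (t + 1)))
    (hT : 1 ≤ P.stepConst (κ ^ m) * η / (25 * D ^ 2) * T * (4 * m * η * Real.log (1 / η))) :
    (∀ t ≤ T, P.StrictlyFeasible (x t).1) ∧
      v - P.V 0 (x T).1 ≤ 5 * m * η * Real.log (1 / η) + D * η := by
  have hη := h.small.η_pos
  have hD := h.D_pos
  have hη2 : η ≤ ν := by
    refine le_trans ?_ h.η_le
    exact le_mul_of_one_le_left hη.le (one_le_pow₀ one_le_two)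
  have hinv : ∀ t ≤ T, P.Invariant κ η v (m * η + D * η)
      (P.stepConst (κ ^ m) * η / (25 * D ^ 2)) (4 * m * η * Real.log (1 / η)) t (x t) := by
    intro t
    induction t with
    | zero =>
      exact fun _ => ⟨fun i => hη.trans_le (hη2.trans (hslater i)),
        productBound_of_le h.κ_pos h.κ_le_one hη hη2 hslater,
        fun hc => by simp [hx0] at hc, fun _ => Or.inr (by simp)⟩
    | succ t ih => exact fun ht => (ih (by omega)).step h (hstep t (by omega))
  refine ⟨fun t ht => (hinv t ht).feasible, ?_⟩
  have hf := hinv T le_rfl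
  have hlog1 : 1 ≤ Real.log (1 / η) := by
    have h1 : 0 ≤ Real.log (1 / κ ^ m) := Real.log_nonneg (by
      rw [le_div_iff₀ h.small.c_pos, one_mul]; exact pow_le_one₀ h.κ_pos.le h.κ_le_one)
    linarith [h.log_ge]
  have hmη : 0 ≤ (m : ℝ) * η := by positivity
  rcases hb : (x T).2 with _ | _
  · have hZ : v - P.barrier η (x T).1 ≤ 4 * m * η * Real.log (1 / η) := by
      rcases hf.active hb with h1 | h1
      · exact h1
      by_contra! hcon
      set a := P.stepConst (κ ^ m) * η / (25 * D ^ 2)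
      have haT : 0 < a * T := by
        by_contra! hneg
        have h2 : 0 ≤ 4 * m * η * Real.log (1 / η) := by positivity
        nlinarith
      have := mul_lt_mul_of_pos_right hcon haT
      linarith
    -- Returning from the barrier to the objective costs at most mη log B, the fifth of the mη log
    -- (1 / η) terms.
    have h2 : ∑ i : Fin m, Real.log (P.V i.succ (x T).1) ≤ m * Real.log (1 / η) := by
      refine (Finset.sum_le_card_nsmul _ _ (Real.log (1 / η)) fun i _ => ?_).trans_eq
        (by rw [Finset.card_univ, Fintype.card_fin, nsmul_eq_mul])
      exact (Real.log_le_log (hf.feasible i) (P.V_le _ _)).trans h.log_B_le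
    have h3 := mul_le_mul_of_nonneg_left h2 hη.le
    have hDη : 0 ≤ D * η := by positivity
    rw [barrier] at hZ
    linarith
  · have h1 := hf.stopped hb
    have h2 : (m : ℝ) * η * 1 ≤ m * η * Real.log (1 / η) := mul_le_mul_of_nonneg_left hlog1 hmη
    have h3 : 0 ≤ (m : ℝ) * η * Real.log (1 / η) := by positivity
    linarith

end SmoothProblem

/-! ## The guarantee of LB-SGD for suitable inputs -/

/-- The error bound for the value estimates that LB-SGD uses. -/
noncomputable def valueError (γ : ℝ) (p : LBInput) : ℝ :=
  γ ^ p.H / (1 - γ) + √2 / (√(p.n : ℝ) * (1 - γ)) * √(Real.log (2 / p.δ))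

/-- The error bound for the gradient estimates that LB-SGD uses. -/
noncomputable def gradError (γ : ℝ) (p : LBInput) : ℝ :=
  2 * √2 * p.Mg / (√(p.n : ℝ) * (1 - γ) ^ (3 / 2 : ℝ)) * √(Real.log (Real.exp (1 / 4) / p.δ))
    + p.Mg * γ ^ p.H / (1 - γ) * √(1 / (1 - γ) + p.H)

/-- The conditions on the input of LB-SGD and on the number of iterations that are used in the
analysis. -/
structure Tuned (m : ℕ) (γ ℓ μF ν κ β : ℝ) (p : LBInput) (T : ℕ) : Prop where
  Mg_pos : 0 < p.Mg
  Mh_pos : 0 < p.Mh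
  n_pos : 0 < p.n
  η_pos : 0 < p.η
  η_le_one : p.η ≤ 1
  η_div_le : p.η / 8 ≤ p.Mg / (1 - γ) ^ 2
  value_le : valueError γ p ≤ κ ^ m * p.η / 4
  value_le' : valueError γ p * (2 * m * (p.Mg / (1 - γ) ^ 2) / (κ ^ m) ^ 2) ≤ p.η ^ 2 / 16
  grad_le : gradError γ p * (1 + 2 * m / κ ^ m) ≤ p.η / 16
  κ_pos : 0 < κ
  κ_le_one : κ ≤ 1
  ℓ_pos : 0 < ℓ
  μF_pos : 0 < μF
  κ_mul_le : κ * (3 * 2 ^ m * ((2 + m) * 2 ^ m) * (p.Mg / (1 - γ) ^ 2)) ≤ ℓ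
  η_le : 2 ^ m * p.η ≤ ν
  log_ge : 1 + Real.log (1 / κ ^ m) ≤ Real.log (1 / p.η)
  log_horizon_le : Real.log (1 / (1 - γ)) ≤ Real.log (1 / p.η)
  run_length : 1 ≤ stepLower m ((p.Mg ^ 2 + p.Mh) / (1 - γ) ^ 2) (p.Mg / (1 - γ) ^ 2)
    (1 / (1 - γ)) (κ ^ m) * p.η / (25 * (p.Mg / μF) ^ 2) * T * (4 * m * p.η * Real.log (1 / p.η))
  deviation : ∃ u₀ u₁ q₀ q₁ : ℝ, 0 ≤ u₀ ∧ 0 ≤ u₁ ∧ u₀ + γ ^ p.H / (1 - γ) ≤ valueError γ p ∧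
    u₁ + p.Mg * (γ ^ p.H * (p.H + 1)) / (1 - γ) ^ 2 ≤ gradError γ p ∧
    2 * Real.exp (-(p.n * u₀ ^ 2 * (1 - γ) ^ 2 / 16)) ≤ q₀ ∧
    2 * Real.exp (-(p.n * u₁ ^ 2 * (1 - γ) ^ 4 / (16 * p.Mg ^ 2))) ≤ q₁ ∧
    T * ((m + 1) * (q₀ + q₁)) ≤ β

section Guarantee

variable {S A : Type*} [MeasurableSpace S] [MeasurableSpace A] {m d : ℕ}
  (C : CMDP S A m) (pol : PolicyClass S A d)

/-- The constrained problem that LB-SGD solves. -/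
noncomputable def smoothProblem {Mg Mh : ℝ} (hMg : 0 < Mg) (hMh : 0 < Mh)
    (h : BoundedScore C pol Mg Mh) : SmoothProblem (Param d) m where
  V := val C pol
  g := gradVal C pol
  M := (Mg ^ 2 + Mh) / (1 - C.γ) ^ 2
  L := Mg / (1 - C.γ) ^ 2
  B := 1 / (1 - C.γ)
  M_pos := by have := sub_pos.2 C.γ_lt_one; positivity
  L_pos := by have := sub_pos.2 C.γ_lt_one; positivity
  B_pos := by have := sub_pos.2 C.γ_lt_one; positivity
  continuous_V i := continuous_val C pol _
  taylor i θ v hseg := by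
    have h0 : θ ∈ strictlyFeasible C pol := by
      simpa using! hseg 0 (Set.left_mem_Icc.2 zero_le_one)
    rw [gradVal_eq_policyGrad C h.scoreBoundOn hMg.le h0]
    exact abs_val_taylor_policyGrad_le C h.scoreBoundOn hMg.le i hseg
  norm_g_le i θ hθ := by
    rw [gradVal_eq_policyGrad C h.scoreBoundOn hMg.le hθ]
    exact norm_policyGrad_le C h.scoreBoundOn hθ i
  V_le i θ := (le_abs_self _).trans (abs_value_le C _ i)

variable {C pol} {ℓ μF ν νs κ β e : ℝ} {p : LBInput} {T : ℕ} {πstar : Kernel S A}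
  [IsMarkovKernel πstar] {θ₀ : Param d}

/-- The bias term is constant along the run, so it is subtracted from the target value; relative to
that target, gradient domination has no bias. -/
lemma Tuned.convergent (ht : Tuned m C.γ ℓ μF ν κ β p T)
    (hπ : ∀ i : Fin m, 0 ≤ value C πstar i.succ) (hsc : BoundedScore C pol p.Mg p.Mh)
    (hmf : ExtendedMFCQ C pol ν ℓ) (hF : RelaxedFisher C pol μF)
    (hbias : BoundedTransferError C pol πstar e) :
    (smoothProblem C pol ht.Mg_pos ht.Mh_pos hsc).Convergent κ ν ℓ p.η (valueError C.γ p)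
      (gradError C.γ p) (value C πstar 0 - √e / (1 - C.γ) * (1 + m / κ ^ m)) (p.Mg / μF) where
  small := ⟨pow_pos ht.κ_pos m, ht.η_pos, ht.η_le_one, ht.η_div_le, ht.value_le, ht.value_le',
    ht.grad_le⟩
  κ_pos := ht.κ_pos
  κ_le_one := ht.κ_le_one
  ℓ_pos := ht.ℓ_pos
  D_pos := div_pos ht.Mg_pos ht.μF_pos
  κ_mul_le := ht.κ_mul_le
  η_le := ht.η_le
  log_ge := ht.log_ge
  log_B_le := ht.log_horizon_le
  mfcq θ hθ := by
    obtain ⟨s, hs, hs'⟩ := hmf θ fun i => (hθ i).le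
    exact ⟨s, hs, fun i => hs' i (hθ i)⟩
  domination θ hθ := by
    have hc := pow_pos ht.κ_pos m
    have hη := ht.η_pos
    have hpos : ∀ i : Fin m, 0 < val C pol i.succ θ := fun i => (mul_pos hc hη).trans_le (hθ i)
    have hfe : θ ∈ feasible C pol := fun i => (hpos i).le
    have h1 := gradient_domination C pol πstar ht.μF_pos hη.le hπ (fun z => (hsc θ hfe z).1)
      (hbias θ hfe) (hF θ hfe) hpos
    -- The weights η / V_i are at most κ^(-m). This is the source of the factor ℓ^(-m) (1 - γ)^(-2m)
    -- in front of the bias.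
    have h2 : ∑ i : Fin m, p.η / val C pol i.succ θ ≤ m / κ ^ m := by
      refine (Finset.sum_le_card_nsmul _ _ (1 / κ ^ m) fun i _ => ?_).trans_eq
        (by rw [Finset.card_univ, Fintype.card_fin, nsmul_eq_mul, mul_one_div])
      rw [div_le_div_iff₀ (hpos i) hc, one_mul, mul_comm]
      exact hθ i
    have h3 : √e / (1 - C.γ) * (1 + ∑ i : Fin m, p.η / val C pol i.succ θ) ≤
        √e / (1 - C.γ) * (1 + m / κ ^ m) :=
      mul_le_mul_of_nonneg_left (by linarith)
        (div_nonneg (Real.sqrt_nonneg _) (sub_pos.2 C.γ_lt_one).le)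
    change value C πstar 0 - _ - val C pol 0 θ ≤ m * p.η + p.Mg / μF * ‖gradVal C pol 0 θ +
      p.η • ∑ i : Fin m, (val C pol i.succ θ)⁻¹ • gradVal C pol i.succ θ‖
    linarith

lemma isStep_lbStep (hMg : 0 < p.Mg) (hMh : 0 < p.Mh) (hsc : BoundedScore C pol p.Mg p.Mh)
    {x : Param d × Bool} {b : Batch S A p}
    (hb : x.1 ∈ strictlyFeasible C pol →
      AccurateBatch C pol p (valueError C.γ p) (gradError C.γ p) x.1 b) :
    (smoothProblem C pol hMg hMh hsc).IsStep p.η (valueError C.γ p) (gradError C.γ p) x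
      (lbStep C pol p x b) where
  stopped h := by simp [lbStep, h]
  active h hfe := by
    obtain ⟨h1, h2⟩ := hb hfe
    refine ⟨fun i => valHat C p i b, fun i => gradHat C pol p i x.1 b, ⟨h1, h2⟩, fun hle => ?_,
      fun hgt => ⟨fun i => alphaLow C p i b, fun i => betaUp C pol p i x.1 b,
        stepsize C pol p x.1 b, fun i => ?_, fun i => ?_, rfl, ?_⟩⟩
    · change ‖barrierGradHat C pol p x.1 b‖ ≤ p.η / 2 at hle
      simp [lbStep, h, hle]
    · simp only [alphaLow, bias0, sigma0, valueError]
      ring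
    · simp only [betaUp, bias1, sigma1, gradError, ← add_assoc]
      rfl
    · change p.η / 2 < ‖barrierGradHat C pol p x.1 b‖ at hgt
      simp only [lbStep, h, not_le.2 hgt, if_false, Bool.false_eq_true]
      rfl

/-- Safety and convergence of LB-SGD with suitable inputs, with high probability. -/
theorem Tuned.le_measureReal [Nonempty (Fin m)] (ht : Tuned m C.γ ℓ μF ν κ β p T) (hν : ν ≤ νs)
    (hπ : ∀ i : Fin m, 0 ≤ value C πstar i.succ) (hsc : BoundedScore C pol p.Mg p.Mh)
    (hsl : Slater C pol θ₀ νs) (hmf : ExtendedMFCQ C pol ν ℓ) (hF : RelaxedFisher C pol μF)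
    (hbias : BoundedTransferError C pol πstar e) :
    1 - β ≤ (lbLaw C pol p θ₀ T).real
      {ω | (∀ t ≤ T, ∀ i : Fin m, 0 ≤ val C pol i.succ (lbIterate C pol p θ₀ ω t)) ∧
        value C πstar 0 - val C pol 0 (lbIterate C pol p θ₀ ω T) ≤
          5 * m * p.η * Real.log (1 / p.η) + p.Mg / μF * p.η
            + √e / (1 - C.γ) * (1 + m / κ ^ m)} := by
  set e₀ := valueError C.γ p
  set e₁ := gradError C.γ p
  have hU := isOpen_strictlyFeasible C (pol := pol)
  have hacc : 1 - β ≤ (lbLaw C pol p θ₀ T).real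
      {ω | AccurateRun C pol p (strictlyFeasible C pol) e₀ e₁ θ₀ ω} := by
    obtain ⟨u₀, u₁, q₀, q₁, hu₀, hu₁, he₀, he₁, hq₀, hq₁, hβ⟩ := ht.deviation
    have hq : 0 ≤ (m + 1) * (q₀ + q₁) := by
      have := (mul_pos two_pos (Real.exp_pos _)).le.trans hq₀
      have := (mul_pos two_pos (Real.exp_pos _)).le.trans hq₁
      positivity
    have h1 := measure_not_accurateRun_le C pol p hU hq (fun θ hθ =>
      measure_not_accurateBatch_le C p hsc.scoreBoundOn ht.Mg_pos ht.n_pos hθ hu₀ hu₁ he₀ he₁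
        hq₀ hq₁) θ₀ T
    have h2 := probReal_compl_eq_one_sub (μ := lbLaw C pol p θ₀ T)
      (measurableSet_accurateRun C pol p hU e₀ e₁ θ₀ T)
    rw [Set.compl_ofPred] at h2
    have h3 := ENNReal.toReal_le_of_le_ofReal (mul_nonneg (Nat.cast_nonneg T) hq) h1
    change (lbLaw C pol p θ₀ T).real _ ≤ _ at h3
    linarith
  -- From here on the argument is pathwise, on a run with accurate batches.
  refine hacc.trans (measureReal_mono fun ω hω => ?_)
  have hrun := (ht.convergent hπ hsc hmf hF hbias).run (T := T) (x := lbState C pol p θ₀ ω) rfl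
    (fun i => hν.trans (hsl i)) (fun t htT => ?_) ht.run_length
  · refine ⟨fun t htT i => (hrun.1 t htT i).le, ?_⟩
    have h1 := hrun.2
    change value C πstar 0 - _ - val C pol 0 (lbIterate C pol p θ₀ ω T) ≤ _ at h1
    linarith
  · have e1 : lbState C pol p θ₀ ω (t + 1) =
        lbStep C pol p (lbState C pol p θ₀ ω t) (ω ⟨t, htT⟩) := by
      rw [lbState, dif_pos htT]
    rw [e1]
    exact isStep_lbStep ht.Mg_pos ht.Mh_pos hsc (hω ⟨t, htT⟩)

end Guarantee

/-! ## Choice of the inputs -/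

lemma sqrt_div_sqrt_le {Λ N r ε : ℝ} (hN : 0 < N) (h : Λ ≤ r * ε ^ 4 * N) :
    √Λ / √N ≤ √r * ε ^ 2 := by
  rw [← Real.sqrt_div' _ hN.le]
  refine (Real.sqrt_le_sqrt ((div_le_iff₀ hN).2 h)).trans_eq ?_
  have e : ε ^ 4 = (ε ^ 2) ^ 2 := by ring
  rw [e, Real.sqrt_mul' _ (sq_nonneg _), Real.sqrt_sq (sq_nonneg ε)]

lemma le_sqrt_div_sqrt {Λ N r ε : ℝ} (hN : 0 < N) (h : r * ε ^ 4 * N ≤ Λ) :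
    √r * ε ^ 2 ≤ √Λ / √N := by
  rw [← Real.sqrt_div' _ hN.le]
  refine le_trans (le_of_eq ?_) (Real.sqrt_le_sqrt ((le_div_iff₀ hN).2 h))
  have e : ε ^ 4 = (ε ^ 2) ^ 2 := by ring
  rw [e, Real.sqrt_mul' _ (sq_nonneg _), Real.sqrt_sq (sq_nonneg ε)]

lemma pow_le_of_le_mul_log {γ ε : ℝ} {H : ℕ} (hγ0 : 0 < γ) (hγ1 : γ < 1) (hε : 0 < ε)
    (h : 4 / Real.log (1 / γ) * Real.log (1 / ε) ≤ H) : γ ^ H ≤ ε ^ 4 := by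
  have hl : 0 < Real.log (1 / γ) := Real.log_pos ((one_lt_div hγ0).2 hγ1)
  rw [← Real.log_le_log_iff (by positivity) (by positivity), Real.log_pow, Real.log_pow]
  rw [div_mul_eq_mul_div, div_le_iff₀ hl, one_div, one_div, Real.log_inv, Real.log_inv] at h
  push_cast
  linarith

lemma valueError_eq (γ : ℝ) (p : LBInput) : valueError γ p =
    γ ^ p.H / (1 - γ) + √2 / (1 - γ) * (√(Real.log (2 / p.δ)) / √(p.n : ℝ)) := by
  rw [valueError, div_mul_div_comm, div_mul_eq_mul_div, mul_comm (1 - γ)]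

lemma gradError_eq (γ : ℝ) (p : LBInput) : gradError γ p =
    2 * √2 * p.Mg / (1 - γ) ^ (3 / 2 : ℝ) *
        (√(Real.log (Real.exp (1 / 4) / p.δ)) / √(p.n : ℝ))
      + p.Mg * γ ^ p.H / (1 - γ) * √(1 / (1 - γ) + p.H) := by
  rw [gradError, div_mul_div_comm, div_mul_eq_mul_div (2 * √2 * p.Mg),
    mul_comm ((1 - γ) ^ (3 / 2 : ℝ))]

lemma rpow_three_halves_sq {x : ℝ} (hx : 0 ≤ x) : (x ^ (3 / 2 : ℝ)) ^ 2 = x ^ 3 := by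
  rw [← Real.rpow_natCast, ← Real.rpow_mul hx, ← Real.rpow_natCast]
  norm_num

/-- The choice of inputs in terms of the accuracy: with `l = log (1 / ε)`, sample size of order
`l / ε ^ 4`, horizon of order `l` and `1 / ε ^ 2` iterations. -/
structure Schedule (γ a h τ l ε : ℝ) (p : LBInput) (T : ℕ) : Prop where
  ε_pos : 0 < ε
  ε_le_one : ε ≤ 1
  l_eq : l = Real.log (1 / ε)
  one_le_l : 1 ≤ l
  Mg_pos : 0 < p.Mg
  n_ge : a * l ≤ ε ^ 4 * p.n
  n_le : ε ^ 4 * p.n ≤ 2 * (a * l)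
  H_ge : h * l ≤ p.H
  H_le : (p.H : ℝ) ≤ h * l + 1
  T_ge : τ ≤ ε ^ 2 * T
  T_le : ε ^ 2 * T ≤ τ + 1
  δ_eq : p.δ = Real.exp (-(24 / (1 - γ) * l))
  γ_pos : 0 < γ
  γ_lt_one : γ < 1
  h_eq : h = 4 / Real.log (1 / γ)
  a_pos : 0 < a
  τ_pos : 0 < τ

namespace Schedule

variable {γ a h τ l ε : ℝ} {p : LBInput} {T : ℕ} (s : Schedule γ a h τ l ε p T)
include s

lemma one_sub_pos : 0 < 1 - γ := sub_pos.2 s.γ_lt_one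

lemma h_pos : 0 < h := by
  rw [s.h_eq]
  exact div_pos four_pos (Real.log_pos ((one_lt_div s.γ_pos).2 s.γ_lt_one))

lemma n_pos : (0 : ℝ) < p.n := by
  have h1 : 0 < ε ^ 4 * p.n :=
    (mul_pos s.a_pos (zero_lt_one.trans_le s.one_le_l)).trans_le s.n_ge
  exact pos_of_mul_pos_right h1 (pow_pos s.ε_pos 4).le

lemma log_two_div : Real.log (2 / p.δ) = Real.log 2 + 24 / (1 - γ) * l := by
  rw [s.δ_eq, Real.log_div two_ne_zero (Real.exp_pos _).ne', Real.log_exp]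
  ring

lemma log_exp_div : Real.log (Real.exp (1 / 4) / p.δ) = 1 / 4 + 24 / (1 - γ) * l := by
  rw [s.δ_eq, ← Real.exp_sub, Real.log_exp]
  ring

lemma pow_H_le : γ ^ p.H ≤ ε ^ 4 := by
  refine pow_le_of_le_mul_log s.γ_pos s.γ_lt_one s.ε_pos ?_
  rw [← s.h_eq, ← s.l_eq]
  exact s.H_ge

lemma mul_l_le_one : ε * l ≤ 1 := by
  have h1 := Real.log_le_sub_one_of_pos (one_div_pos.2 s.ε_pos)
  rw [← s.l_eq] at h1
  have h2 := mul_le_mul_of_nonneg_left h1 s.ε_pos.le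
  rw [mul_sub, mul_one_div_cancel s.ε_pos.ne'] at h2
  linarith [s.ε_pos]

lemma mul_H_le : ε * p.H ≤ h + 1 := by
  have h1 := mul_le_mul_of_nonneg_left s.H_le s.ε_pos.le
  have h2 := mul_le_mul_of_nonneg_left s.mul_l_le_one s.h_pos.le
  linarith [s.ε_le_one]

lemma log_ratio_le {Λ : ℝ} (hΛ : Λ ≤ 1 + 24 / (1 - γ) * l) :
    √Λ / √(p.n : ℝ) ≤ √((24 / (1 - γ) + 1) / a) * ε ^ 2 := by
  refine sqrt_div_sqrt_le s.n_pos ?_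
  have h1 : (24 / (1 - γ) + 1) / a * (a * l) ≤ (24 / (1 - γ) + 1) / a * (ε ^ 4 * p.n) := by
    have := s.one_sub_pos
    have := s.a_pos
    exact mul_le_mul_of_nonneg_left s.n_ge (by positivity)
  have e : (24 / (1 - γ) + 1) / a * (a * l) = (24 / (1 - γ) + 1) * l := by
    have := s.a_pos
    field_simp
  linarith [s.one_le_l]

/-- The upper bound on n matters: the gradient margin must not shrink below the truncation bias that
it has to absorb. -/
lemma le_log_ratio : √(24 / (1 - γ) / (2 * a)) * ε ^ 2 ≤
    √(Real.log (Real.exp (1 / 4) / p.δ)) / √(p.n : ℝ) := by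
  refine le_sqrt_div_sqrt s.n_pos ?_
  rw [s.log_exp_div]
  have h1 : 24 / (1 - γ) / (2 * a) * (ε ^ 4 * p.n) ≤ 24 / (1 - γ) / (2 * a) * (2 * (a * l)) := by
    have := s.one_sub_pos
    have := s.a_pos
    exact mul_le_mul_of_nonneg_left s.n_le (by positivity)
  have e : 24 / (1 - γ) / (2 * a) * (2 * (a * l)) = 24 / (1 - γ) * l := by
    have := s.a_pos
    field_simp
  linarith

/-- The constant a makes the statistical part A ε² / 2, and γ^H ≤ ε⁴ puts the truncation part below
the same amount. -/
lemma valueError_le {A : ℝ} (hA : 0 < A) (ha : a = 8 * (24 / (1 - γ) + 1) / ((1 - γ) * A) ^ 2)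
    (hε : ε ≤ (1 - γ) * A / 2) : valueError γ p ≤ A * ε ^ 2 := by
  have hg := s.one_sub_pos
  rw [valueError_eq]
  have h1 := s.log_ratio_le (Λ := Real.log (2 / p.δ)) (by
    rw [s.log_two_div]
    linarith [Real.log_two_lt_d9])
  have h2 : √2 / (1 - γ) * √((24 / (1 - γ) + 1) / a) = A / 2 := by
    have e : (24 / (1 - γ) + 1) / a = ((1 - γ) * A) ^ 2 / 8 := by
      rw [ha]
      field_simp
    rw [e, div_mul_eq_mul_div, ← Real.sqrt_mul zero_le_two]
    have e2 : (2 : ℝ) * (((1 - γ) * A) ^ 2 / 8) = ((1 - γ) * A / 2) ^ 2 := by ring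
    rw [e2, Real.sqrt_sq (by positivity)]
    field_simp
  have h3 : √2 / (1 - γ) * (√(Real.log (2 / p.δ)) / √(p.n : ℝ)) ≤ A / 2 * ε ^ 2 := by
    rw [← h2, mul_assoc]
    exact mul_le_mul_of_nonneg_left h1 (by positivity)
  have h4 : γ ^ p.H / (1 - γ) ≤ A / 2 * ε ^ 2 := by
    rw [div_le_iff₀ hg]
    refine s.pow_H_le.trans ?_
    have h5 : ε ^ 2 ≤ (1 - γ) * A / 2 := by
      refine le_trans ?_ hε
      rw [sq]
      exact mul_le_of_le_one_left s.ε_pos.le s.ε_le_one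
    have h6 := mul_le_mul_of_nonneg_right h5 (sq_nonneg ε)
    linarith
  linarith

lemma gradError_le : gradError γ p ≤ (2 * √2 * p.Mg / (1 - γ) ^ (3 / 2 : ℝ) *
      √((24 / (1 - γ) + 1) / a) + p.Mg / (1 - γ) * (1 / (1 - γ) + h + 2)) * ε ^ 2 := by
  have hg := s.one_sub_pos
  have hMg := s.Mg_pos
  have hh := s.h_pos
  have hε := s.ε_pos
  rw [gradError_eq, add_mul]
  refine add_le_add ?_ ?_
  · refine (mul_le_mul_of_nonneg_left (s.log_ratio_le ?_) (by positivity)).trans_eq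
      (mul_assoc _ _ _).symm
    rw [s.log_exp_div]
    linarith
  · have h1 : √(1 / (1 - γ) + p.H) ≤ 1 / (1 - γ) + p.H + 1 := by
      rw [Real.sqrt_le_left (by positivity)]
      have : 0 ≤ 1 / (1 - γ) + (p.H : ℝ) := by positivity
      nlinarith
    have h2 : γ ^ p.H * √(1 / (1 - γ) + p.H) ≤ (1 / (1 - γ) + h + 2) * ε ^ 2 := by
      calc _ ≤ ε ^ 4 * (1 / (1 - γ) + p.H + 1) :=
            mul_le_mul s.pow_H_le h1 (Real.sqrt_nonneg _) (by positivity)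
        _ = ε ^ 2 * ε * (ε * (1 / (1 - γ) + 1) + ε * p.H) := by ring
        _ ≤ ε ^ 2 * 1 * (1 * (1 / (1 - γ) + 1) + (h + 1)) := by
            gcongr
            · exact s.ε_le_one
            · exact s.ε_le_one
            · exact s.mul_H_le
        _ = _ := by ring
    calc _ = p.Mg / (1 - γ) * (γ ^ p.H * √(1 / (1 - γ) + p.H)) := by ring
      _ ≤ p.Mg / (1 - γ) * ((1 / (1 - γ) + h + 2) * ε ^ 2) := by gcongr
      _ = _ := by ring

lemma exp_le {x : ℝ} (hx : 3 * l ≤ x) : 2 * Real.exp (-x) ≤ 2 * ε ^ 3 := by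
  have e : ε ^ 3 = Real.exp (-(3 * l)) := by
    rw [s.l_eq, one_div, Real.log_inv, mul_neg, neg_neg, mul_comm, Real.exp_mul,
      Real.exp_log s.ε_pos]
    norm_cast
  rw [e]
  gcongr

/-- Half of the gradient margin 2√2 Mg covers the truncation bias, of order ε³ against ε²; the other
half is u₁. Hoeffding with sample radius Mg / (1 - γ)² loses a factor 1 - γ in the exponent compared
with the scale (1 - γ)^(-3/2) of the algorithm. The choice log (1 / δ) = 24 l / (1 - γ) compensates
for this: each estimate fails with probability at most 2ε³, while T is of order ε⁻². -/
lemma deviation {m : ℕ} {β : ℝ}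
    (hε : p.Mg / (1 - γ) ^ 2 * (h + 2) * ε ≤
      √2 * p.Mg / (1 - γ) ^ (3 / 2 : ℝ) * √(24 / (1 - γ) / (2 * a)))
    (hβ : 4 * (m + 1) * (τ + 1) * ε ≤ β) :
    ∃ u₀ u₁ q₀ q₁ : ℝ, 0 ≤ u₀ ∧ 0 ≤ u₁ ∧ u₀ + γ ^ p.H / (1 - γ) ≤ valueError γ p ∧
    u₁ + p.Mg * (γ ^ p.H * (p.H + 1)) / (1 - γ) ^ 2 ≤ gradError γ p ∧
    2 * Real.exp (-(p.n * u₀ ^ 2 * (1 - γ) ^ 2 / 16)) ≤ q₀ ∧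
    2 * Real.exp (-(p.n * u₁ ^ 2 * (1 - γ) ^ 4 / (16 * p.Mg ^ 2))) ≤ q₁ ∧
    T * ((m + 1) * (q₀ + q₁)) ≤ β := by
  have hg := s.one_sub_pos
  have hMg := s.Mg_pos
  have hh := s.h_pos
  have hε0 := s.ε_pos
  have hn := s.n_pos
  have hl := s.one_le_l
  have hγ := s.γ_pos
  have hq : 0 ≤ 24 / (1 - γ) * l := by positivity
  set r₀ := √(Real.log (2 / p.δ)) / √(p.n : ℝ) with hr₀
  set r₁ := √(Real.log (Real.exp (1 / 4) / p.δ)) / √(p.n : ℝ) with hr₁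
  have hn0 : p.n * r₀ ^ 2 = Real.log 2 + 24 / (1 - γ) * l := by
    rw [hr₀, div_pow, Real.sq_sqrt hn.le, mul_div_cancel₀ _ hn.ne', s.log_two_div,
      Real.sq_sqrt (by linarith [Real.log_two_gt_d9])]
  have hn1 : p.n * r₁ ^ 2 = 1 / 4 + 24 / (1 - γ) * l := by
    rw [hr₁, div_pow, Real.sq_sqrt hn.le, mul_div_cancel₀ _ hn.ne', s.log_exp_div,
      Real.sq_sqrt (by linarith)]
  refine ⟨√2 / (1 - γ) * r₀, √2 * p.Mg / (1 - γ) ^ (3 / 2 : ℝ) * r₁, 2 * ε ^ 3, 2 * ε ^ 3,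
    by positivity, by positivity, ?_, ?_, s.exp_le ?_, s.exp_le ?_, ?_⟩
  · rw [valueError_eq, add_comm]
  · have h1 : p.Mg * (γ ^ p.H * (p.H + 1)) / (1 - γ) ^ 2 ≤
        √2 * p.Mg / (1 - γ) ^ (3 / 2 : ℝ) * r₁ := by
      calc _ = p.Mg / (1 - γ) ^ 2 * (γ ^ p.H * (p.H + 1)) := by ring
        _ ≤ p.Mg / (1 - γ) ^ 2 * (ε ^ 4 * (p.H + 1)) := by gcongr; exact s.pow_H_le
        _ = p.Mg / (1 - γ) ^ 2 * (ε ^ 2 * ε * (ε * p.H + ε)) := by ring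
        _ ≤ p.Mg / (1 - γ) ^ 2 * (ε ^ 2 * ε * ((h + 1) + 1)) := by
            gcongr
            · exact s.mul_H_le
            · exact s.ε_le_one
        _ = p.Mg / (1 - γ) ^ 2 * (h + 2) * ε * ε ^ 2 := by ring
        _ ≤ √2 * p.Mg / (1 - γ) ^ (3 / 2 : ℝ) * √(24 / (1 - γ) / (2 * a)) * ε ^ 2 := by gcongr
        _ ≤ _ := by
            rw [mul_assoc]
            exact mul_le_mul_of_nonneg_left s.le_log_ratio (by positivity)
    have h2 : 0 ≤ p.Mg * γ ^ p.H / (1 - γ) * √(1 / (1 - γ) + p.H) := by positivity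
    rw [gradError_eq]
    have e : 2 * √2 * p.Mg / (1 - γ) ^ (3 / 2 : ℝ) * r₁ =
        2 * (√2 * p.Mg / (1 - γ) ^ (3 / 2 : ℝ) * r₁) := by ring
    linarith
  · have e : p.n * (√2 / (1 - γ) * r₀) ^ 2 * (1 - γ) ^ 2 / 16 = p.n * r₀ ^ 2 / 8 := by
      rw [mul_pow, div_pow, Real.sq_sqrt zero_le_two]
      field_simp
      ring
    rw [e, hn0]
    have h1 : 24 * l ≤ 24 / (1 - γ) * l := by
      refine mul_le_mul_of_nonneg_right ?_ (by linarith)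
      rw [le_div_iff₀ hg]
      linarith
    linarith [Real.log_two_gt_d9]
  · have e : p.n * (√2 * p.Mg / (1 - γ) ^ (3 / 2 : ℝ) * r₁) ^ 2 * (1 - γ) ^ 4 / (16 * p.Mg ^ 2) =
        (1 - γ) * (p.n * r₁ ^ 2) / 8 := by
      rw [mul_pow, div_pow, mul_pow, Real.sq_sqrt zero_le_two, rpow_three_halves_sq hg.le]
      field_simp
      ring
    rw [e, hn1]
    have h1 : (1 - γ) * (24 / (1 - γ) * l) = 24 * l := by field_simp
    linarith
  · calc (T : ℝ) * ((m + 1) * (2 * ε ^ 3 + 2 * ε ^ 3)) = 4 * (m + 1) * (ε ^ 2 * T) * ε := by ring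
      _ ≤ 4 * (m + 1) * (τ + 1) * ε := by gcongr; exact s.T_le
      _ ≤ β := hβ

/-- The product of the three sizes is of order l² / ε⁶. For l large, one further factor l exceeds
all the problem-dependent constants divided by W. -/
lemma cost_le {W : ℝ} (hW : 0 < W) (hl : 2 * a * (h + 1) * (τ + 1) / W ≤ l) :
    ((p.n * p.H * T : ℕ) : ℝ) ≤ W * ((ε ^ 6)⁻¹ * l ^ 3) := by
  have hε := s.ε_pos
  have hl1 := s.one_le_l
  have ha := s.a_pos
  have hh := s.h_pos
  have hτ := s.τ_pos
  rw [mul_left_comm, inv_mul_eq_div, le_div_iff₀ (by positivity)]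
  push_cast
  calc (p.n : ℝ) * p.H * T * ε ^ 6 = (ε ^ 4 * p.n) * p.H * (ε ^ 2 * T) := by ring
    _ ≤ (2 * (a * l)) * ((h + 1) * l) * (τ + 1) := by
        have hH : (p.H : ℝ) ≤ (h + 1) * l := by linarith [s.H_le]
        exact mul_le_mul (mul_le_mul s.n_le hH (by positivity) (by positivity)) s.T_le
          (by positivity) (by positivity)
    _ = 2 * a * (h + 1) * (τ + 1) * l ^ 2 := by ring
    _ ≤ l * W * l ^ 2 := by
        rw [div_le_iff₀ hW] at hl
        gcongr
    _ = _ := by ring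

end Schedule

lemma exists_schedule {γ a h τ ε Mg Mh : ℝ} (hγ0 : 0 < γ) (hγ1 : γ < 1) (ha : 0 < a) (hτ : 0 < τ)
    (hh : h = 4 / Real.log (1 / γ)) (hMg : 0 < Mg) (hε : 0 < ε) (hε1 : ε ≤ 1) (hεa : ε ≤ a)
    (hl : 1 ≤ Real.log (1 / ε)) :
    ∃ (n H T : ℕ) (δ : ℝ), 0 < δ ∧ δ < 1 ∧
      Schedule γ a h τ (Real.log (1 / ε)) ε ⟨Mg, Mh, ε, δ, n, H⟩ T := by
  have hg : 0 < 1 - γ := sub_pos.2 hγ1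
  have hh0 : 0 < h := by
    rw [hh]; exact div_pos four_pos (Real.log_pos ((one_lt_div hγ0).2 hγ1))
  set l := Real.log (1 / ε) with hldef
  have hl0 : 0 < l := by linarith
  have hn0 : 0 ≤ a * l / ε ^ 4 := by positivity
  have hn1 := Nat.le_ceil (a * l / ε ^ 4)
  have hn2 := (Nat.ceil_lt_add_one hn0).le
  have hT1 := Nat.le_ceil (τ / ε ^ 2)
  have hT2 := (Nat.ceil_lt_add_one (show 0 ≤ τ / ε ^ 2 by positivity)).le
  have hε2 : ε ^ 2 ≤ 1 := pow_le_one₀ hε.le hε1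
  have hε4 : ε ^ 4 ≤ a * l := by
    have h1 : ε ^ 4 ≤ ε := pow_le_of_le_one hε.le hε1 (by norm_num)
    have h2 : a * 1 ≤ a * l := mul_le_mul_of_nonneg_left hl ha.le
    linarith
  refine ⟨⌈a * l / ε ^ 4⌉₊, ⌈h * l⌉₊, ⌈τ / ε ^ 2⌉₊, Real.exp (-(24 / (1 - γ) * l)),
    Real.exp_pos _, ?_, ?_⟩
  · rw [Real.exp_lt_one_iff, neg_lt_zero]
    positivity
  · refine ⟨hε, hε1, hldef, hl, hMg, ?_, ?_, Nat.le_ceil _,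
      (Nat.ceil_lt_add_one (by positivity)).le, ?_, ?_, rfl, hγ0, hγ1, hh, ha, hτ⟩
    · rw [div_le_iff₀ (by positivity)] at hn1
      linarith
    · have h1 := mul_le_mul_of_nonneg_left hn2 (pow_pos hε 4).le
      rw [mul_add, mul_div_cancel₀ _ (pow_pos hε 4).ne'] at h1
      simp only
      linarith
    · rw [div_le_iff₀ (by positivity)] at hT1
      linarith
    · have h1 := mul_le_mul_of_nonneg_left hT2 (pow_pos hε 2).le
      rw [mul_add, mul_div_cancel₀ _ (pow_pos hε 2).ne'] at h1
      linarith

open Filter Topology in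
lemma eventually_le_log_inv (y : ℝ) : ∀ᶠ ε : ℝ in 𝓝[>] 0, y ≤ Real.log (1 / ε) := by
  have h : Tendsto (fun ε : ℝ => Real.log (1 / ε)) (𝓝[>] 0) atTop := by
    simp only [one_div]
    exact Real.tendsto_log_atTop.comp tendsto_inv_nhdsGT_zero
  exact h.eventually_ge_atTop y

open Filter Topology in
lemma eventually_mul_le {x y : ℝ} (hx : 0 < x) : ∀ᶠ ε : ℝ in 𝓝[>] 0, y * ε ≤ x := by
  have h : Tendsto (fun ε : ℝ => y * ε) (𝓝[>] 0) (𝓝 (y * 0)) :=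
    (tendsto_id.const_mul y).mono_left nhdsWithin_le_nhds
  rw [mul_zero] at h
  exact h.eventually_le_const hx

/-- Suitable inputs exist for all small accuracies. -/
theorem exists_tuned {m : ℕ} (hm : 1 ≤ m) {Mg Mh γ ℓ μF ν κ β W : ℝ} (hMg : 0 < Mg) (hMh : 0 < Mh)
    (hγ0 : 0 < γ) (hγ1 : γ < 1) (hℓ : 0 < ℓ) (hμF : 0 < μF) (hν : 0 < ν) (hκ0 : 0 < κ)
    (hκ1 : κ ≤ 1) (hκ : κ * (3 * 2 ^ m * ((2 + m) * 2 ^ m) * (Mg / (1 - γ) ^ 2)) ≤ ℓ)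
    (hβ : 0 < β) (hW : 0 < W) :
    ∃ ε₀ : ℝ, 0 < ε₀ ∧ ∀ ε : ℝ, 0 < ε → ε ≤ ε₀ → ∃ (n H T : ℕ) (δ : ℝ), 0 < δ ∧ δ < 1 ∧
      ((n * H * T : ℕ) : ℝ) ≤ W * ((ε ^ 6)⁻¹ * Real.log (1 / ε) ^ 3) ∧
      Tuned m γ ℓ μF ν κ β ⟨Mg, Mh, ε, δ, n, H⟩ T := by
  have hg : 0 < 1 - γ := sub_pos.2 hγ1
  have hm0 : (1 : ℝ) ≤ m := by exact_mod_cast hm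
  set c := κ ^ m with hc
  have hc0 : 0 < c := pow_pos hκ0 m
  set L := Mg / (1 - γ) ^ 2 with hL
  have hL0 : 0 < L := by positivity
  -- The two terms answer the two requirements on the value error, one linear and one quadratic in
  -- ε.
  set A := min (c / 4) (c ^ 2 / (32 * m * L)) with hA
  have hA0 : 0 < A := lt_min (by positivity) (by positivity)
  set a := 8 * (24 / (1 - γ) + 1) / ((1 - γ) * A) ^ 2 with ha
  have ha0 : 0 < a := by positivity
  set h := 4 / Real.log (1 / γ) with hh
  have hh0 : 0 < h := div_pos four_pos (Real.log_pos ((one_lt_div hγ0).2 hγ1))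
  set σ := stepLower m ((Mg ^ 2 + Mh) / (1 - γ) ^ 2) L (1 / (1 - γ)) c with hσ
  have hσ0 : 0 < σ := stepLower_pos m (by positivity) hL0 (by positivity) hc0
  -- With ε² T ≥ τ the contraction constant times T times Z is at least 4m log (1 / ε) ≥ 1.
  set τ := 25 * (Mg / μF) ^ 2 / σ with hτ
  have hτ0 : 0 < τ := by positivity
  set A₁ := 2 * √2 * Mg / (1 - γ) ^ (3 / 2 : ℝ) * √((24 / (1 - γ) + 1) / a) +
    Mg / (1 - γ) * (1 / (1 - γ) + h + 2) with hA₁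
  -- With the problem constants fixed, every requirement on ε is either an upper bound or a lower
  -- bound on log (1 / ε), hence holds for all small positive ε.
  have hev : ∀ᶠ ε : ℝ in nhdsWithin 0 (Set.Ioi 0), ∃ (n H T : ℕ) (δ : ℝ), 0 < δ ∧ δ < 1 ∧
      ((n * H * T : ℕ) : ℝ) ≤ W * ((ε ^ 6)⁻¹ * Real.log (1 / ε) ^ 3) ∧
      Tuned m γ ℓ μF ν κ β ⟨Mg, Mh, ε, δ, n, H⟩ T := by
    have hdev : 0 < √2 * Mg / (1 - γ) ^ (3 / 2 : ℝ) * √(24 / (1 - γ) / (2 * a)) := by positivity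
    filter_upwards [self_mem_nhdsWithin, eventually_mul_le (y := 1) one_pos,
      eventually_mul_le (y := 1) ha0, eventually_le_log_inv 1,
      eventually_mul_le (y := 1 / 8) hL0, eventually_mul_le (y := 2 ^ m) hν,
      eventually_le_log_inv (1 + Real.log (1 / c)), eventually_le_log_inv (Real.log (1 / (1 - γ))),
      eventually_le_log_inv (2 * a * (h + 1) * (τ + 1) / W),
      eventually_mul_le (y := 1) (show 0 < (1 - γ) * A / 2 by positivity),
      eventually_mul_le (y := A₁ * (1 + 2 * m / c)) (show (0 : ℝ) < 1 / 16 by norm_num),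
      eventually_mul_le (y := Mg / (1 - γ) ^ 2 * (h + 2)) hdev,
      eventually_mul_le (y := 4 * (m + 1) * (τ + 1)) hβ] with
      ε hε h1 h2 h3 h4 h5 h6 h7 h8 h9 h10 h11 h12
    replace hε : 0 < ε := hε
    rw [one_mul] at h1 h2 h9
    obtain ⟨n, H, T, δ, hδ0, hδ1, s⟩ := exists_schedule (Mh := Mh) hγ0 hγ1 ha0 hτ0 hh hMg hε h1 h2 h3
    refine ⟨n, H, T, δ, hδ0, hδ1, s.cost_le hW h8, ?_⟩
    have hve := s.valueError_le hA0 ha h9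
    have hge := s.gradError_le
    refine ⟨hMg, hMh, by exact_mod_cast s.n_pos, hε, h1, ?_, ?_, ?_, ?_, hκ0, hκ1, hℓ, hμF, hκ, h5,
      h6, h7, ?_, s.deviation h11 h12⟩
    · simp only
      linarith
    · refine hve.trans ?_
      calc A * ε ^ 2 ≤ c / 4 * ε ^ 1 := by
            exact mul_le_mul (min_le_left _ _) (pow_le_pow_of_le_one hε.le h1 one_le_two)
              (by positivity) (by positivity)
        _ = _ := by rw [pow_one, div_mul_eq_mul_div]
    · calc _ ≤ c ^ 2 / (32 * m * L) * ε ^ 2 * (2 * m * L / c ^ 2) := by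
            refine mul_le_mul_of_nonneg_right (hve.trans ?_) (by positivity)
            exact mul_le_mul_of_nonneg_right (min_le_right _ _) (sq_nonneg ε)
        _ = ε ^ 2 / 16 := by field_simp; norm_num
    · calc _ ≤ A₁ * ε ^ 2 * (1 + 2 * m / c) := mul_le_mul_of_nonneg_right hge (by positivity)
        _ = A₁ * (1 + 2 * m / c) * ε * ε := by ring
        _ ≤ 1 / 16 * ε := mul_le_mul_of_nonneg_right h10 hε.le
        _ = _ := by ring
    · have hT := s.T_ge
      have h13 : σ * τ = 25 * (Mg / μF) ^ 2 := by rw [hτ]; field_simp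
      calc (1 : ℝ) = σ * τ / (25 * (Mg / μF) ^ 2) := by rw [h13]; field_simp
        _ ≤ σ * (ε ^ 2 * T) / (25 * (Mg / μF) ^ 2) * (1 * 1) := by rw [one_mul, mul_one]; gcongr
        _ ≤ σ * (ε ^ 2 * T) / (25 * (Mg / μF) ^ 2) * (4 * m * Real.log (1 / ε)) := by
            refine mul_le_mul_of_nonneg_left ?_ (by positivity)
            exact mul_le_mul (by linarith) h3 zero_le_one (by positivity)
        _ = _ := by ring
  obtain ⟨ε₀, hε₀, hsub⟩ := mem_nhdsGT_iff_exists_Ioc_subset.1 hev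
  exact ⟨ε₀, hε₀, fun ε hε hle => hsub ⟨hε, hle⟩⟩

/-- The constant that relates the lower bound on the constraint values to the constants of the
problem. -/
noncomputable def feasibilityConst (m : ℕ) (Mg : ℝ) : ℝ :=
  3 * 2 ^ m * ((2 + m) * 2 ^ m) * max Mg 1

lemma one_le_feasibilityConst (m : ℕ) (Mg : ℝ) : 1 ≤ feasibilityConst m Mg := by
  have h1 : (1 : ℝ) ≤ 2 ^ m := one_le_pow₀ one_le_two
  have h2 : (1 : ℝ) ≤ max Mg 1 := le_max_right _ _
  have h3 : (1 : ℝ) ≤ 2 + m := by linarith [Nat.cast_nonneg (α := ℝ) m]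
  exact one_le_mul_of_one_le_of_one_le (one_le_mul_of_one_le_of_one_le
    (one_le_mul_of_one_le_of_one_le (by norm_num) h1) (one_le_mul_of_one_le_of_one_le h3 h1)) h2

/-- As κ = ℓ g² / c₁ ≤ 1, the 1 is absorbed into κ^(-m), and κ^(-m) splits into its factors. -/
lemma bias_coefficient_le {m : ℕ} {ℓ g c₁ e : ℝ} (hℓ : 0 < ℓ) (hg : 0 < g)
    (hc₁ : 0 < c₁) (hκ : ℓ * g ^ 2 / c₁ ≤ 1) :
    √e / g * (1 + m / (ℓ * g ^ 2 / c₁) ^ m) ≤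
      (m + 1) * c₁ ^ m * (√e * (ℓ ^ m)⁻¹ * (g ^ (2 * m + 1))⁻¹) := by
  have h1 : 1 ≤ 1 / (ℓ * g ^ 2 / c₁) ^ m := by
    rw [le_div_iff₀ (by positivity), one_mul]
    exact pow_le_one₀ (by positivity) hκ
  calc _ ≤ √e / g * (1 / (ℓ * g ^ 2 / c₁) ^ m + m / (ℓ * g ^ 2 / c₁) ^ m) := by gcongr
    _ = _ := by
      rw [div_pow, mul_pow, ← pow_mul, pow_succ]
      field_simp
      ring

end SafeRL

open SafeRL
theorem mainTheorem2 (m : ℕ) (hm : 1 ≤ m) (Mg Mh : ℝ) (hMg : 0 < Mg) (hMh : 0 < Mh) :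
    ∃ K : ℝ, 0 < K ∧
      ∀ γ ℓ μF νemf νs β : ℝ, 0 < γ → γ < 1 → 0 < ℓ → ℓ ≤ 1 / 2 → 0 < μF →
        0 < νemf → νemf ≤ νs → 0 < β → β < 1 →
      ∃ ε₀ : ℝ, 0 < ε₀ ∧ ∀ ε : ℝ, 0 < ε → ε ≤ ε₀ →
      ∃ (n H T : ℕ) (δ : ℝ), 0 < δ ∧ δ < 1 ∧
        ((n * H * T : ℕ) : ℝ) ≤
          K * (μF⁻¹ * (ε ^ 6)⁻¹ * (ℓ ^ (6 * m))⁻¹ * ((1 - γ) ^ (10 + 12 * m))⁻¹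
            * Real.log (1 / ℓ) * Real.log (1 / ε) ^ 3) ∧
        ∀ (S A : Type*) [MeasurableSpace S] [MeasurableSpace A] (d : ℕ)
          (C : CMDP S A m) (pol : PolicyClass S A d)
          (πstar : Kernel S A) [IsMarkovKernel πstar]
          (θ₀ : Param d) (εbias : ℝ),
          C.γ = γ → 0 ≤ εbias →
          IsOptimalPolicy C πstar →
          BoundedScore C pol Mg Mh →
          Slater C pol θ₀ νs →
          ExtendedMFCQ C pol νemf ℓ →
          RelaxedFisher C pol μF →
          BoundedTransferError C pol πstar εbias →
          let p : LBInput := { Mg := Mg, Mh := Mh, η := ε, δ := δ, n := n, H := H }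
          1 - β ≤ (lbLaw C pol p θ₀ T).real
            {ω | (∀ t ≤ T, ∀ i : Fin m, 0 ≤ val C pol i.succ (lbIterate C pol p θ₀ ω t)) ∧
              value C πstar 0 - val C pol 0 (lbIterate C pol p θ₀ ω T) ≤
                K * (ε * Real.log (1 / ε) + ε / μF)
                  + K * (√εbias * (ℓ ^ m)⁻¹ * ((1 - γ) ^ (2 * m + 1))⁻¹)} := by
  have hc₁ := one_le_feasibilityConst m Mg
  set c₁ := feasibilityConst m Mg with hc₁def
  have hc₁0 : 0 < c₁ := by linarith
  -- The summands serve the logarithmic term, the term Mg ε / μF and the bias term, in this order.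
  set K : ℝ := 5 * m + Mg + (m + 1) * c₁ ^ m with hK
  have hK0 : 0 < K := by positivity
  refine ⟨K, hK0, ?_⟩
  intro γ ℓ μF νemf νs β hγ0 hγ1 hℓ hℓ2 hμF hνemf hνs hβ hβ1
  have hg : 0 < 1 - γ := sub_pos.2 hγ1
  -- The separation of the product bound: ℓ divided by L, up to a factor depending on m and Mg. The
  -- maximum with 1 in c₁ ensures κ ≤ 1.
  set κ := ℓ * (1 - γ) ^ 2 / c₁ with hκ
  have hκ0 : 0 < κ := by positivity
  have hκ1 : κ ≤ 1 := by
    rw [hκ, div_le_one hc₁0]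
    refine le_trans ?_ hc₁
    exact mul_le_one₀ (by linarith) (by positivity) (pow_le_one₀ hg.le (by linarith))
  have hκL : κ * (3 * 2 ^ m * ((2 + m) * 2 ^ m) * (Mg / (1 - γ) ^ 2)) ≤ ℓ := by
    have e : κ * (3 * 2 ^ m * ((2 + m) * 2 ^ m) * (Mg / (1 - γ) ^ 2)) =
        ℓ * (3 * 2 ^ m * ((2 + m) * 2 ^ m) * Mg / c₁) := by
      rw [hκ]; field_simp
    rw [e]
    refine mul_le_of_le_one_right hℓ.le ((div_le_one hc₁0).2 ?_)
    exact mul_le_mul_of_nonneg_left (le_max_left _ _) (by positivity)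
  have hlogℓ : 0 < Real.log (1 / ℓ) := Real.log_pos ((one_lt_div hℓ).2 (by linarith))
  -- W collects the prescribed dependence of the cost on the problem constants; only its positivity
  -- matters, since ε₀ may depend on it.
  obtain ⟨ε₀, hε₀, hall⟩ := exists_tuned hm hMg hMh hγ0 hγ1 hℓ hμF hνemf hκ0 hκ1 hκL hβ
    (W := K * (μF⁻¹ * (ℓ ^ (6 * m))⁻¹ * ((1 - γ) ^ (10 + 12 * m))⁻¹ * Real.log (1 / ℓ)))
    (by positivity)
  refine ⟨ε₀, hε₀, fun ε hε hle => ?_⟩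
  obtain ⟨n, H, T, δ, hδ0, hδ1, hcost, ht⟩ := hall ε hε hle
  refine ⟨n, H, T, δ, hδ0, hδ1, hcost.trans_eq (by ring), ?_⟩
  intro S A _ _ d C pol πstar _ θ₀ εbias hCγ _ hopt hsc hsl hmf hF hbias p
  subst hCγ
  have : Nonempty (Fin m) := ⟨⟨0, hm⟩⟩
  refine (ht.le_measureReal hνs hopt.1 hsc hsl hmf hF hbias).trans
    (measureReal_mono fun ω hω => ⟨hω.1, hω.2.trans ?_⟩)
  have hlogε : 0 ≤ Real.log (1 / ε) := Real.log_nonneg ((one_le_div hε).2 ht.η_le_one)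
  have hKb : (m + 1) * c₁ ^ m ≤ K := by rw [hK]; linarith [Nat.cast_nonneg (α := ℝ) m]
  have hKm : (5 : ℝ) * m ≤ K := by
    have : (0 : ℝ) ≤ (m + 1) * c₁ ^ m := by positivity
    rw [hK]; linarith
  have hKg : Mg ≤ K := by
    have : (0 : ℝ) ≤ (m + 1) * c₁ ^ m := by positivity
    rw [hK]; linarith [Nat.cast_nonneg (α := ℝ) m]
  refine add_le_add ?_ ?_
  · rw [mul_add]
    refine add_le_add ?_ ?_
    · simp only
      rw [mul_assoc]
      exact mul_le_mul_of_nonneg_right hKm (by positivity)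
    · simp only
      rw [div_mul_eq_mul_div, mul_div_assoc]
      exact mul_le_mul_of_nonneg_right hKg (by positivity)
  · refine (bias_coefficient_le hℓ hg hc₁0 hκ1).trans ?_
    exact mul_le_mul_of_nonneg_right hKb (by positivity)
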